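/- **Proposition (Adaptive Estimation).** *Setting.* Let $Z=(X,Y)$ with $X$ in a covariate space $\mathcal X\subset\mathbb R^D$ of diameter at most $\Delta$, where $\Delta>0$ is known; let $\mu$ be the law of $X$ and let $Z_1,\dots,Z_n$ be i.i.d. copies of $Z$. Fix $x\in\mathcal X$. Let $\psi(z;\theta)\in\mathbb R^p$, $\theta\in\Theta\subset\mathbb R^p$, $p\ge1$, be a score with conditional moment $m(x';\theta)=\mathbf E[\psi(Z;\theta)\mid X=x']$, and let $\theta(x)\in\Theta$ satisfy $m(x;\theta(x))=0$. Assume: 1. $\mu$ is $(C,d)$-homogeneous on the ball $B(x,r)$, that is, $\mu(B(x,r))\le C t^{-d}\mu(B(x,tr))$ for all $t\in(0,1)$, with $d,r>0$, and $\mu(B(x,r))\ge q>0$; 2. $m(x;\cdot)$ is the gradient on $\Theta$ of a $\lambda$-strongly convex loss, $\lambda>0$; 3. for each $\theta\in\Theta$, $m(\cdot;\theta)$ is $L_m$-Lipschitz on $\mathcal X$; 4. $\|\psi(z;\theta)\|_\infty\le\psi_{\max}$ for all $z$ and all $\theta\in\Theta$; 5. for each coordinate $j$, the bracketing numbers of $\mathcal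 F_j=\{\psi_j(\cdot;\theta):\theta\in\Theta\}$ satisfy $\log N_{[]}(\mathcal F_j,\epsilon,L_2(Q))\le C_b/\epsilon$ for all $\epsilon\in(0,1]$ and every probability measure $Q$ on the observation space. *Algorithm.* Fix $k\ge1$ and let $n\ge k$. For a set $S$ of indices let $H_k(x,S)$ be the indices in $S$ of the $k$ nearest neighbours of $x$ (ties broken by the smaller index). Run with size $s$ and $B$ sub-samples, the sub-sampled $k$-NN algorithm draws independent sets $S_1,\dots,S_B$, uniform among the $s$-element subsets of $[n]$ and independent of the data, and returns a solution $\hat\theta\in\Theta$ of $\sum_{i}\alpha_i\psi(Z_i;\hat\theta)=0$, where $\alpha_i=\frac1{kB}\sum_{b=1}^B \mathbf 1\{i\in H_k(x,S_b)\}$ (a solution is assumed to exist). *Choice of $s$.* Let $\delta\in(0,1]$ and, for $k\le s\le n$, $$G_\delta(s)=\Delta\sqrt{\tfrac{2ps}{n}\log\tfrac{2pn}{\delta}},\qquad H(s)=\binom ns^{-1}\sum_{|S|=s}\ \max_{i\in H_k(x,S)}\|x-X_i\|_2,\qquad \epsilon_k(s)=\mathbf E[H(s)].$$ Let $s_2$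 be the first $s$, as $s$ decreases from $n$ to $k$, with $H(s)>2G_\delta(s)$; put $s_1=s_2+1$, or $s_1=k$ if there is no such $s$. Put $s_*=9s_1+1$, replaced by $n$ if it exceeds $n$. Let $s^*$ be the least $s\in\{k,\dots,n\}$ with $\epsilon_k(s)\le G_\delta(s)$. Run the algorithm with $s=s_*$ and $B\ge n/s_*$ sub-samples, where $B$ is a fixed function of the sub-sample size. Neither the rule nor the algorithm uses $d$. *Conclusion.* (i) There is a constant $K$ depending only on $k,d,C,r,q,\Delta,\lambda,L_m,\psi_{\max},C_b$ (not on $n,p,\delta,D$) such that, for all $n\ge k$, $p\ge 1$ and $\delta\in(0,1]$, with probability at least $1-2\delta$, $$\|\hat\theta-\theta(x)\|_2\le K\,G_\delta(s^*),$$ and whenever $p\log(2pn/\delta)\le n$, $$G_\delta(s^*)\le K\Big(\frac{n}{p\log(2pn/\delta)}\Big)^{-1/(d+2)},$$ and, with probability at least $1-2\delta$, $\|\hat\theta-\theta(x)\|_2\le K\big(\frac{n}{p\log(2pn/\delta)}\big)^{-1/(d+2)}$. (ii) Let $\delta=1/n$. Then for each $p\ge 1$ there are constants $K,a$, depending only on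 $p$ and the constants listed in (i), such that for all $n\ge\max(k,2)$ the squared error is integrable and $$\sqrt{\mathbf E\|\hat\theta-\theta(x)\|_2^2}\le K(\log n)^a\,n^{-1/(d+2)},$$ that is, the root mean squared error is $\tilde O(n^{-1/(d+2)})$. -/

import Mathlib

open MeasureTheory ProbabilityTheory

universe u v

noncomputable section

/-- The `D`-dimensional Euclidean space. -/
abbrev Euc (D : ℕ) : Type := EuclideanSpace ℝ (Fin D)

/-! ### The `k`-nearest-neighbour kernel -/

open Classical in
/-- `H_k(x,S)`: the indices in `S` of the `k` nearest neighbours of `x` among `(X i)_{i ∈ S}`,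
ties in the distance being broken in favour of the smaller index. -/
def nearestNeighbors {ι : Type*} [LinearOrder ι] {D : ℕ} (k : ℕ) (x : Euc D) (X : ι → Euc D)
    (S : Finset ι) : Finset ι :=
  S.filter fun i =>
    (S.filter fun j => dist x (X j) < dist x (X i) ∨
      (dist x (X j) = dist x (X i) ∧ j < i)).card < k

/-- The largest distance from `x` to one of its `k` nearest neighbours in `S`. -/
def knnRadius {ι : Type*} [LinearOrder ι] {D : ℕ} (k : ℕ) (x : Euc D) (X : ι → Euc D)
    (S : Finset ι) : ℝ :=
  (((nearestNeighbors k x X S).sup fun i => nndist x (X i) : NNReal) : ℝ)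

/-- `ε_k(s)`: expected shrinkage of the `k`-NN kernel on `s` i.i.d. covariates with law `μ`. -/
def expectedShrinkage {D : ℕ} (μ : Measure (Euc D)) (k : ℕ) (x : Euc D) (s : ℕ) : ℝ :=
  ∫ w : Fin s → Euc D, knnRadius k x w Finset.univ ∂(Measure.pi fun _ => μ)

/-- `H(s)`: the complete U-statistic of order `s` estimating `ε_k(s)`. -/
def shrinkageEstimate {D n : ℕ} (k : ℕ) (x : Euc D) (X : Fin n → Euc D) (s : ℕ) : ℝ :=
  (∑ S ∈ (Finset.univ : Finset (Fin n)).powersetCard s, knnRadius k x X S) / (n.choose s : ℝ)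

/-- `G_δ(s) = Δ √(C_{n,p,δ} p s / n)` with `C_{n,p,δ} = 2 log (2pn/δ)`. -/
def threshold (Δ : ℝ) (p n : ℕ) (δ : ℝ) (s : ℕ) : ℝ :=
  Δ * √(2 * Real.log (2 * p * n / δ) * p * s / n)

/-! ### The data-driven rule -/

open Classical in
/-- `s₁ = s₂ + 1`, where `s₂` is the first `s` with `H(s) > 2 G_δ(s)` that is met when
`s` runs down from `n` to `k`; if there is none, `s₁ = k`. -/
def selectedSize {D n : ℕ} (k p : ℕ) (Δ δ : ℝ) (x : Euc D) (X : Fin n → Euc D) : ℕ :=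
  max k (((Finset.Icc k n).filter fun s =>
    2 * threshold Δ p n δ s < shrinkageEstimate k x X s).sup fun s => s + 1)

/-- The sub-sample size `9 s₁ + 1` of the adaptive algorithm. A sub-sample cannot have more than
`n` points, hence the cap. -/
def adaptiveSize {D n : ℕ} (k p : ℕ) (Δ δ : ℝ) (x : Euc D) (X : Fin n → Euc D) : ℕ :=
  min n (9 * selectedSize k p Δ δ x X + 1)

/-- The (unknown) balancing size `s^*`: the least `s ∈ {k,…,n}` with `ε_k(s) ≤ G_δ(s)`. -/
def oracleSize {D : ℕ} (μ : Measure (Euc D)) (k p n : ℕ) (Δ δ : ℝ) (x : Euc D) : ℕ :=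
  sInf {s : ℕ | k ≤ s ∧ s ≤ n ∧ expectedShrinkage μ k x s ≤ threshold Δ p n δ s}

/-! ### The sub-sampled `k`-NN estimating equation -/

open Classical in
/-- The weight `α(X_i)` of observation `i` in the sub-sampled `k`-NN algorithm run with the
`B` sub-samples `S_1,…,S_B`. -/
def knnWeight {D n B : ℕ} (k : ℕ) (x : Euc D) (X : Fin n → Euc D)
    (S : Fin B → Finset (Fin n)) (i : Fin n) : ℝ :=
  (∑ b : Fin B, if i ∈ nearestNeighbors k x X (S b) then (1 : ℝ) / k else 0) / B

/-- The weighted score `Ψ(x; θ) = ∑ i, α(X_i) ψ(Z_i; θ)`. -/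
def knnScore {D p n B : ℕ} {𝒴 : Type*} (k : ℕ) (x : Euc D)
    (ψ : Euc D × 𝒴 → Euc p → Euc p) (z : Fin n → Euc D × 𝒴)
    (S : Fin B → Finset (Fin n)) (θ : Euc p) : Euc p :=
  ∑ i, knnWeight k x (fun j => (z j).1) S i • ψ (z i) θ

/-! ### Assumptions -/

/-- `μ` is `(C,d)`-homogeneous on the open ball `B(x,r)`. -/
def IsHomogeneousOn {D : ℕ} (μ : Measure (Euc D)) (C d : ℝ) (x : Euc D) (r : ℝ) : Prop :=
  ∀ t : ℝ, 0 < t → t < 1 →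
    μ (Metric.ball x r) ≤ ENNReal.ofReal (C * t ^ (-d)) * μ (Metric.ball x (t * r))

/-- `T` is a finite family of `ε`-brackets in `L₂(P)` that covers the class `F`. -/
def IsBracketCover {𝒵 : Type*} [MeasurableSpace 𝒵] (F : Set (𝒵 → ℝ)) (P : Measure 𝒵) (ε : ℝ)
    (T : Finset ((𝒵 → ℝ) × (𝒵 → ℝ))) : Prop :=
  (∀ b ∈ T, Measurable b.1 ∧ Measurable b.2 ∧
    eLpNorm (fun z => b.2 z - b.1 z) 2 P ≤ ENNReal.ofReal ε) ∧
  ∀ f ∈ F, ∃ b ∈ T, ∀ z, b.1 z ≤ f z ∧ f z ≤ b.2 z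

/-- The bracketing number `N_[](F, ε, L₂(P))`. -/
def bracketingNumber {𝒵 : Type*} [MeasurableSpace 𝒵] (F : Set (𝒵 → ℝ)) (P : Measure 𝒵)
    (ε : ℝ) : ℕ∞ :=
  ⨅ (T : Finset ((𝒵 → ℝ) × (𝒵 → ℝ))) (_ : IsBracketCover F P ε T), (T.card : ℕ∞)

/-- The conditional moment model at the target point `x`: `P` is the law of `Z = (X,Y)`, `𝒳` the
covariate space, `Θ` the parameter set, `ψ` the score, `m` the moment and `θ₀ = θ(x)`. -/
structure MomentModel {D p : ℕ} {𝒴 : Type*} [MeasurableSpace 𝒴]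
    (d C r q Δ lam Lm ψmax Cb : ℝ)
    (P : Measure (Euc D × 𝒴)) (𝒳 : Set (Euc D)) (x : Euc D) (Θ : Set (Euc p))
    (ψ : Euc D × 𝒴 → Euc p → Euc p) (m : Euc D → Euc p → Euc p) (θ₀ : Euc p) : Prop where
  isProb : IsProbabilityMeasure P
  target_mem : x ∈ 𝒳
  covariate_mem : ∀ᵐ z ∂P, z.1 ∈ 𝒳
  /-- `Δ` is at least the diameter of the covariate space. -/
  diam_le : ∀ a ∈ 𝒳, ∀ b ∈ 𝒳, dist a b ≤ Δ
  homogeneous : IsHomogeneousOn (P.map Prod.fst) C d x r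
  /-- The ball carries mass, as it does when `x` is in the support of the covariate law. -/
  mass : ENNReal.ofReal q ≤ P.map Prod.fst (Metric.ball x r)
  measurable_score : Measurable (Function.uncurry ψ)
  /-- `m(X; θ) = E[ψ(Z; θ) | X]`. -/
  moment : ∀ θ ∈ Θ, (fun z => m z.1 θ) =ᵐ[P]
    P[fun z => ψ z θ | MeasurableSpace.comap Prod.fst inferInstance]
  /-- `θ(x)` solves `m(x; θ) = 0`. -/
  param_mem : θ₀ ∈ Θ
  moment_eq_zero : m x θ₀ = 0
  /-- `m(x; ·)` is the gradient of a `lam`-strongly convex loss. -/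
  strongConvex : ∃ L : Euc p → ℝ, StrongConvexOn Θ lam L ∧
    ∀ θ ∈ Θ, HasGradientWithinAt L (m x θ) Θ θ
  lipschitz : ∀ θ ∈ Θ, ∀ a ∈ 𝒳, ∀ b ∈ 𝒳, ‖m a θ - m b θ‖ ≤ Lm * ‖a - b‖
  score_bound : ∀ z, ∀ θ ∈ Θ, ∀ j, |ψ z θ j| ≤ ψmax
  /-- `log N_[](F_j, ε, L₂(Q)) ≤ Cb / ε` for each coordinate class
  `F_j = {ψ_j(·; θ) : θ ∈ Θ}` and each probability measure `Q` on the observation space. -/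
  bracketing : ∀ (j : Fin p) (Q : Measure (Euc D × 𝒴)), IsProbabilityMeasure Q →
    ∀ ε : ℝ, 0 < ε → ε ≤ 1 →
      ((bracketingNumber ((fun θ z => ψ z θ j) '' Θ) Q ε : ℕ∞) : ENNReal) ≤
        ENNReal.ofReal (Real.exp (Cb / ε))

/-- `Z_1,…,Z_n` are i.i.d. with law `P`; for each admissible size `s` (between `k` and `n`) there
are `B s ≥ n/s` independent draws `S s b`, uniform over the `s`-element subsets of the `n` indices
and independent of the data. The algorithm run with size `s` uses the draws `S s b`, `b < B s`. -/
structure SubsampledData {D n : ℕ} {𝒴 Ω : Type*} [MeasurableSpace 𝒴] [MeasurableSpace Ω]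
    (k : ℕ) (Pr : Measure Ω) (P : Measure (Euc D × 𝒴)) (Z : Fin n → Ω → Euc D × 𝒴)
    (B : ℕ → ℕ) (S : (s : ℕ) → Fin (B s) → Ω → Finset (Fin n)) : Prop where
  measurable_data : ∀ i, Measurable (Z i)
  law_data : ∀ i, Pr.map (Z i) = P
  indep_data : iIndepFun Z Pr
  draws_ge : ∀ s ∈ Finset.Icc k n, (n : ℝ) / s ≤ B s
  measurable_draws : ∀ s ∈ Finset.Icc k n, ∀ b, Measurable (S s b)
  uniform_draws : ∀ s ∈ Finset.Icc k n, ∀ b,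
    ∀ T ∈ (Finset.univ : Finset (Fin n)).powersetCard s,
      Pr {ω | S s b ω = T} = ((n.choose s : ℕ) : ENNReal)⁻¹
  indep_draws : ∀ s ∈ Finset.Icc k n, iIndepFun (S s) Pr
  indep_draws_data : ∀ s ∈ Finset.Icc k n,
    IndepFun (fun ω i => Z i ω) (fun ω b => S s b ω) Pr

/-- `θhat` is an output of the sub-sampled `k`-NN algorithm, run on the data `Z` with the
data-driven sub-sample size: almost surely it is a point of `Θ` at which the weighted score
vanishes. -/
structure IsAdaptiveKnnEstimator {D p n : ℕ} {𝒴 Ω : Type*} [MeasurableSpace Ω]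
    (k : ℕ) (Δ δ : ℝ) (Pr : Measure Ω) (x : Euc D) (Θ : Set (Euc p))
    (ψ : Euc D × 𝒴 → Euc p → Euc p) (Z : Fin n → Ω → Euc D × 𝒴)
    (B : ℕ → ℕ) (S : (s : ℕ) → Fin (B s) → Ω → Finset (Fin n)) (θhat : Ω → Euc p) :
    Prop where
  measurable : Measurable θhat
  mem : ∀ᵐ ω ∂Pr, θhat ω ∈ Θ
  solves : ∀ᵐ ω ∂Pr,
    knnScore k x ψ (fun i => Z i ω)
      (fun b => S (adaptiveSize k p Δ δ x fun i => (Z i ω).1) b ω) (θhat ω) = 0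

end

/-! Fix a size `s` and a parameter θ. By strong convexity, `lam * ‖θ - θ₀‖ ≤ ‖m x θ‖`
(`strongConvexOn_mul_norm_le`). At a zero of the weighted score, `m x θ` is the sum of a bias and a
noise term, both taken relative to `knnLaw P k x s`, the law of a random `k`-nearest neighbour among
`s` i.i.d. points.

Bias: whether a point is a neighbour depends on covariates only, so each score may be replaced by
its conditional mean. The Lipschitz property then bounds the bias by `|Lm|` times the expected
shrinkage ε_k(s) (`norm_integral_knnLaw_sub_le`).

Noise: the sub-sampled average is an incomplete U-statistic of order `s`. Hoeffding's comparison
(`lintegral_exp_uStatistic_le`) makes the complete statistic behave like a mean of ⌊n/s⌋ independent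
blocks. Drawing at least n/s sub-samples costs only a variance-sized term in the exponent
(`lintegral_exp_draws_le`). The resulting Bernstein inequality feeds a bracketing chain
(`chaining_tail`) with entropy 1/ε, so each coordinate deviates by O(√(log(2pn/δ) s/n)) uniformly in
θ. The factor √p from passing to the Euclidean norm is already part of G_δ(s), so the constants do
not depend on p.

Hence the error is at most a constant times ε_k(s) + G_δ(s), for all sizes simultaneously by a union
bound; this is what permits a data-driven size. On the same event H(s) is within G_δ(s) of ε_k(s),
and monotonicity of ε_k and G_δ shows that the selected size satisfies ε_k ≤ 3 G_δ and is at most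
ten times the oracle size (`adaptiveSize_spec`). This is the oracle inequality
`measure_adaptive_error_le`.

For the rate, homogeneity and the mass of the ball give μ(B(x,t)) ≥ c t^d, hence ε_k(s) =
O(s^(-1/d)) (`expectedShrinkage_le_rpow`), and balancing this with √(s/n) gives the exponent 1/(d+2)
(`threshold_oracleSize_le`). The mean square bound combines the tail at level 1/n with the fact that
the assumptions force Θ to be bounded (`MomentModel.norm_sub_le`). -/

noncomputable section

/-! ### Ranks and nearest neighbours. -/

section NearestNeighbors

variable {ι κ : Type*} [LinearOrder ι] [LinearOrder κ] {D : ℕ}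

open Classical in
/-- The points of `S` that precede `i` in the order by distance to `x`, then by index. -/
def closerPoints (x : Euc D) (X : ι → Euc D) (S : Finset ι) (i : ι) : Finset ι :=
  S.filter fun j => dist x (X j) < dist x (X i) ∨ (dist x (X j) = dist x (X i) ∧ j < i)

lemma mem_nearestNeighbors {k : ℕ} {x : Euc D} {X : ι → Euc D} {S : Finset ι} {i : ι} :
    i ∈ nearestNeighbors k x X S ↔ i ∈ S ∧ (closerPoints x X S i).card < k := by
  simp [nearestNeighbors, closerPoints]

lemma mem_closerPoints {x : Euc D} {X : ι → Euc D} {S : Finset ι} {i j : ι} :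
    j ∈ closerPoints x X S i ↔ j ∈ S ∧
      (dist x (X j) < dist x (X i) ∨ (dist x (X j) = dist x (X i) ∧ j < i)) := by
  simp [closerPoints]

lemma closerPoints_card_lt {x : Euc D} {X : ι → Euc D} {S : Finset ι} {i j : ι}
    (hj : j ∈ closerPoints x X S i) :
    (closerPoints x X S j).card < (closerPoints x X S i).card := by
  apply Finset.card_lt_card
  rw [Finset.ssubset_iff_of_subset]
  · exact ⟨j, hj, fun h => by simp [mem_closerPoints] at h⟩
  · intro l hl
    rw [mem_closerPoints] at *
    refine ⟨hl.1, ?_⟩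
    rcases hj.2 with h | h <;> rcases hl.2 with h' | h'
    · exact Or.inl (h'.trans h)
    · exact Or.inl (h'.1 ▸ h)
    · exact Or.inl (h.1 ▸ h')
    · exact Or.inr ⟨h'.1.trans h.1, h'.2.trans h.2⟩

/-- Ordering by distance and then by index is total, so one of two distinct points precedes the
other and has strictly smaller rank. -/
lemma closerPoints_card_injOn (x : Euc D) (X : ι → Euc D) (S : Finset ι) :
    Set.InjOn (fun i => (closerPoints x X S i).card) S := by
  intro i hi j hj hij
  by_contra hne
  have key : i ∈ closerPoints x X S j ∨ j ∈ closerPoints x X S i := by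
    simp only [mem_closerPoints]
    rcases lt_trichotomy (dist x (X i)) (dist x (X j)) with h | h | h
    · exact Or.inl ⟨hi, Or.inl h⟩
    · rcases lt_or_gt_of_ne hne with h' | h'
      · exact Or.inl ⟨hi, Or.inr ⟨h, h'⟩⟩
      · exact Or.inr ⟨hj, Or.inr ⟨h.symm, h'⟩⟩
    · exact Or.inr ⟨hj, Or.inl h⟩
  rcases key with h | h
  · exact (closerPoints_card_lt h).ne hij
  · exact (closerPoints_card_lt h).ne hij.symm

lemma closerPoints_card_lt_card {x : Euc D} {X : ι → Euc D} {S : Finset ι} {i : ι} (hi : i ∈ S) :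
    (closerPoints x X S i).card < S.card := by
  apply Finset.card_lt_card
  rw [Finset.ssubset_iff_of_subset (fun j hj => (mem_closerPoints.1 hj).1)]
  exact ⟨i, hi, fun h => by simp [mem_closerPoints] at h⟩

lemma nearestNeighbors_subset (k : ℕ) (x : Euc D) (X : ι → Euc D) (S : Finset ι) :
    nearestNeighbors k x X S ⊆ S := fun _ h => (mem_nearestNeighbors.1 h).1

lemma card_nearestNeighbors_le (k : ℕ) (x : Euc D) (X : ι → Euc D) (S : Finset ι) :
    (nearestNeighbors k x X S).card ≤ k := by
  conv_rhs => rw [← Finset.card_range k]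
  refine Finset.card_le_card_of_injOn (fun i => (closerPoints x X S i).card) ?_ ?_
  · intro i hi
    simpa using (mem_nearestNeighbors.1 hi).2
  · exact (closerPoints_card_injOn x X S).mono
      (by exact_mod_cast nearestNeighbors_subset k x X S)

/-- Ranks are injective on `S` with values below `S.card`, so they exhaust `range S.card`; in
particular each rank below `k` is attained. -/
lemma card_nearestNeighbors {k : ℕ} {S : Finset ι} (hk : k ≤ S.card) (x : Euc D)
    (X : ι → Euc D) : (nearestNeighbors k x X S).card = k := by
  classical
  refine le_antisymm (card_nearestNeighbors_le k x X S) ?_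
  have himg : S.image (fun i => (closerPoints x X S i).card) = Finset.range S.card := by
    apply Finset.eq_of_subset_of_card_le
    · intro a ha
      obtain ⟨i, hi, rfl⟩ := Finset.mem_image.1 ha
      exact Finset.mem_range.2 (closerPoints_card_lt_card hi)
    · rw [Finset.card_image_of_injOn (closerPoints_card_injOn x X S), Finset.card_range]
  have hsub : Finset.range k ⊆
      (nearestNeighbors k x X S).image fun i => (closerPoints x X S i).card := by
    intro a ha
    have : a ∈ S.image (fun i => (closerPoints x X S i).card) := by
      rw [himg]; exact Finset.mem_range.2 ((Finset.mem_range.1 ha).trans_le hk)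
    obtain ⟨i, hi, rfl⟩ := Finset.mem_image.1 this
    exact Finset.mem_image.2 ⟨i, mem_nearestNeighbors.2 ⟨hi, Finset.mem_range.1 ha⟩, rfl⟩
  calc k = (Finset.range k).card := (Finset.card_range k).symm
    _ ≤ _ := Finset.card_le_card hsub
    _ ≤ _ := Finset.card_image_le

/-- The embedding has to preserve order because ties are broken by index. Applied to the increasing
enumeration of a sub-sample, this turns nearest-neighbour functionals into fixed kernels of `s`
arguments, the form required of a U-statistic. -/
lemma nearestNeighbors_map (k : ℕ) (x : Euc D) (X : κ → Euc D) (e : ι ↪o κ) (T : Finset ι) :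
    nearestNeighbors k x X (T.map e.toEmbedding) =
      (nearestNeighbors k x (fun i => X (e i)) T).map e.toEmbedding := by
  have hcl : ∀ i, closerPoints x X (T.map e.toEmbedding) (e i) =
      (closerPoints x (fun i => X (e i)) T i).map e.toEmbedding := by
    intro i
    ext j
    simp only [mem_closerPoints, Finset.mem_map, RelEmbedding.coe_toEmbedding]
    constructor
    · rintro ⟨⟨a, ha, rfl⟩, h⟩
      exact ⟨a, ⟨ha, by simpa using h⟩, rfl⟩
    · rintro ⟨a, ⟨ha, h⟩, rfl⟩
      exact ⟨⟨a, ha, rfl⟩, by simpa using h⟩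
  ext j
  simp only [Finset.mem_map, mem_nearestNeighbors, RelEmbedding.coe_toEmbedding]
  constructor
  · rintro ⟨⟨a, ha, rfl⟩, h⟩
    rw [hcl, Finset.card_map] at h
    exact ⟨a, ⟨ha, h⟩, rfl⟩
  · rintro ⟨a, ⟨ha, h⟩, rfl⟩
    refine ⟨⟨a, ha, rfl⟩, ?_⟩
    rwa [hcl, Finset.card_map]

lemma knnRadius_map (k : ℕ) (x : Euc D) (X : κ → Euc D) (e : ι ↪o κ) (T : Finset ι) :
    knnRadius k x X (T.map e.toEmbedding) = knnRadius k x (fun i => X (e i)) T := by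
  simp only [knnRadius, nearestNeighbors_map, Finset.sup_map]
  rfl

lemma knnRadius_nonneg (k : ℕ) (x : Euc D) (X : ι → Euc D) (S : Finset ι) :
    0 ≤ knnRadius k x X S := NNReal.coe_nonneg _

lemma dist_le_knnRadius {k : ℕ} {x : Euc D} {X : ι → Euc D} {S : Finset ι} {i : ι}
    (hi : i ∈ nearestNeighbors k x X S) : dist x (X i) ≤ knnRadius k x X S := by
  rw [knnRadius, ← coe_nndist]
  exact_mod_cast Finset.le_sup (f := fun i => nndist x (X i)) hi

lemma knnRadius_le {k : ℕ} {x : Euc D} {X : ι → Euc D} {S : Finset ι} {t : ℝ} (ht : 0 ≤ t)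
    (h : ∀ i ∈ nearestNeighbors k x X S, dist x (X i) ≤ t) : knnRadius k x X S ≤ t := by
  lift t to NNReal using ht
  rw [knnRadius]
  refine NNReal.coe_le_coe.2 (Finset.sup_le fun i hi => ?_)
  have := h i hi
  rw [← coe_nndist] at this
  exact_mod_cast this

-- A neighbour beyond `t` would be preceded by at least `k` points, so its rank would be too large.
open Classical in
lemma knnRadius_le_of_card {k : ℕ} {x : Euc D} {X : ι → Euc D} {S : Finset ι} {t : ℝ}
    (ht : 0 ≤ t) (h : k ≤ (S.filter fun i => dist x (X i) ≤ t).card) :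
    knnRadius k x X S ≤ t := by
  refine knnRadius_le ht fun i hi => ?_
  by_contra! hlt
  have hsub : (S.filter fun i => dist x (X i) ≤ t) ⊆ closerPoints x X S i := by
    intro j hj
    rw [Finset.mem_filter] at hj
    exact mem_closerPoints.2 ⟨hj.1, Or.inl (hj.2.trans_lt hlt)⟩
  exact absurd (mem_nearestNeighbors.1 hi).2 (not_lt.2 (h.trans (Finset.card_le_card hsub)))

lemma knnRadius_anti {k : ℕ} {x : Euc D} {X : ι → Euc D} {S T : Finset ι} (hST : S ⊆ T)
    (hk : k ≤ S.card) : knnRadius k x X T ≤ knnRadius k x X S := by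
  classical
  refine knnRadius_le_of_card (knnRadius_nonneg ..) ?_
  refine (card_nearestNeighbors hk x X).ge.trans (Finset.card_le_card fun i hi => ?_)
  exact Finset.mem_filter.2 ⟨hST (nearestNeighbors_subset _ _ _ _ hi), dist_le_knnRadius hi⟩

end NearestNeighbors

/-! ### Measurability of the neighbour set and its radius. -/

section Measurability

variable {ι Ω : Type*} [LinearOrder ι] [MeasurableSpace Ω] {D : ℕ}

lemma measurableSet_mem_nearestNeighbors (k : ℕ) (x : Euc D) {X : ι → Ω → Euc D}
    (hX : ∀ i, Measurable (X i)) (S : Finset ι) (i : ι) :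
    MeasurableSet {ω | i ∈ nearestNeighbors k x (fun j => X j ω) S} := by
  classical
  simp only [mem_nearestNeighbors, closerPoints, Finset.card_filter]
  refine (MeasurableSet.const _).inter ?_
  refine measurableSet_lt (α := ℕ) (Finset.measurable_sum _ fun j _ => ?_) measurable_const
  refine Measurable.ite ?_ measurable_const measurable_const
  have hd : ∀ i, Measurable fun ω => dist x (X i ω) := fun i =>
    (measurable_const).dist (hX i)
  exact (measurableSet_lt (hd j) (hd i)).union
    ((measurableSet_eq_fun (hd j) (hd i)).inter (MeasurableSet.const _))

lemma measurable_knnRadius (k : ℕ) (x : Euc D) {X : ι → Ω → Euc D}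
    (hX : ∀ i, Measurable (X i)) (S : Finset ι) :
    Measurable fun ω => knnRadius k x (fun j => X j ω) S := by
  classical
  refine measurable_of_Iic fun t => ?_
  by_cases ht : 0 ≤ t
  · have : (fun ω => knnRadius k x (fun j => X j ω) S) ⁻¹' Set.Iic t =
        ⋂ i ∈ S, {ω | i ∈ nearestNeighbors k x (fun j => X j ω) S}ᶜ ∪
          {ω | dist x (X i ω) ≤ t} := by
      ext ω
      simp only [Set.mem_preimage, Set.mem_Iic, Set.mem_iInter, Set.mem_union,
        Set.mem_compl_iff, Set.mem_ofPred_eq]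
      constructor
      · intro h i _
        by_cases hi : i ∈ nearestNeighbors k x (fun j => X j ω) S
        · exact Or.inr ((dist_le_knnRadius hi).trans h)
        · exact Or.inl hi
      · intro h
        refine knnRadius_le ht fun i hi => ?_
        exact (h i (nearestNeighbors_subset _ _ _ _ hi)).resolve_left (not_not.2 hi)
    rw [this]
    refine Finset.measurableSet_biInter _ fun i _ => ?_
    exact (measurableSet_mem_nearestNeighbors k x hX S i).compl.union
      (measurableSet_le (measurable_const.dist (hX i)) measurable_const)
  · have : (fun ω => knnRadius k x (fun j => X j ω) S) ⁻¹' Set.Iic t = ∅ := by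
      ext ω
      simp only [Set.mem_preimage, Set.mem_Iic, Set.mem_empty_iff_false, iff_false, not_le]
      exact (not_le.1 ht).trans_le (knnRadius_nonneg ..)
    rw [this]; exact MeasurableSet.empty

end Measurability

/-! ### Averages over the nearest neighbours. -/

section Average

variable {ι κ : Type*} [LinearOrder ι] [LinearOrder κ] {D : ℕ} {𝒴 : Type*}

/-- The average of `h` over the `k` nearest neighbours of `x` in the sample `(z i)_{i ∈ S}`. -/
def knnAverage (k : ℕ) (x : Euc D) (h : Euc D × 𝒴 → ℝ) (z : ι → Euc D × 𝒴) (S : Finset ι) : ℝ :=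
  (∑ i ∈ nearestNeighbors k x (fun j => (z j).1) S, h (z i)) / k

lemma knnAverage_map (k : ℕ) (x : Euc D) (h : Euc D × 𝒴 → ℝ) (z : κ → Euc D × 𝒴) (e : ι ↪o κ)
    (T : Finset ι) :
    knnAverage k x h z (T.map e.toEmbedding) = knnAverage k x h (fun i => z (e i)) T := by
  simp only [knnAverage, nearestNeighbors_map, Finset.sum_map]
  rfl

lemma abs_knnAverage_le {k : ℕ} (x : Euc D) {h : Euc D × 𝒴 → ℝ} {M : ℝ} (hM : 0 ≤ M)
    (hh : ∀ z, |h z| ≤ M) (z : ι → Euc D × 𝒴) (S : Finset ι) :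
    |knnAverage k x h z S| ≤ M := by
  rcases Nat.eq_zero_or_pos k with rfl | hk
  · simpa [knnAverage] using hM
  rw [knnAverage, abs_div, Nat.abs_cast, div_le_iff₀ (by positivity)]
  calc _ ≤ ∑ i ∈ nearestNeighbors k x (fun j => (z j).1) S, |h (z i)| :=
        Finset.abs_sum_le_sum_abs _ _
    _ ≤ (nearestNeighbors k x (fun j => (z j).1) S).card • M :=
        Finset.sum_le_card_nsmul _ _ _ fun i _ => hh _
    _ ≤ M * k := by
        rw [nsmul_eq_mul, mul_comm]
        gcongr
        exact_mod_cast card_nearestNeighbors_le ..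

/-- Cauchy–Schwarz; there are at most `k` summands, so dividing by `k` is harmless even when `S` has
fewer than `k` points. -/
lemma knnAverage_sq_le {k : ℕ} (x : Euc D) (h : Euc D × 𝒴 → ℝ) (z : ι → Euc D × 𝒴)
    (S : Finset ι) :
    knnAverage k x h z S ^ 2 ≤ knnAverage k x (fun z => h z ^ 2) z S := by
  rcases Nat.eq_zero_or_pos k with rfl | hk
  · simp [knnAverage]
  rw [knnAverage, knnAverage, div_pow, div_le_div_iff₀ (by positivity) (by positivity)]
  have h1 := sq_sum_le_card_mul_sum_sq (s := nearestNeighbors k x (fun j => (z j).1) S)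
    (f := fun i => h (z i))
  have h2 : ((nearestNeighbors k x (fun j => (z j).1) S).card : ℝ) ≤ k := by
    exact_mod_cast card_nearestNeighbors_le ..
  have h3 : 0 ≤ ∑ i ∈ nearestNeighbors k x (fun j => (z j).1) S, h (z i) ^ 2 :=
    Finset.sum_nonneg fun _ _ => sq_nonneg _
  have hk' : (0 : ℝ) < k := by exact_mod_cast hk
  calc _ ≤ (k * ∑ i ∈ nearestNeighbors k x (fun j => (z j).1) S, h (z i) ^ 2) * k := by
        gcongr
        exact h1.trans (by gcongr)
    _ = _ := by ring

lemma measurable_knnAverage [MeasurableSpace 𝒴] {Ω : Type*} [MeasurableSpace Ω] (k : ℕ)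
    (x : Euc D) {h : Euc D × 𝒴 → ℝ} (hh : Measurable h) {Z : ι → Ω → Euc D × 𝒴}
    (hZ : ∀ i, Measurable (Z i)) (S : Finset ι) :
    Measurable fun ω => knnAverage k x h (fun i => Z i ω) S := by
  classical
  have : (fun ω => knnAverage k x h (fun i => Z i ω) S) = fun ω =>
      (∑ i ∈ S, if i ∈ nearestNeighbors k x (fun j => (Z j ω).1) S then h (Z i ω) else 0) / k := by
    funext ω
    rw [knnAverage, ← Finset.sum_filter]
    congr 2
    ext i
    simp only [Finset.mem_filter]
    exact ⟨fun hi => ⟨nearestNeighbors_subset _ _ _ _ hi, hi⟩, fun hi => hi.2⟩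
  rw [this]
  refine Measurable.div_const (Finset.measurable_sum _ fun i _ => ?_) _
  exact Measurable.ite (measurableSet_mem_nearestNeighbors k x (fun j => (hZ j).fst) S i)
    (hh.comp (hZ i)) measurable_const

end Average

end

noncomputable section

/-! ### Hoeffding's block decomposition of a U-statistic. -/

section UStatistic

lemma measurePreserving_precomp {ι κ 𝒵 : Type*} [Fintype ι] [Fintype κ] [MeasurableSpace 𝒵]
    (P : Measure 𝒵) [IsProbabilityMeasure P] {g : κ → ι} (hg : Function.Injective g) :
    MeasurePreserving (fun (z : ι → 𝒵) j => z (g j)) (Measure.pi fun _ => P)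
      (Measure.pi fun _ => P) := by
  refine ⟨measurable_pi_lambda _ fun j => measurable_pi_apply _, ?_⟩
  have h : iIndepFun (fun (i : ι) (z : ι → 𝒵) => z i) (Measure.pi fun _ => P) :=
    iIndepFun_pi (X := fun _ z => z) fun _ => aemeasurable_id
  rw [(iIndepFun_iff_map_fun_eq_pi_map
    (fun j => (measurable_pi_apply (g j)).aemeasurable)).1 (h.precomp hg)]
  congr 1
  funext j
  exact (measurePreserving_eval (fun _ => P) (g j)).map_eq

/-- Injectivity of the uncurried `e` says that the blocks are disjoint and repeat no index.
Selecting these coordinates and currying gives `m` independent samples of size `s`. -/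
lemma lintegral_prod_blocks {n m s : ℕ} {𝒵 : Type*} [MeasurableSpace 𝒵] (P : Measure 𝒵)
    [IsProbabilityMeasure P] {e : Fin m → Fin s → Fin n} (he : Function.Injective (Function.uncurry e))
    {f : Fin m → (Fin s → 𝒵) → ENNReal} (hf : ∀ l, Measurable (f l)) :
    ∫⁻ z : Fin n → 𝒵, ∏ l, f l (fun i => z (e l i)) ∂(Measure.pi fun _ => P) =
      ∏ l, ∫⁻ w, f l w ∂(Measure.pi fun _ => P) := by
  have h1 := measurePreserving_precomp (κ := Fin m × Fin s) P he
  have h2 : MeasurePreserving (MeasurableEquiv.curry (Fin m) (Fin s) 𝒵)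
      (Measure.pi fun _ => P) (Measure.pi fun _ => Measure.pi fun _ => P) := by
    refine ⟨MeasurableEquiv.measurable _, ?_⟩
    have := Measure.infinitePi_map_curry (ι := Fin m) (κ := Fin s) (fun _ _ => P)
    simpa only [Measure.infinitePi_eq_pi] using this
  have h3 := h2.comp h1
  have hm : Measurable fun w : Fin m → Fin s → 𝒵 => ∏ l, f l (w l) :=
    Finset.measurable_prod _ fun l _ => (hf l).comp (measurable_pi_apply l)
  have h4 := h3.lintegral_comp hm
  refine Eq.trans ?_ (h4.trans ?_)
  · rfl
  · rw [lintegral_prod_eq_prod_lintegral_of_indepFun Finset.univ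
      (fun l (w : Fin m → Fin s → 𝒵) => f l (w l))
      (iIndepFun_pi fun l => (hf l).aemeasurable)
      (fun l => (hf l).comp (measurable_pi_apply l))]
    refine Finset.prod_congr rfl fun l _ => ?_
    exact (measurePreserving_eval (fun _ : Fin m => Measure.pi fun _ : Fin s => P) l).lintegral_comp (hf l)

lemma map_perm_bijOn {n s : ℕ} (σ : Equiv.Perm (Fin n)) (a : Finset (Fin n) → ℝ) :
    ∑ T ∈ (Finset.univ : Finset (Fin n)).powersetCard s, a (T.map σ.toEmbedding) =
      ∑ T ∈ (Finset.univ : Finset (Fin n)).powersetCard s, a T := by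
  refine Finset.sum_nbij' (fun T => T.map σ.toEmbedding) (fun T => T.map σ.symm.toEmbedding)
    ?_ ?_ ?_ ?_ ?_
  · intro T hT; simpa [Finset.mem_powersetCard] using hT
  · intro T hT; simpa [Finset.mem_powersetCard] using hT
  · intro T _; ext; simp
  · intro T _; ext; simp
  · intro T _; rfl

lemma exists_perm_map_eq {n : ℕ} {S T : Finset (Fin n)} (h : S.card = T.card) :
    ∃ τ : Equiv.Perm (Fin n), S.map τ.toEmbedding = T := by
  have e : S ≃ T := Finset.equivOfCardEq h
  refine ⟨e.extendSubtype, ?_⟩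
  apply Finset.eq_of_subset_of_card_le
  · intro j hj
    obtain ⟨i, hi, rfl⟩ := Finset.mem_map.1 hj
    exact e.extendSubtype_mem i hi
  · rw [Finset.card_map, h]

/-- The image of a fixed `s`-set under a uniform permutation is a uniform `s`-set. The sum over σ is
the same for every `s`-set, by right multiplication in the permutation group, so one may sum over
`s`-sets as well and exchange the sums. -/
lemma sum_perm_map {n s : ℕ} (S : Finset (Fin n)) (hS : S.card = s) (a : Finset (Fin n) → ℝ) :
    (n.choose s : ℝ) * ∑ σ : Equiv.Perm (Fin n), a (S.map σ.toEmbedding) =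
      (n.factorial : ℝ) * ∑ T ∈ (Finset.univ : Finset (Fin n)).powersetCard s, a T := by
  have h1 : ∀ T ∈ (Finset.univ : Finset (Fin n)).powersetCard s,
      ∑ σ : Equiv.Perm (Fin n), a (T.map σ.toEmbedding) =
        ∑ σ : Equiv.Perm (Fin n), a (S.map σ.toEmbedding) := by
    intro T hT
    obtain ⟨τ, rfl⟩ := exists_perm_map_eq (hS.trans (Finset.mem_powersetCard.1 hT).2.symm)
    conv_rhs => rw [← Equiv.sum_comp (Equiv.mulRight τ)]
    refine Finset.sum_congr rfl fun σ _ => ?_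
    rw [Finset.map_map]
    rfl
  have h2 : ∑ T ∈ (Finset.univ : Finset (Fin n)).powersetCard s,
      ∑ σ : Equiv.Perm (Fin n), a (T.map σ.toEmbedding) =
        (n.choose s : ℝ) * ∑ σ : Equiv.Perm (Fin n), a (S.map σ.toEmbedding) := by
    rw [Finset.sum_congr rfl h1]
    simp
  rw [← h2, Finset.sum_comm]
  simp only [map_perm_bijOn]
  simp [Fintype.card_perm]

/-- Hoeffding's comparison of a U-statistic with an average over independent blocks. -/
lemma lintegral_exp_uStatistic_le {n m s : ℕ} (hms : m * s ≤ n) {𝒵 : Type*} [MeasurableSpace 𝒵]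
    (P : Measure 𝒵) [IsProbabilityMeasure P] {φ₀ : (Fin s → 𝒵) → ℝ} (hφ₀ : Measurable φ₀)
    {φ : Finset (Fin n) → (Fin n → 𝒵) → ℝ}
    (hφ : ∀ (S : Finset (Fin n)) (h : S.card = s) z,
      φ S z = φ₀ fun i => z (S.orderEmbOfFin h i)) :
    ∫⁻ z, ENNReal.ofReal (Real.exp (m *
        ((∑ S ∈ (Finset.univ : Finset (Fin n)).powersetCard s, φ S z) / (n.choose s : ℝ))))
        ∂(Measure.pi fun _ => P) ≤
      (∫⁻ w, ENNReal.ofReal (Real.exp (φ₀ w)) ∂(Measure.pi fun _ => P)) ^ m := by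
  rcases Nat.eq_zero_or_pos m with rfl | hm
  · simp
  have hsn : s ≤ n := (Nat.le_mul_of_pos_left s hm).trans hms
  have hC : (0 : ℝ) < n.choose s := by exact_mod_cast Nat.choose_pos hsn
  have hF : (0 : ℝ) < n.factorial := by exact_mod_cast Nat.factorial_pos n
  -- The first `m * s` indices are cut into `m` consecutive blocks of length `s`.
  set b : Fin m → Fin s ↪ Fin n := fun l =>
    ⟨fun i => Fin.castLE hms (finProdFinEquiv (l, i)), fun i j h => by
      have := finProdFinEquiv.injective (Fin.castLE_injective hms h)
      simpa using this⟩ with hb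
  set T : Fin m → Finset (Fin n) := fun l => Finset.univ.map (b l) with hT
  have hTcard : ∀ l, (T l).card = s := fun l => by simp [hT]
  have hTdisj : ∀ l l', ∀ i ∈ T l, i ∈ T l' → l = l' := by
    intro l l' i hi hi'
    obtain ⟨u, -, rfl⟩ := Finset.mem_map.1 hi
    obtain ⟨v, -, hv⟩ := Finset.mem_map.1 hi'
    have := finProdFinEquiv.injective (Fin.castLE_injective hms hv)
    exact ((Prod.ext_iff.1 this).1).symm
  have hcard : ∀ (σ : Equiv.Perm (Fin n)) l, ((T l).map σ.toEmbedding).card = s := fun σ l => by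
    rw [Finset.card_map, hTcard]
  have hpt : ∀ z, Real.exp (m *
      ((∑ S ∈ (Finset.univ : Finset (Fin n)).powersetCard s, φ S z) / (n.choose s : ℝ))) ≤
      ∑ σ : Equiv.Perm (Fin n), (n.factorial : ℝ)⁻¹ *
        ∏ l, Real.exp (φ ((T l).map σ.toEmbedding) z) := by
    intro z
    -- The U-statistic is the average over permutations of a mean over `m` disjoint blocks. The
    -- factor `m` cancels the block normalisation, and Jensen's inequality for exp pulls out the
    -- average over σ.
    have h1 : (m : ℝ) *
        ((∑ S ∈ (Finset.univ : Finset (Fin n)).powersetCard s, φ S z) / (n.choose s : ℝ)) =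
        ∑ σ : Equiv.Perm (Fin n), (n.factorial : ℝ)⁻¹ •
          ∑ l, φ ((T l).map σ.toEmbedding) z := by
      rw [← Finset.smul_sum, Finset.sum_comm, smul_eq_mul]
      have h2 : ∀ l, ∑ σ : Equiv.Perm (Fin n), φ ((T l).map σ.toEmbedding) z =
          n.factorial * (∑ S ∈ (Finset.univ : Finset (Fin n)).powersetCard s, φ S z) /
            n.choose s := by
        intro l
        rw [eq_div_iff hC.ne', mul_comm]
        exact sum_perm_map (T l) (hTcard l) fun S => φ S z
      simp only [h2, Finset.sum_const, Finset.card_univ, Fintype.card_fin, nsmul_eq_mul]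
      field_simp
    rw [h1]
    refine (convexOn_exp.map_sum_le (fun _ _ => by positivity) ?_ (fun _ _ => Set.mem_univ _)).trans ?_
    · simp [Fintype.card_perm, hF.ne']
    · refine Finset.sum_le_sum fun σ _ => ?_
      rw [Real.exp_sum, smul_eq_mul]
  have hmeas : Measurable fun w => ENNReal.ofReal (Real.exp (φ₀ w)) := by fun_prop
  calc _ ≤ ∫⁻ z, ∑ σ : Equiv.Perm (Fin n), ENNReal.ofReal (n.factorial : ℝ)⁻¹ *
        ∏ l, ENNReal.ofReal (Real.exp (φ₀ fun i =>
          z (((T l).map σ.toEmbedding).orderEmbOfFin (hcard σ l) i))) ∂(Measure.pi fun _ => P) := by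
        refine lintegral_mono fun z => ?_
        refine (ENNReal.ofReal_le_ofReal (hpt z)).trans ?_
        rw [ENNReal.ofReal_sum_of_nonneg fun _ _ => by positivity]
        refine Finset.sum_le_sum fun σ _ => ?_
        rw [ENNReal.ofReal_mul (by positivity),
          ENNReal.ofReal_prod_of_nonneg fun _ _ => by positivity]
        simp only [hφ _ (hcard σ _), le_refl]
    _ = ∑ σ : Equiv.Perm (Fin n), ENNReal.ofReal (n.factorial : ℝ)⁻¹ *
          (∫⁻ w, ENNReal.ofReal (Real.exp (φ₀ w)) ∂(Measure.pi fun _ => P)) ^ m := by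
        have hmσ : ∀ σ : Equiv.Perm (Fin n), Measurable fun z : Fin n → 𝒵 =>
            ∏ l, ENNReal.ofReal (Real.exp (φ₀ fun i =>
              z (((T l).map σ.toEmbedding).orderEmbOfFin (hcard σ l) i))) := fun σ =>
          Finset.measurable_prod _ fun l _ => hmeas.comp
            (measurable_pi_lambda _ fun i => measurable_pi_apply _)
        rw [lintegral_finsetSum _ fun σ _ => (hmσ σ).const_mul _]
        refine Finset.sum_congr rfl fun σ _ => ?_
        rw [lintegral_const_mul _ (hmσ σ)]
        rw [lintegral_prod_blocks P (e := fun l i =>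
          ((T l).map σ.toEmbedding).orderEmbOfFin (hcard σ l) i)
          (f := fun _ w => ENNReal.ofReal (Real.exp (φ₀ w))) ?_ (fun _ => hmeas)]
        · simp
        · rintro ⟨l, i⟩ ⟨l', i'⟩ h
          simp only [Function.uncurry] at h
          have h1 := Finset.orderEmbOfFin_mem _ (hcard σ l) i
          have h2 := Finset.orderEmbOfFin_mem _ (hcard σ l') i'
          rw [h] at h1
          have hl : l = l' := by
            obtain ⟨u, hu, hu'⟩ := Finset.mem_map.1 h1
            obtain ⟨v, hv, hv'⟩ := Finset.mem_map.1 h2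
            have huv : u = v := σ.injective (hu'.trans hv'.symm)
            exact hTdisj l l' u hu (huv ▸ hv)
          subst hl
          simpa using h
    _ = _ := by
        rw [Finset.sum_const, Finset.card_univ, Fintype.card_perm, Fintype.card_fin,
          nsmul_eq_mul, ← mul_assoc, ← ENNReal.ofReal_natCast, ← ENNReal.ofReal_mul hF.le,
          mul_inv_cancel₀ hF.ne', ENNReal.ofReal_one, one_mul]

end UStatistic

end

noncomputable section

/-! ### Exponential inequalities for complete and incomplete U-statistics. -/

section Concentration

lemma measure_le_of_lintegral_exp {Ω : Type*} [MeasurableSpace Ω] {μ : Measure Ω} {f : Ω → ℝ}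
    (hf : Measurable f) {a : ℝ}
    (h : ∫⁻ ω, ENNReal.ofReal (Real.exp (f ω)) ∂μ ≤ ENNReal.ofReal (Real.exp a)) (b : ℝ) :
    μ {ω | b ≤ f ω} ≤ ENNReal.ofReal (Real.exp (a - b)) := by
  have h1 := mul_meas_ge_le_lintegral (μ := μ)
    (f := fun ω => ENNReal.ofReal (Real.exp (f ω))) (by fun_prop) (ENNReal.ofReal (Real.exp b))
  have h2 : {ω | b ≤ f ω} ⊆ {ω | ENNReal.ofReal (Real.exp b) ≤ ENNReal.ofReal (Real.exp (f ω))} :=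
    fun ω hω => ENNReal.ofReal_le_ofReal (Real.exp_le_exp.2 hω)
  rw [Real.exp_sub, ENNReal.ofReal_div_of_pos (Real.exp_pos _), ENNReal.le_div_iff_mul_le
    (Or.inl (by simp [Real.exp_pos])) (Or.inl ENNReal.ofReal_ne_top), mul_comm]
  exact (mul_le_mul_right (measure_mono h2) _).trans (h1.trans h)

/-- Hoeffding's inequality for U-statistics, upper tail. -/
lemma uStatistic_upper_tail {n m s : ℕ} (hms : m * s ≤ n) (hsn : s ≤ n) {𝒵 : Type*} [MeasurableSpace 𝒵]
    (P : Measure 𝒵) [IsProbabilityMeasure P] {φ₀ : (Fin s → 𝒵) → ℝ} (hφ₀ : Measurable φ₀)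
    {φ : Finset (Fin n) → (Fin n → 𝒵) → ℝ} (hφm : ∀ S, Measurable (φ S))
    (hφ : ∀ (S : Finset (Fin n)) (h : S.card = s) z,
      φ S z = φ₀ fun i => z (S.orderEmbOfFin h i)) {Δ : ℝ} (hΔ : 0 < Δ)
    (hbd : ∀ᵐ w ∂(Measure.pi fun _ => P), φ₀ w ∈ Set.Icc 0 Δ) {t : ℝ} (ht : 0 ≤ t) :
    (Measure.pi fun _ => P) {z | t ≤
      (∑ S ∈ (Finset.univ : Finset (Fin n)).powersetCard s, φ S z) / (n.choose s : ℝ) -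
        ∫ w, φ₀ w ∂(Measure.pi fun _ => P)} ≤
      ENNReal.ofReal (Real.exp (-(2 * m * t ^ 2 / Δ ^ 2))) := by
  set e := ∫ w, φ₀ w ∂(Measure.pi fun _ => P)
  have hC : (0 : ℝ) < n.choose s := by exact_mod_cast Nat.choose_pos hsn
  -- The minimiser of `Δ ^ 2 / 8 * c ^ 2 - c * t`, where Δ²/8 comes from Hoeffding's lemma for a
  -- variable with values in [0, Δ].
  set c := 4 * t / Δ ^ 2 with hc
  have h1 := lintegral_exp_uStatistic_le hms P (φ₀ := fun w => c * (φ₀ w - e))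
    ((hφ₀.sub_const _).const_mul _) (φ := fun S z => c * (φ S z - e))
    (fun S h z => by simp only [hφ S h])
  have hsub := (hasSubgaussianMGF_of_mem_Icc hφ₀.aemeasurable hbd)
  have h2 : ∫⁻ w, ENNReal.ofReal (Real.exp (c * (φ₀ w - e))) ∂(Measure.pi fun _ => P) ≤
      ENNReal.ofReal (Real.exp (Δ ^ 2 / 8 * c ^ 2)) := by
    rw [← ofReal_integral_eq_lintegral_ofReal (hsub.integrable_exp_mul c)
      (Filter.Eventually.of_forall fun _ => (Real.exp_pos _).le)]
    refine ENNReal.ofReal_le_ofReal ((hsub.mgf_le c).trans (Real.exp_le_exp.2 (le_of_eq ?_)))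
    simp only [sub_zero, NNReal.coe_pow, NNReal.coe_div, coe_nnnorm, Real.norm_eq_abs,
      abs_of_pos hΔ, NNReal.coe_ofNat]
    ring
  have h3 := h1.trans (pow_le_pow_left' h2 m)
  rw [← ENNReal.ofReal_pow (Real.exp_pos _).le, ← Real.exp_nat_mul] at h3
  have h4 := measure_le_of_lintegral_exp (by fun_prop) h3 (m * (c * t))
  refine (measure_mono ?_).trans (h4.trans (ENNReal.ofReal_le_ofReal (Real.exp_le_exp.2 (le_of_eq ?_))))
  · intro z hz
    simp only [Set.mem_ofPred_eq] at hz ⊢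
    have : (∑ S ∈ (Finset.univ : Finset (Fin n)).powersetCard s, c * (φ S z - e)) /
        (n.choose s : ℝ) = c * ((∑ S ∈ (Finset.univ : Finset (Fin n)).powersetCard s, φ S z) /
          (n.choose s : ℝ) - e) := by
      rw [← Finset.mul_sum, Finset.sum_sub_distrib, Finset.sum_const, Finset.card_powersetCard,
        Finset.card_univ, Fintype.card_fin, nsmul_eq_mul]
      field_simp
    rw [this]
    have : 0 ≤ c := by positivity
    gcongr
  · rw [hc]; field_simp; ring

/-- Hoeffding's inequality for U-statistics. -/
lemma uStatistic_tail {n m s : ℕ} (hms : m * s ≤ n) (hsn : s ≤ n) {𝒵 : Type*} [MeasurableSpace 𝒵]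
    (P : Measure 𝒵) [IsProbabilityMeasure P] {φ₀ : (Fin s → 𝒵) → ℝ} (hφ₀ : Measurable φ₀)
    {φ : Finset (Fin n) → (Fin n → 𝒵) → ℝ} (hφm : ∀ S, Measurable (φ S))
    (hφ : ∀ (S : Finset (Fin n)) (h : S.card = s) z,
      φ S z = φ₀ fun i => z (S.orderEmbOfFin h i)) {Δ : ℝ} (hΔ : 0 < Δ)
    (hbd : ∀ᵐ w ∂(Measure.pi fun _ => P), φ₀ w ∈ Set.Icc 0 Δ) {t : ℝ} (ht : 0 ≤ t) :
    (Measure.pi fun _ => P) {z | t ≤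
      |(∑ S ∈ (Finset.univ : Finset (Fin n)).powersetCard s, φ S z) / (n.choose s : ℝ) -
        ∫ w, φ₀ w ∂(Measure.pi fun _ => P)|} ≤
      ENNReal.ofReal (2 * Real.exp (-(2 * m * t ^ 2 / Δ ^ 2))) := by
  have hC : (0 : ℝ) < n.choose s := by exact_mod_cast Nat.choose_pos hsn
  have h1 := uStatistic_upper_tail hms hsn P hφ₀ hφm hφ hΔ hbd ht
  -- The lower tail is the upper tail of the reflected kernel `Δ - φ₀`, which also lies in [0, Δ].
  have h2 := uStatistic_upper_tail hms hsn P (φ₀ := fun w => Δ - φ₀ w)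
    (measurable_const.sub hφ₀) (φ := fun S z => Δ - φ S z) (fun S => measurable_const.sub (hφm S))
    (fun S h z => by simp only [hφ S h]) hΔ
    (hbd.mono fun w hw => ⟨by linarith [hw.2], by linarith [hw.1]⟩) ht
  have hint : Integrable φ₀ (Measure.pi fun _ => P) :=
    Integrable.of_bound hφ₀.aestronglyMeasurable Δ
      (hbd.mono fun w hw => by rw [Real.norm_eq_abs, abs_of_nonneg hw.1]; exact hw.2)
  have he : ∫ w, (Δ - φ₀ w) ∂(Measure.pi fun _ => P) = Δ - ∫ w, φ₀ w ∂(Measure.pi fun _ => P) := by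
    rw [integral_sub (integrable_const _) hint]; simp
  rw [two_mul, ENNReal.ofReal_add (Real.exp_pos _).le (Real.exp_pos _).le]
  refine (measure_mono ?_).trans ((measure_union_le _ _).trans (add_le_add h1 h2))
  intro z hz
  rw [Set.mem_ofPred_eq] at hz
  rcases le_abs.1 hz with h | h
  · exact Or.inl h
  · right
    simp only [Set.mem_ofPred_eq]
    rw [he, Finset.sum_sub_distrib, Finset.sum_const, Finset.card_powersetCard,
        Finset.card_univ, Fintype.card_fin, nsmul_eq_mul, sub_div, mul_div_cancel_left₀ _ hC.ne']
    linarith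

/-- The uniform law on the `s`-element subsets of `Fin n`. -/
def uniformSubsets (n s : ℕ) : Measure (Finset (Fin n)) :=
  ((n.choose s : ℕ) : ENNReal)⁻¹ •
    ∑ T ∈ (Finset.univ : Finset (Fin n)).powersetCard s, Measure.dirac T

lemma lintegral_uniformSubsets (n s : ℕ) (f : Finset (Fin n) → ENNReal) :
    ∫⁻ T, f T ∂(uniformSubsets n s) = ((n.choose s : ℕ) : ENNReal)⁻¹ *
      ∑ T ∈ (Finset.univ : Finset (Fin n)).powersetCard s, f T := by
  simp [uniformSubsets, lintegral_smul_measure]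

lemma isProbabilityMeasure_uniformSubsets {n s : ℕ} (h : s ≤ n) :
    IsProbabilityMeasure (uniformSubsets n s) := by
  refine ⟨?_⟩
  rw [← lintegral_one, lintegral_uniformSubsets]
  have : (n.choose s : ENNReal) ≠ 0 := by exact_mod_cast (Nat.choose_pos h).ne'
  simp [ENNReal.inv_mul_cancel this]

lemma lintegral_prod_pi {ι 𝒯 : Type*} [Fintype ι] [MeasurableSpace 𝒯] (U : Measure 𝒯)
    [IsProbabilityMeasure U] {f : 𝒯 → ENNReal} (hf : Measurable f) :
    ∫⁻ S : ι → 𝒯, ∏ b, f (S b) ∂(Measure.pi fun _ => U) =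
      (∫⁻ T, f T ∂U) ^ Fintype.card ι := by
  rw [lintegral_prod_eq_prod_lintegral_of_indepFun Finset.univ
      (fun b (S : ι → 𝒯) => f (S b)) (iIndepFun_pi fun _ => hf.aemeasurable)
      (fun b => hf.comp (measurable_pi_apply b))]
  rw [← Finset.card_univ, ← Finset.prod_const]
  exact Finset.prod_congr rfl fun b _ =>
    (measurePreserving_eval (fun _ : ι => U) b).lintegral_comp hf

lemma exp_le_one_add_add_sq {y : ℝ} (hy : |y| ≤ 1) : Real.exp y ≤ 1 + y + y ^ 2 := by
  have := (abs_le.1 (Real.abs_exp_sub_one_sub_id_le hy)).2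
  linarith

/-- With the data fixed, the draws are independent. For q = m/B ≤ 1, exp(q c a) ≤ 1 + q (c a + (c
a)²), because q² ≤ q, and the power `B` turns q back into `m`. Averaging over random sub-samples
thus replaces the kernel `c a` by `c a + (c a)²` in the complete statistic, as soon as `m ≤ B`. -/
lemma lintegral_exp_draws_le {n m s B : ℕ} (hsn : s ≤ n) (hmB : m ≤ B) (hm : 1 ≤ m)
    {a : Finset (Fin n) → ℝ} {c : ℝ} (ha : ∀ S, |c * a S| ≤ 1) :
    ∫⁻ S : Fin B → Finset (Fin n), ENNReal.ofReal (Real.exp (c * m * ((∑ b, a (S b)) / B)))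
        ∂(Measure.pi fun _ => uniformSubsets n s) ≤
      ENNReal.ofReal (Real.exp (m * ((∑ S ∈ (Finset.univ : Finset (Fin n)).powersetCard s,
        (c * a S + (c * a S) ^ 2)) / (n.choose s : ℝ)))) := by
  have := isProbabilityMeasure_uniformSubsets hsn
  have hC : (0 : ℝ) < n.choose s := by exact_mod_cast Nat.choose_pos hsn
  have hB : (0 : ℝ) < B := by exact_mod_cast hm.trans hmB
  have hm0 : (0 : ℝ) < m := by exact_mod_cast hm
  have hq1 : (m : ℝ) / B ≤ 1 := by rw [div_le_one hB]; exact_mod_cast hmB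
  have hq0 : (0 : ℝ) < (m : ℝ) / B := by positivity
  set q : ℝ := (m : ℝ) / B with hq
  have h1 : ∀ S : Fin B → Finset (Fin n),
      ENNReal.ofReal (Real.exp (c * m * ((∑ b, a (S b)) / B))) =
        ∏ b, ENNReal.ofReal (Real.exp (q * (c * a (S b)))) := by
    intro S
    rw [← ENNReal.ofReal_prod_of_nonneg fun _ _ => (Real.exp_pos _).le, ← Real.exp_sum,
      ← Finset.mul_sum, ← Finset.mul_sum]
    congr 2
    rw [hq]; ring
  simp only [h1]
  rw [lintegral_prod_pi _ (f := fun T => ENNReal.ofReal (Real.exp (q * (c * a T))))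
    (measurable_of_finite _), lintegral_uniformSubsets, Fintype.card_fin]
  set A : ℝ := (∑ S ∈ (Finset.univ : Finset (Fin n)).powersetCard s,
        (c * a S + (c * a S) ^ 2)) / (n.choose s : ℝ) with hA
  have h2 : ((n.choose s : ℕ) : ENNReal)⁻¹ * ∑ T ∈ (Finset.univ : Finset (Fin n)).powersetCard s,
      ENNReal.ofReal (Real.exp (q * (c * a T))) ≤ ENNReal.ofReal (Real.exp (q * A)) := by
    rw [← ENNReal.ofReal_sum_of_nonneg fun _ _ => (Real.exp_pos _).le,
      ← ENNReal.ofReal_natCast, ← ENNReal.ofReal_inv_of_pos hC,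
      ← ENNReal.ofReal_mul (by positivity)]
    refine ENNReal.ofReal_le_ofReal ?_
    have h3 : ∑ T ∈ (Finset.univ : Finset (Fin n)).powersetCard s, Real.exp (q * (c * a T)) ≤
        ∑ T ∈ (Finset.univ : Finset (Fin n)).powersetCard s,
          (1 + q * (c * a T + (c * a T) ^ 2)) := by
      refine Finset.sum_le_sum fun T _ => ?_
      refine (exp_le_one_add_add_sq ?_).trans ?_
      · rw [abs_mul, abs_of_pos hq0]
        calc q * |c * a T| ≤ 1 * 1 := by gcongr; exact ha T
          _ = 1 := one_mul 1
      · have : q ^ 2 * (c * a T) ^ 2 ≤ q * (c * a T) ^ 2 := by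
          gcongr; nlinarith
        nlinarith
    have h4 : ∑ T ∈ (Finset.univ : Finset (Fin n)).powersetCard s,
          (1 + q * (c * a T + (c * a T) ^ 2)) = n.choose s * (1 + q * A) := by
      rw [Finset.sum_add_distrib, ← Finset.mul_sum, Finset.sum_const, Finset.card_powersetCard,
        Finset.card_univ, Fintype.card_fin, nsmul_eq_mul, hA]
      field_simp
    rw [inv_mul_le_iff₀ hC]
    refine h3.trans (h4.le.trans ?_)
    gcongr
    linarith [Real.add_one_le_exp (q * A)]
  refine (pow_le_pow_left' h2 B).trans (le_of_eq ?_)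
  rw [← ENNReal.ofReal_pow (Real.exp_pos _).le, ← Real.exp_nat_mul]
  congr 2
  rw [hq]; field_simp

/-- For |u| ≤ 1/2 one has exp(u + u²) ≤ 1 + u + 4u², so the square left over from the draws only
changes the constant in front of the variance. -/
lemma lintegral_exp_add_sq_le {Ω : Type*} [MeasurableSpace Ω] {μ : Measure Ω}
    [IsProbabilityMeasure μ] {f : Ω → ℝ} (hf : Measurable f) {M v c : ℝ} (hM : ∀ ω, |f ω| ≤ M)
    (hc : 0 ≤ c) (hcM : c * M ≤ 1 / 2) (h0 : ∫ ω, f ω ∂μ = 0) (hv : ∫ ω, f ω ^ 2 ∂μ ≤ v) :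
    ∫⁻ ω, ENNReal.ofReal (Real.exp (c * f ω + (c * f ω) ^ 2)) ∂μ ≤
      ENNReal.ofReal (Real.exp (4 * c ^ 2 * v)) := by
  have hi1 : Integrable f μ := Integrable.of_bound hf.aestronglyMeasurable M
    (Filter.Eventually.of_forall hM)
  have hi2 : Integrable (fun ω => f ω ^ 2) μ :=
    Integrable.of_bound (hf.pow_const 2).aestronglyMeasurable (M ^ 2)
    (Filter.Eventually.of_forall fun ω => by
      rw [Real.norm_eq_abs, abs_pow]; exact pow_le_pow_left₀ (abs_nonneg _) (hM ω) 2)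
  have hi : Integrable (fun ω => 1 + c * f ω + 4 * c ^ 2 * f ω ^ 2) μ :=
    ((integrable_const _).add (hi1.const_mul c)).add (hi2.const_mul _)
  have hpt : ∀ ω, Real.exp (c * f ω + (c * f ω) ^ 2) ≤ 1 + c * f ω + 4 * c ^ 2 * f ω ^ 2 := by
    intro ω
    have hu : |c * f ω| ≤ 1 / 2 := by
      rw [abs_mul, abs_of_nonneg hc]
      exact (mul_le_mul_of_nonneg_left (hM ω) hc).trans hcM
    rw [show 4 * c ^ 2 * f ω ^ 2 = 4 * (c * f ω) ^ 2 by ring]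
    generalize c * f ω = u at hu
    obtain ⟨hu1, hu2⟩ := abs_le.1 hu
    refine (exp_le_one_add_add_sq (abs_le.2 ⟨by nlinarith, by nlinarith⟩)).trans ?_
    nlinarith [sq_nonneg u, mul_nonneg (sq_nonneg u) (sub_nonneg.2 hu2),
      mul_nonneg (sq_nonneg u) (mul_nonneg (sub_nonneg.2 hu2) (by linarith : (0:ℝ) ≤ 5/2 + u))]
  calc _ ≤ ∫⁻ ω, ENNReal.ofReal (1 + c * f ω + 4 * c ^ 2 * f ω ^ 2) ∂μ :=
        lintegral_mono fun ω => ENNReal.ofReal_le_ofReal (hpt ω)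
    _ = ENNReal.ofReal (∫ ω, (1 + c * f ω + 4 * c ^ 2 * f ω ^ 2) ∂μ) :=
        (ofReal_integral_eq_lintegral_ofReal hi (Filter.Eventually.of_forall fun ω =>
          (Real.exp_pos _).le.trans (hpt ω))).symm
    _ ≤ _ := by
        refine ENNReal.ofReal_le_ofReal ?_
        have hs : ∫ ω, (1 + c * f ω + 4 * c ^ 2 * f ω ^ 2) ∂μ =
            (∫ _, (1 : ℝ) ∂μ + ∫ ω, c * f ω ∂μ) + ∫ ω, 4 * c ^ 2 * f ω ^ 2 ∂μ := by
          rw [← integral_add (integrable_const _) (hi1.const_mul c)]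
          exact integral_add ((integrable_const _).add (hi1.const_mul c)) (hi2.const_mul _)
        rw [hs, integral_const_mul, integral_const_mul, h0]
        simp only [integral_const, probReal_univ, smul_eq_mul, mul_one, mul_zero, add_zero]
        have : 4 * c ^ 2 * ∫ ω, f ω ^ 2 ∂μ ≤ 4 * c ^ 2 * v := by gcongr
        linarith [Real.add_one_le_exp (4 * c ^ 2 * v)]

/-- The joint law of `n` i.i.d. observations and `B` independent uniform `s`-element subsets. -/
def subsampleLaw {𝒵 : Type*} [MeasurableSpace 𝒵] (P : Measure 𝒵) (n s B : ℕ) :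
    Measure ((Fin n → 𝒵) × (Fin B → Finset (Fin n))) :=
  (Measure.pi fun _ => P).prod (Measure.pi fun _ => uniformSubsets n s)

/-- A bound on the moment generating function of an incomplete U-statistic. -/
lemma lintegral_exp_incomplete_le {n m s B : ℕ} (hms : m * s ≤ n) (hsn : s ≤ n) (hmB : m ≤ B)
    (hm : 1 ≤ m) {𝒵 : Type*} [MeasurableSpace 𝒵]
    (P : Measure 𝒵) [IsProbabilityMeasure P] {φ₀ : (Fin s → 𝒵) → ℝ} (hφ₀ : Measurable φ₀)
    {φ : Finset (Fin n) → (Fin n → 𝒵) → ℝ} (hφm : ∀ S, Measurable (φ S))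
    (hφ : ∀ (S : Finset (Fin n)) (h : S.card = s) z,
      φ S z = φ₀ fun i => z (S.orderEmbOfFin h i)) {M v c : ℝ} (hM0 : ∀ w, |φ₀ w| ≤ M)
    (hM : ∀ S z, |φ S z| ≤ M) (hc : 0 ≤ c) (hcM : c * M ≤ 1 / 2)
    (h0 : ∫ w, φ₀ w ∂(Measure.pi fun _ => P) = 0)
    (hv : ∫ w, φ₀ w ^ 2 ∂(Measure.pi fun _ => P) ≤ v) :
    ∫⁻ p, ENNReal.ofReal (Real.exp (c * m * ((∑ b, φ (p.2 b) p.1) / B))) ∂(subsampleLaw P n s B) ≤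
      ENNReal.ofReal (Real.exp (4 * m * c ^ 2 * v)) := by
  have := isProbabilityMeasure_uniformSubsets hsn
  have hjm : Measurable fun p : (Fin n → 𝒵) × Finset (Fin n) => φ p.2 p.1 :=
    measurable_from_prod_countable_left hφm
  have hmeas : Measurable fun p : (Fin n → 𝒵) × (Fin B → Finset (Fin n)) =>
      ENNReal.ofReal (Real.exp (c * m * ((∑ b, φ (p.2 b) p.1) / B))) := by
    refine ENNReal.measurable_ofReal.comp (Real.measurable_exp.comp
      (Measurable.const_mul (Measurable.div_const (Finset.measurable_sum _ fun b _ => ?_) _) _))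
    exact hjm.comp (measurable_fst.prodMk ((measurable_pi_apply b).comp measurable_snd))
  rw [subsampleLaw, lintegral_prod _ hmeas.aemeasurable]
  -- The draws are integrated out first, for fixed data; the complete U-statistic that remains is
  -- compared with independent blocks.
  calc _ ≤ ∫⁻ z, ENNReal.ofReal (Real.exp (m *
        ((∑ S ∈ (Finset.univ : Finset (Fin n)).powersetCard s,
        (c * φ S z + (c * φ S z) ^ 2)) / (n.choose s : ℝ)))) ∂(Measure.pi fun _ => P) := by
        refine lintegral_mono fun z => ?_
        refine lintegral_exp_draws_le hsn hmB hm fun S => ?_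
        rw [abs_mul, abs_of_nonneg hc]
        linarith [mul_le_mul_of_nonneg_left (hM S z) hc]
    _ ≤ _ := lintegral_exp_uStatistic_le hms P (φ₀ := fun w => c * φ₀ w + (c * φ₀ w) ^ 2)
        (by fun_prop) (φ := fun S z => c * φ S z + (c * φ S z) ^ 2)
        (fun S h z => by simp only [hφ S h])
    _ ≤ _ := pow_le_pow_left' (lintegral_exp_add_sq_le hφ₀ hM0 hc hcM h0 hv) m
    _ = _ := by
        rw [← ENNReal.ofReal_pow (Real.exp_pos _).le, ← Real.exp_nat_mul]
        congr 2; ring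

/-- Bernstein's inequality for incomplete U-statistics, upper tail. -/
lemma incomplete_upper_tail {n m s B : ℕ} (hms : m * s ≤ n) (hsn : s ≤ n) (hmB : m ≤ B)
    (hm : 1 ≤ m) {𝒵 : Type*} [MeasurableSpace 𝒵]
    (P : Measure 𝒵) [IsProbabilityMeasure P] {φ₀ : (Fin s → 𝒵) → ℝ} (hφ₀ : Measurable φ₀)
    {φ : Finset (Fin n) → (Fin n → 𝒵) → ℝ} (hφm : ∀ S, Measurable (φ S))
    (hφ : ∀ (S : Finset (Fin n)) (h : S.card = s) z,
      φ S z = φ₀ fun i => z (S.orderEmbOfFin h i)) {M σ ℓ : ℝ} (hMpos : 0 < M) (hσ : 0 < σ)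
    (hℓ : 0 < ℓ) (hM0 : ∀ w, |φ₀ w| ≤ M) (hM : ∀ S z, |φ S z| ≤ M)
    (h0 : ∫ w, φ₀ w ∂(Measure.pi fun _ => P) = 0)
    (hv : ∫ w, φ₀ w ^ 2 ∂(Measure.pi fun _ => P) ≤ σ ^ 2) :
    subsampleLaw P n s B {p | 4 * σ * √(ℓ / m) + 4 * M * (ℓ / m) ≤ (∑ b, φ (p.2 b) p.1) / B} ≤
      ENNReal.ofReal (Real.exp (-ℓ)) := by
  have hm0 : (0 : ℝ) < m := by exact_mod_cast hm
  set r := √(ℓ / m) with hr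
  have hr0 : 0 < r := Real.sqrt_pos.2 (by positivity)
  have hr2 : ℓ / m = r ^ 2 := (Real.sq_sqrt (by positivity)).symm
  have hℓr : ℓ = m * r ^ 2 := by rw [← hr2]; field_simp
  have hden : 0 < 2 * (σ + M * r) := by positivity
  -- This choice gives both `c * M ≤ 1 / 2` and `c * σ ≤ r / 2`: the exponent is then at most `m * r
  -- ^ 2 = ℓ`, while the threshold multiplied by `c * m` equals `2 * ℓ`.
  set c := r / (2 * (σ + M * r)) with hc
  have hc0 : 0 < c := by positivity
  have hcM : c * M ≤ 1 / 2 := by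
    rw [hc, div_mul_eq_mul_div, div_le_iff₀ hden]; nlinarith
  have hcσ : c * σ ≤ r / 2 := by
    rw [hc, div_mul_eq_mul_div, div_le_iff₀ hden]; nlinarith [mul_pos hr0 (mul_pos hMpos hr0)]
  have h1 := lintegral_exp_incomplete_le hms hsn hmB hm P hφ₀ hφm hφ hM0 hM hc0.le hcM h0 hv
  have hjm : Measurable fun p : (Fin n → 𝒵) × Finset (Fin n) => φ p.2 p.1 :=
    measurable_from_prod_countable_left hφm
  have hmeas : Measurable fun p : (Fin n → 𝒵) × (Fin B → Finset (Fin n)) =>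
      c * m * ((∑ b, φ (p.2 b) p.1) / B) := by
    refine Measurable.const_mul (Measurable.div_const (Finset.measurable_sum _ fun b _ => ?_) _) _
    exact hjm.comp (measurable_fst.prodMk ((measurable_pi_apply b).comp measurable_snd))
  have h2 := measure_le_of_lintegral_exp hmeas h1 (2 * ℓ)
  refine (measure_mono ?_).trans (h2.trans (ENNReal.ofReal_le_ofReal (Real.exp_le_exp.2 ?_)))
  · intro p hp
    simp only [Set.mem_ofPred_eq] at hp ⊢
    have h3 : 2 * ℓ = c * m * (4 * σ * r + 4 * M * (ℓ / m)) := by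
      rw [hr2, hc, hℓr]; field_simp; ring
    rw [h3]
    gcongr
  · have : (c * σ) ^ 2 ≤ (r / 2) ^ 2 := by gcongr
    rw [hℓr]
    nlinarith

/-- Bernstein's inequality for incomplete U-statistics. -/
lemma incomplete_tail {n m s B : ℕ} (hms : m * s ≤ n) (hsn : s ≤ n) (hmB : m ≤ B)
    (hm : 1 ≤ m) {𝒵 : Type*} [MeasurableSpace 𝒵]
    (P : Measure 𝒵) [IsProbabilityMeasure P] {φ₀ : (Fin s → 𝒵) → ℝ} (hφ₀ : Measurable φ₀)
    {φ : Finset (Fin n) → (Fin n → 𝒵) → ℝ} (hφm : ∀ S, Measurable (φ S))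
    (hφ : ∀ (S : Finset (Fin n)) (h : S.card = s) z,
      φ S z = φ₀ fun i => z (S.orderEmbOfFin h i)) {M σ ℓ : ℝ} (hMpos : 0 < M) (hσ : 0 < σ)
    (hℓ : 0 < ℓ) (hM0 : ∀ w, |φ₀ w| ≤ M) (hM : ∀ S z, |φ S z| ≤ M)
    (h0 : ∫ w, φ₀ w ∂(Measure.pi fun _ => P) = 0)
    (hv : ∫ w, φ₀ w ^ 2 ∂(Measure.pi fun _ => P) ≤ σ ^ 2) :
    subsampleLaw P n s B {p | 4 * σ * √(ℓ / m) + 4 * M * (ℓ / m) ≤ |(∑ b, φ (p.2 b) p.1) / B|} ≤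
      ENNReal.ofReal (2 * Real.exp (-ℓ)) := by
  have h1 := incomplete_upper_tail hms hsn hmB hm P hφ₀ hφm hφ hMpos hσ hℓ hM0 hM h0 hv
  have h2 := incomplete_upper_tail hms hsn hmB hm P (φ₀ := fun w => -φ₀ w) hφ₀.neg
    (φ := fun S z => -φ S z) (fun S => (hφm S).neg) (fun S h z => by simp only [hφ S h]) hMpos hσ hℓ
    (fun w => by rw [abs_neg]; exact hM0 w) (fun S z => by rw [abs_neg]; exact hM S z)
    (by rw [integral_neg, h0, neg_zero]) (by simpa only [neg_sq] using hv)
  rw [two_mul, ENNReal.ofReal_add (Real.exp_pos _).le (Real.exp_pos _).le]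
  refine (measure_mono ?_).trans ((measure_union_le _ _).trans (add_le_add h1 h2))
  intro p hp
  rw [Set.mem_ofPred_eq] at hp
  rcases le_abs.1 hp with h | h
  · exact Or.inl h
  · right
    simpa only [Set.mem_ofPred_eq, Finset.sum_neg_distrib, neg_div] using h

end Concentration

end

noncomputable section

/-! ### Bracketing covers and chaining. -/

section Chaining

lemma exists_bracket_cover {𝒵 : Type*} [MeasurableSpace 𝒵] {F : Set (𝒵 → ℝ)} {Q : Measure 𝒵}
    {ε a : ℝ} (h : ((bracketingNumber F Q ε : ℕ∞) : ENNReal) ≤ ENNReal.ofReal a) (ha : 0 ≤ a) :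
    ∃ T : Finset ((𝒵 → ℝ) × (𝒵 → ℝ)), IsBracketCover F Q ε T ∧ (T.card : ℝ) ≤ a := by
  have hne : bracketingNumber F Q ε ≠ ⊤ := by
    intro htop
    rw [htop] at h
    simp at h
  obtain ⟨N, hN⟩ := ENat.ne_top_iff_exists.1 hne
  have hlt : bracketingNumber F Q ε < ((N + 1 : ℕ) : ℕ∞) := by
    rw [← hN]; exact_mod_cast Nat.lt_succ_self N
  rw [bracketingNumber] at hlt
  obtain ⟨T, hT⟩ := iInf_lt_iff.1 hlt
  obtain ⟨hcov, hT⟩ := iInf_lt_iff.1 hT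
  refine ⟨T, hcov, ?_⟩
  have hTN : T.card ≤ N := Nat.lt_succ_iff.1 (by exact_mod_cast hT)
  rw [← hN] at h
  have h' : (N : ENNReal) ≤ ENNReal.ofReal a := by simpa using h
  rw [← ENNReal.ofReal_natCast, ENNReal.ofReal_le_ofReal_iff ha] at h'
  exact le_trans (by exact_mod_cast hTN) h'

/-- `T` is a finite set of centres in `F`, each with an envelope of size `ε` in `L₂(Q)`, such that
every member of `F` is within the envelope of some centre. -/
structure IsEnvelopeCover {𝒵 : Type*} [MeasurableSpace 𝒵] (F : Set (𝒵 → ℝ)) (Q : Measure 𝒵)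
    (M ε : ℝ) (T : Finset ((𝒵 → ℝ) × (𝒵 → ℝ))) : Prop where
  center_mem : ∀ b ∈ T, b.1 ∈ F
  measurable : ∀ b ∈ T, Measurable b.2
  nonneg : ∀ b ∈ T, ∀ z, 0 ≤ b.2 z
  le : ∀ b ∈ T, ∀ z, b.2 z ≤ 2 * M
  sq_le : ∀ b ∈ T, ∫ z, b.2 z ^ 2 ∂Q ≤ ε ^ 2
  cover : ∀ f ∈ F, ∃ b ∈ T, ∀ z, |f z - b.1 z| ≤ b.2 z

lemma integral_sq_le_of_eLpNorm_le {𝒵 : Type*} [MeasurableSpace 𝒵] {Q : Measure 𝒵}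
    {f g : 𝒵 → ℝ} (hf : Measurable f) {ε : ℝ} (hε : 0 ≤ ε) (h0 : ∀ z, 0 ≤ f z)
    (hfg : ∀ z, f z ≤ g z) (hg : eLpNorm g 2 Q ≤ ENNReal.ofReal ε) :
    ∫ z, f z ^ 2 ∂Q ≤ ε ^ 2 := by
  have h1 : eLpNorm f 2 Q ≤ ENNReal.ofReal ε := (eLpNorm_mono_real fun z => by
    rw [Real.norm_eq_abs, abs_of_nonneg (h0 z)]; exact hfg z).trans hg
  rw [integral_eq_lintegral_of_nonneg_ae (Filter.Eventually.of_forall fun z => sq_nonneg _)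
    (hf.pow_const 2).aestronglyMeasurable]
  refine ENNReal.toReal_le_of_le_ofReal (sq_nonneg ε) ?_
  rw [eLpNorm_eq_lintegral_rpow_enorm_toReal (by norm_num) (by norm_num)] at h1
  have h2 := ENNReal.rpow_le_rpow h1 (z := 2) (by norm_num)
  rw [← ENNReal.rpow_mul] at h2
  simp only [ENNReal.toReal_ofNat, one_div, ne_eq, OfNat.ofNat_ne_zero, not_false_eq_true,
    inv_mul_cancel₀, ENNReal.rpow_one] at h2
  rw [ENNReal.ofReal_rpow_of_nonneg hε (by norm_num)] at h2
  refine le_trans (le_of_eq ?_) (h2.trans (le_of_eq (by norm_num)))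
  refine lintegral_congr fun z => ?_
  rw [Real.enorm_eq_ofReal (h0 z), ENNReal.ofReal_rpow_of_nonneg (h0 z) (by norm_num)]
  norm_num

-- Brackets containing no member of `F` are discarded; in each of the others a member of `F` is
-- chosen as centre. Two members of one bracket differ by at most its width, and by at most `2 * M`,
-- so truncating the width keeps the envelope bounded even if the bracket functions are not.
open Classical in
lemma exists_envelopeCover {𝒵 : Type*} [MeasurableSpace 𝒵] {F : Set (𝒵 → ℝ)} {Q : Measure 𝒵}
    {M ε a : ℝ} (hF : ∀ f ∈ F, ∀ z, |f z| ≤ M) (hε : 0 ≤ ε) (hM : 0 ≤ M)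
    (h : ((bracketingNumber F Q ε : ℕ∞) : ENNReal) ≤ ENNReal.ofReal a) (ha : 0 ≤ a) :
    ∃ T : Finset ((𝒵 → ℝ) × (𝒵 → ℝ)), IsEnvelopeCover F Q M ε T ∧ (T.card : ℝ) ≤ a := by
  obtain ⟨T₀, hcov, hcard⟩ := exists_bracket_cover h ha
  set p : (𝒵 → ℝ) × (𝒵 → ℝ) → (𝒵 → ℝ) → Prop := fun b f =>
    f ∈ F ∧ ∀ z, b.1 z ≤ f z ∧ f z ≤ b.2 z with hp
  set c : (𝒵 → ℝ) × (𝒵 → ℝ) → (𝒵 → ℝ) := fun b => if hb : ∃ f, p b f then hb.choose else 0 with hc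
  have hcp : ∀ b, (∃ f, p b f) → p b (c b) := fun b hb => by
    simp only [hc, hb, dif_pos]; exact hb.choose_spec
  refine ⟨(T₀.filter fun b => ∃ f, p b f).image
    fun b => (c b, fun z => min (b.2 z - b.1 z) (2 * M)), ?_, ?_⟩
  · have key : ∀ b' ∈ (T₀.filter fun b => ∃ f, p b f).image
        (fun b => (c b, fun z => min (b.2 z - b.1 z) (2 * M))),
        ∃ b ∈ T₀, p b (c b) ∧ b' = (c b, fun z => min (b.2 z - b.1 z) (2 * M)) := by
      intro b' hb'
      obtain ⟨b, hb, rfl⟩ := Finset.mem_image.1 hb'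
      rw [Finset.mem_filter] at hb
      exact ⟨b, hb.1, hcp b hb.2, rfl⟩
    have hmeas : ∀ b ∈ T₀, Measurable fun z => min (b.2 z - b.1 z) (2 * M) := fun b hb =>
      ((hcov.1 b hb).2.1.sub (hcov.1 b hb).1).min measurable_const
    have hnn : ∀ b, p b (c b) → ∀ z, 0 ≤ min (b.2 z - b.1 z) (2 * M) := fun b hb z =>
      le_min (by linarith [hb.2 z]) (by linarith)
    constructor
    · intro b' hb'
      obtain ⟨b, -, hb, rfl⟩ := key b' hb'
      exact hb.1
    · intro b' hb'
      obtain ⟨b, hbT, hb, rfl⟩ := key b' hb'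
      exact hmeas b hbT
    · intro b' hb' z
      obtain ⟨b, -, hb, rfl⟩ := key b' hb'
      exact hnn b hb z
    · intro b' hb' z
      obtain ⟨b, -, hb, rfl⟩ := key b' hb'
      exact min_le_right _ _
    · intro b' hb'
      obtain ⟨b, hbT, hb, rfl⟩ := key b' hb'
      exact integral_sq_le_of_eLpNorm_le (hmeas b hbT) hε (hnn b hb) (fun z => min_le_left _ _)
        (hcov.1 b hbT).2.2
    · intro f hf
      obtain ⟨b, hbT, hb⟩ := hcov.2 f hf
      have hpc := hcp b ⟨f, hf, hb⟩
      refine ⟨_, Finset.mem_image.2 ⟨b, Finset.mem_filter.2 ⟨hbT, f, hf, hb⟩, rfl⟩, fun z => ?_⟩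
      have h1 := hb z
      have h2 := hpc.2 z
      have h3 := abs_le.1 (hF f hf z)
      have h4 := abs_le.1 (hF _ hpc.1 z)
      refine le_min (abs_le.2 ⟨by linarith, by linarith⟩) (abs_le.2 ⟨by linarith, by linarith⟩)
  · refine le_trans ?_ hcard
    exact_mod_cast Finset.card_image_le.trans (Finset.card_filter_le _ _)

lemma two_mul_integral_le {𝒵 : Type*} [MeasurableSpace 𝒵] {Q : Measure 𝒵} [IsProbabilityMeasure Q]
    {w : 𝒵 → ℝ} (hw : Measurable w) {M ε : ℝ} (hε : 0 < ε) (hM : ∀ z, |w z| ≤ M)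
    (h : ∫ z, w z ^ 2 ∂Q ≤ ε ^ 2) : 2 * ∫ z, w z ∂Q ≤ 2 * ε := by
  have hi1 : Integrable w Q := Integrable.of_bound hw.aestronglyMeasurable M
    (Filter.Eventually.of_forall hM)
  have hi2 : Integrable (fun z => w z ^ 2) Q :=
    Integrable.of_bound (hw.pow_const 2).aestronglyMeasurable (M ^ 2)
    (Filter.Eventually.of_forall fun z => by
      rw [Real.norm_eq_abs, abs_pow]; exact pow_le_pow_left₀ (abs_nonneg _) (hM z) 2)
  have h1 : ∫ z, 2 * ε * w z ∂Q ≤ ∫ z, (ε ^ 2 + w z ^ 2) ∂Q :=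
    integral_mono (hi1.const_mul _) ((integrable_const _).add hi2)
      fun z => by nlinarith [sq_nonneg (ε - w z)]
  rw [integral_const_mul, integral_add (integrable_const _) hi2] at h1
  simp only [integral_const, probReal_univ, smul_eq_mul, one_mul] at h1
  nlinarith

lemma measure_exists_mem_finset_le {Ω ι : Type*} [MeasurableSpace Ω] (μ : Measure Ω) (T : Finset ι)
    {p : ι → Ω → Prop} {a b : ℝ} (ha : 0 ≤ a) (hT : (T.card : ℝ) ≤ b)
    (h : ∀ i ∈ T, μ {ω | p i ω} ≤ ENNReal.ofReal a) :
    μ {ω | ∃ i ∈ T, p i ω} ≤ ENNReal.ofReal (b * a) := by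
  have : {ω | ∃ i ∈ T, p i ω} = ⋃ i ∈ T, {ω | p i ω} := by ext; simp
  rw [this]
  refine (measure_biUnion_finset_le _ _).trans ((Finset.sum_le_card_nsmul _ _ _ h).trans ?_)
  rw [nsmul_eq_mul, ← ENNReal.ofReal_natCast, ← ENNReal.ofReal_mul (by positivity)]
  exact ENNReal.ofReal_le_ofReal (by gcongr)

/-- Chaining for a process `A` with Bernstein tails, indexed by a class `F` of bounded functions
whose bracketing entropy at scale `ε` is of order `1 / ε`. -/
theorem chaining_tail {Ω 𝒵 : Type*} [MeasurableSpace Ω] [MeasurableSpace 𝒵] {μ : Measure Ω}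
    {Q : Measure 𝒵} [IsProbabilityMeasure Q] {A : (𝒵 → ℝ) → Ω → ℝ} {m : ℝ}
    (hsub : ∀ f g : 𝒵 → ℝ, Measurable f → Measurable g → (∃ M, ∀ z, |f z| ≤ M) →
      (∃ M, ∀ z, |g z| ≤ M) → ∀ ω, A (fun z => f z - g z) ω = A f ω - A g ω)
    (hdom : ∀ f w : 𝒵 → ℝ, Measurable f → Measurable w → (∃ M, ∀ z, |w z| ≤ M) →
      (∀ z, |f z| ≤ w z) → ∀ ω, |A f ω| ≤ |A w ω| + 2 * ∫ z, w z ∂Q)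
    (htail : ∀ (f : 𝒵 → ℝ) (M σ ℓ : ℝ), Measurable f → 0 < M → 0 < σ → 0 < ℓ → (∀ z, |f z| ≤ M) →
      ∫ z, f z ^ 2 ∂Q ≤ σ ^ 2 →
      μ {ω | 4 * σ * √(ℓ / m) + 8 * M * (ℓ / m) ≤ |A f ω|} ≤ ENNReal.ofReal (2 * Real.exp (-ℓ)))
    {F : Set (𝒵 → ℝ)} {M C ℓ : ℝ} (hM : 0 < M) (hC : 0 ≤ C) (hFm : ∀ f ∈ F, Measurable f)
    (hFM : ∀ f ∈ F, ∀ z, |f z| ≤ M)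
    (hcov : ∀ ε : ℝ, 0 < ε → ε ≤ 1 → ((bracketingNumber F Q ε : ℕ∞) : ENNReal) ≤
        ENNReal.ofReal (Real.exp (C / ε)))
    (hℓ : 1 ≤ ℓ) (hℓm : ℓ ≤ m) :
    μ {ω | ∃ f ∈ F, (50 * M * (C + 1) + 20 * (C + 1) + 8) * √(ℓ / m) ≤ |A f ω|} ≤
      ENNReal.ofReal (6 * Real.exp (-ℓ)) := by
  have hm : 0 < m := by linarith
  set r := √(ℓ / m) with hr
  have hr0 : 0 < r := Real.sqrt_pos.2 (by positivity)
  have hr2 : ℓ / m = r ^ 2 := (Real.sq_sqrt (by positivity)).symm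
  have hr1 : r ≤ 1 := Real.sqrt_le_one.2 (by rwa [div_le_one hm])
  set c := C + 1 with hc
  have hc1 : 1 ≤ c := by linarith
  -- With `ℓ` in the scale, the entropy `C / ε i` is `C * ℓ * 4 ^ i`, a multiple of the deviation
  -- level. Scales shrink by 4 while the square root of the entropy grows by 2, so the variance
  -- parts of the increments sum geometrically.
  set ε : ℕ → ℝ := fun i => (4 ^ i * ℓ)⁻¹ with hε
  have hε0 : ∀ i, 0 < ε i := fun i => by positivity
  have h4 : ∀ i : ℕ, (1 : ℝ) ≤ 4 ^ i := fun i => one_le_pow₀ (by norm_num)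
  have hε1 : ∀ i, ε i ≤ (4 ^ i)⁻¹ := fun i => by
    rw [hε]; exact inv_anti₀ (by positivity) (le_mul_of_one_le_right (by positivity) hℓ)
  choose T hT hTcard using fun i => exists_envelopeCover hFM (hε0 i).le hM.le
    (hcov (ε i) (hε0 i) ((hε1 i).trans (inv_le_one_of_one_le₀ (h4 i)))) (Real.exp_pos _).le
  have hTcard' : ∀ i, ((T i).card : ℝ) ≤ Real.exp (C * ℓ * 4 ^ i) := fun i => by
    refine (hTcard i).trans (le_of_eq ?_)
    congr 1; simp only [hε]; field_simp
  have hsq : ∀ i : ℕ, √(c * ℓ * 4 ^ i / m) ≤ c * 2 ^ i * r := by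
    intro i
    rw [Real.sqrt_le_left (by positivity)]
    rw [show c * ℓ * 4 ^ i / m = c * 4 ^ i * (ℓ / m) by ring, hr2,
      show (c * 2 ^ i * r) ^ 2 = c * (c * 4 ^ i * r ^ 2) by
        rw [show (4 : ℝ) = 2 ^ 2 by norm_num, ← pow_mul, mul_comm 2 i, pow_mul]; ring]
    exact le_mul_of_one_le_left (by positivity) hc1
  have hlin : ∀ i : ℕ, c * ℓ * 4 ^ i / m = c * 4 ^ i * r ^ 2 := fun i => by rw [← hr2]; ring
  -- The excess of `c` over `C` is what survives the union bound over `T i`.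
  have hunion : ∀ i : ℕ, Real.exp (C * ℓ * 4 ^ i) * (2 * Real.exp (-(c * ℓ * 4 ^ i))) =
      2 * Real.exp (-(ℓ * 4 ^ i)) := fun i => by
    rw [mul_left_comm, ← Real.exp_add]; congr 2; rw [hc]; ring
  -- the tail of the increments at level `i`
  have hlevel : ∀ (i : ℕ) (u : ((𝒵 → ℝ) × (𝒵 → ℝ)) → 𝒵 → ℝ) (M' σ : ℝ), 0 < M' → 0 < σ →
      (∀ b ∈ T i, Measurable (u b) ∧ (∀ z, |u b z| ≤ M') ∧ ∫ z, u b z ^ 2 ∂Q ≤ σ ^ 2) →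
      μ {ω | ∃ b ∈ T i, 4 * σ * (c * 2 ^ i * r) + 8 * M' * (c * 4 ^ i * r ^ 2) ≤ |A (u b) ω|} ≤
        ENNReal.ofReal (2 * Real.exp (-(ℓ * 4 ^ i))) := by
    intro i u M' σ hM' hσ hu
    rw [← hunion i]
    refine measure_exists_mem_finset_le μ (T i) (by positivity) (hTcard' i) fun b hb => ?_
    obtain ⟨h1, h2, h3⟩ := hu b hb
    refine (measure_mono ?_).trans (htail (u b) M' σ (c * ℓ * 4 ^ i) h1 hM' hσ (by positivity) h2 h3)
    intro ω hω
    rw [Set.mem_ofPred_eq] at hω ⊢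
    refine le_trans ?_ hω
    rw [hlin]
    gcongr
    rw [← hlin]; exact hsq i
  -- The bound accumulated along a chain. The second term sums the variance parts, each at most `16
  -- * c * (2 ^ (i + 1))⁻¹ * r`. The third sums the Bernstein linear parts: passing to level `i + 1`
  -- adds `64 * M * c * 4 ^ i * r ^ 2`, and 22 + 64 ≤ 4 * 22.
  set Dv : ℕ → ℝ := fun i => 12 * M * c * r + 16 * c * (1 - (2 ^ i)⁻¹) * r +
    22 * M * c * 4 ^ i * r ^ 2 with hDv
  have hind : ∀ i, μ {ω | ∃ b ∈ T i, Dv i ≤ |A b.1 ω|} ≤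
      ENNReal.ofReal (2 * Real.exp (-ℓ) * (2 - (2 ^ i)⁻¹)) := by
    intro i
    induction i with
    | zero =>
      refine (measure_mono ?_).trans ((hlevel 0 (fun b => b.1) M M hM hM ?_).trans
        (ENNReal.ofReal_le_ofReal (le_of_eq (by norm_num))))
      · rintro ω ⟨b, hb, h⟩
        refine ⟨b, hb, le_trans ?_ h⟩
        simp only [hDv, pow_zero, mul_one, inv_one, sub_self, mul_zero, zero_mul, add_zero]
        have : 0 ≤ M * c * r ^ 2 := by positivity
        have : M * c * r ^ 2 ≤ M * c * r := by
          rw [sq]; gcongr; nlinarith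
        nlinarith
      · intro b hb
        have hbF := (hT 0).center_mem b hb
        refine ⟨hFm _ hbF, hFM _ hbF, ?_⟩
        calc ∫ z, b.1 z ^ 2 ∂Q ≤ ∫ _, M ^ 2 ∂Q := by
              refine integral_mono_of_nonneg (Filter.Eventually.of_forall fun z => sq_nonneg _)
                (integrable_const _) (Filter.Eventually.of_forall fun z => ?_)
              exact sq_le_sq' (abs_le.1 (hFM _ hbF z)).1 (abs_le.1 (hFM _ hbF z)).2
          _ = M ^ 2 := by simp
    | succ i ih =>
      -- Each centre at level `i + 1` is linked to a centre at level `i` whose envelope dominates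
      -- their difference; the value outside `T (i + 1)` is irrelevant.
      have hpar : ∀ b, ∃ a, b ∈ T (i + 1) → a ∈ T i ∧ ∀ z, |b.1 z - a.1 z| ≤ a.2 z := by
        intro b
        by_cases hb : b ∈ T (i + 1)
        · obtain ⟨a, ha, h⟩ := (hT i).cover b.1 ((hT (i + 1)).center_mem b hb)
          exact ⟨a, fun _ => ⟨ha, h⟩⟩
        · exact ⟨b, fun h => absurd h hb⟩
      choose par hpar using hpar
      have hl := hlevel (i + 1) (fun b z => b.1 z - (par b).1 z) (2 * M) (ε i) (by positivity)
        (hε0 i) ?_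
      · have hsum : 2 * Real.exp (-ℓ) * (2 - (2 ^ i)⁻¹) + 2 * Real.exp (-(ℓ * 4 ^ (i + 1))) ≤
            2 * Real.exp (-ℓ) * (2 - (2 ^ (i + 1))⁻¹) := by
          have h1 : Real.exp (-(ℓ * 4 ^ (i + 1))) ≤ Real.exp (-ℓ) * (2 ^ (i + 1))⁻¹ := by
            have h2 : Real.exp (-((i + 1 : ℕ) : ℝ)) ≤ (2 ^ (i + 1))⁻¹ := by
              rw [Real.exp_neg, ← Real.exp_one_pow]
              gcongr
              linarith [Real.add_one_le_exp 1]
            refine le_trans ?_ (mul_le_mul_of_nonneg_left h2 (Real.exp_pos _).le)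
            rw [← Real.exp_add, Real.exp_le_exp]
            have h3 : ((i + 1 : ℕ) : ℝ) * 3 + 1 ≤ 4 ^ (i + 1) := by
              have := one_add_mul_le_pow (a := (3 : ℝ)) (by norm_num) (i + 1)
              norm_num at this ⊢
              linarith
            have h4 : (0 : ℝ) ≤ ((i + 1 : ℕ) : ℝ) := Nat.cast_nonneg _
            nlinarith
          have h5 : ((2 : ℝ) ^ i)⁻¹ = 2 * (2 ^ (i + 1))⁻¹ := by
            rw [pow_succ]; field_simp
          rw [h5]
          nlinarith [Real.exp_pos (-ℓ)]
        refine (measure_mono ?_).trans ((measure_union_le _ _).trans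
          ((add_le_add ih hl).trans ((ENNReal.ofReal_add ?_ (by positivity)).symm.le.trans
            (ENNReal.ofReal_le_ofReal hsum))))
        · rintro ω ⟨b, hb, h⟩
          obtain ⟨hpT, hpz⟩ := hpar b hb
          by_cases hcase : Dv i ≤ |A (par b).1 ω|
          · exact Or.inl ⟨par b, hpT, hcase⟩
          · right
            refine ⟨b, hb, ?_⟩
            have hbF := (hT (i + 1)).center_mem b hb
            have hpF := (hT i).center_mem _ hpT
            have hs := hsub b.1 (par b).1 (hFm _ hbF) (hFm _ hpF) ⟨M, hFM _ hbF⟩ ⟨M, hFM _ hpF⟩ ω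
            rw [hs]
            have h6 := abs_sub_abs_le_abs_sub (A b.1 ω) (A (par b).1 ω)
            refine le_trans ?_ (h6.trans' (sub_le_sub h (not_le.1 hcase).le))
            have h5 : ((2 : ℝ) ^ i)⁻¹ = 2 * (2 ^ (i + 1))⁻¹ := by
              rw [pow_succ]; field_simp
            have h7 : 4 * ε i * (c * 2 ^ (i + 1) * r) ≤ 16 * c * (2 ^ (i + 1))⁻¹ * r := by
              have h8 : ε i ≤ (2 ^ (i + 1))⁻¹ * (2 ^ (i + 1))⁻¹ * 4 := by
                refine (hε1 i).trans (le_of_eq ?_)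
                rw [show (4 : ℝ) = 2 ^ 2 by norm_num, ← pow_mul, mul_comm 2 i, pow_mul, pow_succ]
                field_simp
                ring
              calc 4 * ε i * (c * 2 ^ (i + 1) * r) ≤
                    4 * ((2 ^ (i + 1))⁻¹ * (2 ^ (i + 1))⁻¹ * 4) * (c * 2 ^ (i + 1) * r) := by gcongr
                _ = _ := by field_simp; norm_num
            have h9 : 0 ≤ M * c * 4 ^ i * r ^ 2 := by positivity
            simp only [hDv]
            rw [h5]
            rw [pow_succ 4 i]
            nlinarith
        · have : ((2 : ℝ) ^ i)⁻¹ ≤ 1 := inv_le_one_of_one_le₀ (one_le_pow₀ (by norm_num))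
          have := Real.exp_pos (-ℓ)
          apply mul_nonneg <;> linarith
      · intro b hb
        obtain ⟨hpT, hpz⟩ := hpar b hb
        have hbF := (hT (i + 1)).center_mem b hb
        have hpF := (hT i).center_mem _ hpT
        have hm2 := (hFm _ hbF).sub (hFm _ hpF)
        refine ⟨hm2, fun z => (hpz z).trans ((hT i).le _ hpT z), ?_⟩
        refine le_trans ?_ ((hT i).sq_le _ hpT)
        refine integral_mono_of_nonneg (Filter.Eventually.of_forall fun z => sq_nonneg _) ?_
          (Filter.Eventually.of_forall fun z => ?_)
        · refine Integrable.of_bound (((hT i).measurable _ hpT).pow_const 2).aestronglyMeasurable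
            ((2 * M) ^ 2) (Filter.Eventually.of_forall fun z => ?_)
          rw [Real.norm_eq_abs, abs_pow, abs_of_nonneg ((hT i).nonneg _ hpT z)]
          exact pow_le_pow_left₀ ((hT i).nonneg _ hpT z) ((hT i).le _ hpT z) 2
        · exact sq_le_sq' (abs_le.1 (hpz z)).1 (abs_le.1 (hpz z)).2
  -- the finest level
  obtain ⟨J, hJ1, hJ2⟩ : ∃ J : ℕ, (4 : ℝ) ^ J * r ≤ 1 ∧ 1 < 4 ^ (J + 1) * r := by
    obtain ⟨J, h1, h2⟩ := exists_nat_pow_near (x := r⁻¹) (y := (4 : ℝ))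
      ((one_le_inv₀ hr0).2 hr1) (by norm_num)
    refine ⟨J, ?_, ?_⟩
    · rwa [le_inv_comm₀ (by positivity) hr0, inv_eq_one_div, le_div_iff₀ (by positivity),
        mul_comm] at h1
    · rwa [inv_lt_comm₀ hr0 (by positivity), inv_eq_one_div, div_lt_iff₀ (by positivity),
        mul_comm] at h2
  -- Stopping when `4 ^ J` is about `1 / r` balances the two remaining errors: the mean of the last
  -- envelope is O(ε J) = O(r), and the accumulated linear part is O(4 ^ J * r ^ 2) = O(r).
  have hεJ : ε J ≤ 4 * r := by
    refine (hε1 J).trans ?_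
    rw [inv_le_iff_one_le_mul₀ (by positivity)]
    rw [pow_succ] at hJ2
    nlinarith
  have hwb : ∀ b ∈ T J, ∀ z, |b.2 z| ≤ 2 * M := fun b hb z => by
    rw [abs_of_nonneg ((hT J).nonneg b hb z)]; exact (hT J).le b hb z
  have hlast := hlevel J (fun b => b.2) (2 * M) (ε J) (by positivity) (hε0 J)
    fun b hb => ⟨(hT J).measurable b hb, hwb b hb, (hT J).sq_le b hb⟩
  have h2J : ((2 : ℝ) ^ J)⁻¹ ≤ 1 := inv_le_one_of_one_le₀ (one_le_pow₀ (by norm_num))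
  have h2J0 : 0 < ((2 : ℝ) ^ J)⁻¹ := by positivity
  have hfin : 2 * Real.exp (-ℓ) * (2 - (2 ^ J)⁻¹) + 2 * Real.exp (-(ℓ * 4 ^ J)) ≤
      6 * Real.exp (-ℓ) := by
    have h1 : Real.exp (-(ℓ * 4 ^ J)) ≤ Real.exp (-ℓ) := by
      rw [Real.exp_le_exp]; nlinarith [h4 J]
    nlinarith [Real.exp_pos (-ℓ)]
  refine (measure_mono ?_).trans ((measure_union_le _ _).trans ((add_le_add (hind J) hlast).trans
    ((ENNReal.ofReal_add (mul_nonneg (by positivity) (by linarith)) (by positivity)).symm.le.trans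
      (ENNReal.ofReal_le_ofReal hfin))))
  rintro ω ⟨f, hf, h⟩
  obtain ⟨b, hb, hbz⟩ := (hT J).cover f hf
  by_cases hcase : Dv J ≤ |A b.1 ω|
  · exact Or.inl ⟨b, hb, hcase⟩
  · right
    refine ⟨b, hb, ?_⟩
    have hbF := (hT J).center_mem b hb
    have hs := hsub f b.1 (hFm _ hf) (hFm _ hbF) ⟨M, hFM _ hf⟩ ⟨M, hFM _ hbF⟩ ω
    have h1 := abs_sub_abs_le_abs_sub (A f ω) (A b.1 ω)
    have h2 := hdom (fun z => f z - b.1 z) b.2 ((hFm _ hf).sub (hFm _ hbF))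
      ((hT J).measurable b hb) ⟨2 * M, hwb b hb⟩ hbz ω
    have h3 := two_mul_integral_le ((hT J).measurable b hb) (hε0 J) (hwb b hb) ((hT J).sq_le b hb)
    rw [hs] at h2
    have h5 : Dv J ≤ (12 * M * c + 16 * c + 22 * M * c) * r := by
      have h6 : M * c * 4 ^ J * r ^ 2 ≤ M * c * r := by
        calc M * c * 4 ^ J * r ^ 2 = M * c * r * (4 ^ J * r) := by ring
          _ ≤ M * c * r * 1 := by gcongr
          _ = _ := mul_one _
      have h7 : 16 * c * (1 - (2 ^ J)⁻¹) * r ≤ 16 * c * 1 * r := by gcongr; linarith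
      simp only [hDv]
      nlinarith
    have h8 : 4 * ε J * (c * 2 ^ J * r) ≤ 4 * c * r := by
      have h9 : ε J * 2 ^ J ≤ 1 := by
        calc ε J * 2 ^ J ≤ (4 ^ J)⁻¹ * 4 ^ J := by
              gcongr
              · exact hε1 J
              · norm_num
          _ = 1 := inv_mul_cancel₀ (by positivity)
      calc 4 * ε J * (c * 2 ^ J * r) = 4 * c * r * (ε J * 2 ^ J) := by ring
        _ ≤ 4 * c * r * 1 := by gcongr
        _ = _ := mul_one _
    have h10 : M * c * 4 ^ J * r ^ 2 ≤ M * c * r := by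
      calc M * c * 4 ^ J * r ^ 2 = M * c * r * (4 ^ J * r) := by ring
        _ ≤ M * c * r * 1 := by gcongr
        _ = _ := mul_one _
    -- The constants add up as 50 = 12 + 22 + 16 for `M * c`, 20 = 16 + 4 for `c`, and 8 from `2 * ε
    -- J ≤ 8 * r`.
    nlinarith [not_le.1 hcase]

end Chaining

end

noncomputable section

/-! ### The law of a random neighbour and uniform deviations of the sub-sampled average. -/

section KnnLaw

variable {D : ℕ} {𝒴 : Type*}

lemma sum_nn_eq_sum_indicator {E : Type*} [AddCommMonoid E] {s : ℕ} (k : ℕ) (x : Euc D)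
    (h : Euc D × 𝒴 → E) (w : Fin s → Euc D × 𝒴) :
    ∑ i ∈ nearestNeighbors k x (fun j => (w j).1) Finset.univ, h (w i) =
      ∑ i, {w : Fin s → Euc D × 𝒴 |
        i ∈ nearestNeighbors k x (fun j => (w j).1) Finset.univ}.indicator (fun w => h (w i)) w := by
  classical
  simp only [Set.indicator_apply, Set.mem_ofPred_eq]
  rw [← Finset.sum_filter]
  refine Finset.sum_congr ?_ fun _ _ => rfl
  ext; simp

lemma knnAverage_eq_orderEmb {k n s : ℕ} {x : Euc D} (h : Euc D × 𝒴 → ℝ) (S : Finset (Fin n)) (hS : S.card = s)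
    (z : Fin n → Euc D × 𝒴) :
    knnAverage k x h z S =
      knnAverage k x h (fun i => z (S.orderEmbOfFin hS i)) Finset.univ := by
  rw [← knnAverage_map, Finset.map_orderEmbOfFin_univ]

variable [MeasurableSpace 𝒴]

/-- The law of a uniformly chosen `k`-nearest neighbour of `x` in a sample of `s` points. -/
def knnLaw (P : Measure (Euc D × 𝒴)) (k : ℕ) (x : Euc D) (s : ℕ) : Measure (Euc D × 𝒴) :=
  (k : ENNReal)⁻¹ • ∑ i : Fin s, ((Measure.pi fun _ : Fin s => P).restrict
    {w | i ∈ nearestNeighbors k x (fun j => (w j).1) Finset.univ}).map fun w => w i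

lemma measurableSet_nn {s : ℕ} (k : ℕ) (x : Euc D) (i : Fin s) :
    MeasurableSet {w : Fin s → Euc D × 𝒴 |
      i ∈ nearestNeighbors k x (fun j => (w j).1) Finset.univ} :=
  measurableSet_mem_nearestNeighbors k x (X := fun j (w : Fin s → Euc D × 𝒴) => (w j).1)
    (fun j => (measurable_pi_apply j).fst) Finset.univ i

lemma isProbabilityMeasure_knnLaw (P : Measure (Euc D × 𝒴)) [IsProbabilityMeasure P] {k s : ℕ}
    (hk : 1 ≤ k) (hks : k ≤ s) (x : Euc D) : IsProbabilityMeasure (knnLaw P k x s) := by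
  classical
  refine ⟨?_⟩
  have h1 : ∀ i : Fin s, (((Measure.pi fun _ : Fin s => P).restrict
      {w | i ∈ nearestNeighbors k x (fun j => (w j).1) Finset.univ}).map fun w => w i) Set.univ =
      ∫⁻ w, {w : Fin s → Euc D × 𝒴 |
        i ∈ nearestNeighbors k x (fun j => (w j).1) Finset.univ}.indicator 1 w
        ∂(Measure.pi fun _ : Fin s => P) := by
    intro i
    rw [Measure.map_apply (measurable_pi_apply i) MeasurableSet.univ, lintegral_indicator_one
      (measurableSet_nn k x i)]
    simp
  rw [knnLaw, Measure.smul_apply, Measure.finsetSum_apply]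
  simp only [h1]
  rw [← lintegral_finsetSum _ fun i _ => (measurable_one.indicator (measurableSet_nn k x i))]
  have h2 : ∀ w : Fin s → Euc D × 𝒴, ∑ i : Fin s, {w : Fin s → Euc D × 𝒴 |
        i ∈ nearestNeighbors k x (fun j => (w j).1) Finset.univ}.indicator
          (1 : (Fin s → Euc D × 𝒴) → ENNReal) w = k := by
    intro w
    refine (sum_nn_eq_sum_indicator k x (fun _ => (1 : ENNReal)) w).symm.trans ?_
    rw [Finset.sum_const, card_nearestNeighbors (by simpa using hks)]
    simp
  simp only [h2]
  have hk0 : (k : ENNReal) ≠ 0 := by exact_mod_cast (show k ≠ 0 by omega)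
  simp [ENNReal.inv_mul_cancel hk0]

lemma integral_knnLaw (P : Measure (Euc D × 𝒴)) [IsProbabilityMeasure P] (k : ℕ) (x : Euc D)
    (s : ℕ) {E : Type*} [NormedAddCommGroup E] [NormedSpace ℝ E]
    {h : Euc D × 𝒴 → E} (hh : StronglyMeasurable h) {M : ℝ} (hM : ∀ z, ‖h z‖ ≤ M) :
    ∫ z, h z ∂(knnLaw P k x s) = (k : ℝ)⁻¹ • ∫ w : Fin s → Euc D × 𝒴,
      (∑ i ∈ nearestNeighbors k x (fun j => (w j).1) Finset.univ, h (w i))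
        ∂(Measure.pi fun _ => P) := by
  have hint : ∀ (ν : Measure (Euc D × 𝒴)) [IsFiniteMeasure ν], Integrable h ν := fun ν _ =>
    Integrable.of_bound hh.aestronglyMeasurable M (Filter.Eventually.of_forall hM)
  rw [knnLaw, integral_smul_measure, integral_finsetSum_measure fun i _ => hint _]
  simp only [sum_nn_eq_sum_indicator]
  rw [integral_finsetSum]
  · simp only [ENNReal.toReal_inv, ENNReal.toReal_natCast]
    congr 1
    refine Finset.sum_congr rfl fun i _ => ?_
    rw [integral_map (measurable_pi_apply i).aemeasurable hh.aestronglyMeasurable,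
      integral_indicator (measurableSet_nn k x i)]
  · intro i _
    refine Integrable.indicator ?_ (measurableSet_nn k x i)
    exact Integrable.of_bound (hh.comp_measurable (measurable_pi_apply i)).aestronglyMeasurable M
      (Filter.Eventually.of_forall fun w => hM _)

lemma integral_knnLaw_eq_knnAverage (P : Measure (Euc D × 𝒴)) [IsProbabilityMeasure P] (k : ℕ)
    (x : Euc D) (s : ℕ) {h : Euc D × 𝒴 → ℝ} (hh : Measurable h) {M : ℝ} (hM : ∀ z, |h z| ≤ M) :
    ∫ z, h z ∂(knnLaw P k x s) =
      ∫ w : Fin s → Euc D × 𝒴, knnAverage k x h w Finset.univ ∂(Measure.pi fun _ => P) := by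
  rw [integral_knnLaw P k x s hh.stronglyMeasurable (M := M) hM]
  simp only [knnAverage, integral_div, smul_eq_mul]
  ring

/-- The deviation of the sub-sampled `k`-NN average of `h` from its mean. -/
def knnDeviation (P : Measure (Euc D × 𝒴)) (k : ℕ) (x : Euc D) {n B : ℕ} (s : ℕ)
    (h : Euc D × 𝒴 → ℝ) (p : (Fin n → Euc D × 𝒴) × (Fin B → Finset (Fin n))) : ℝ :=
  (∑ b, knnAverage k x h p.1 (p.2 b)) / B - ∫ z, h z ∂(knnLaw P k x s)

lemma integrable_of_abs_le {Ω : Type*} [MeasurableSpace Ω] {μ : Measure Ω} [IsFiniteMeasure μ]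
    {f : Ω → ℝ} (hf : Measurable f) (hM : ∃ M, ∀ ω, |f ω| ≤ M) : Integrable f μ := by
  obtain ⟨M, hM⟩ := hM
  exact Integrable.of_bound hf.aestronglyMeasurable M (Filter.Eventually.of_forall hM)

variable {P : Measure (Euc D × 𝒴)} {k : ℕ} {x : Euc D} {n B s : ℕ}

lemma knnDeviation_sub [IsFiniteMeasure (knnLaw P k x s)] {f g : Euc D × 𝒴 → ℝ}
    (hf : Measurable f) (hg : Measurable g)
    (hfM : ∃ M, ∀ z, |f z| ≤ M) (hgM : ∃ M, ∀ z, |g z| ≤ M)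
    (p : (Fin n → Euc D × 𝒴) × (Fin B → Finset (Fin n))) :
    knnDeviation P k x s (fun z => f z - g z) p =
      knnDeviation P k x s f p - knnDeviation P k x s g p := by
  simp only [knnDeviation, knnAverage]
  rw [integral_sub (integrable_of_abs_le hf hfM) (integrable_of_abs_le hg hgM)]
  simp only [Finset.sum_sub_distrib, sub_div]
  ring

/-- The empirical average of `w` is its deviation plus its mean, and the mean of `f` contributes a
second copy of the mean of `w`. Together with `knnDeviation_sub` this supplies the structural
hypotheses of `chaining_tail`. -/
lemma abs_knnDeviation_le [IsFiniteMeasure (knnLaw P k x s)] {f w : Euc D × 𝒴 → ℝ}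
    (hf : Measurable f) (hw : Measurable w) (hwM : ∃ M, ∀ z, |w z| ≤ M) (hfw : ∀ z, |f z| ≤ w z)
    (p : (Fin n → Euc D × 𝒴) × (Fin B → Finset (Fin n))) :
    |knnDeviation P k x s f p| ≤
      |knnDeviation P k x s w p| + 2 * ∫ z, w z ∂(knnLaw P k x s) := by
  have hfM : ∃ M, ∀ z, |f z| ≤ M := by
    obtain ⟨M, hM⟩ := hwM
    exact ⟨M, fun z => (hfw z).trans ((le_abs_self _).trans (hM z))⟩
  have h1 : |∫ z, f z ∂(knnLaw P k x s)| ≤ ∫ z, w z ∂(knnLaw P k x s) :=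
    abs_integral_le_integral_abs.trans
      (integral_mono (integrable_of_abs_le hf hfM).abs (integrable_of_abs_le hw hwM) hfw)
  have h2 : |(∑ b, knnAverage k x f p.1 (p.2 b)) / B| ≤
      (∑ b, knnAverage k x w p.1 (p.2 b)) / B := by
    rw [abs_div, Nat.abs_cast]
    gcongr
    refine (Finset.abs_sum_le_sum_abs _ _).trans (Finset.sum_le_sum fun b _ => ?_)
    rw [knnAverage, knnAverage, abs_div, Nat.abs_cast]
    gcongr
    exact (Finset.abs_sum_le_sum_abs _ _).trans (Finset.sum_le_sum fun i _ => hfw _)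
  rw [knnDeviation]
  refine (abs_sub _ _).trans ?_
  have h3 := le_abs_self (knnDeviation P k x s w p)
  rw [knnDeviation] at h3 ⊢
  linarith

/-- The kernel is the centred neighbour average. Its variance is bounded through `knnAverage_sq_le`
by the second moment of `f` under `knnLaw`. Brackets must therefore be small in L₂ of this law,
which changes with `s`; this is where entropy bounds for every measure are needed. Centring doubles
the sup bound, hence the 8. -/
lemma knnDeviation_tail [IsProbabilityMeasure P] {m : ℕ} (hk : 1 ≤ k) (hks : k ≤ s)
    (hms : m * s ≤ n) (hsn : s ≤ n) (hmB : m ≤ B) (hm : 1 ≤ m) {f : Euc D × 𝒴 → ℝ}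
    (hf : Measurable f) {M σ ℓ : ℝ} (hM : 0 < M) (hσ : 0 < σ) (hℓ : 0 < ℓ) (hfM : ∀ z, |f z| ≤ M)
    (hfσ : ∫ z, f z ^ 2 ∂(knnLaw P k x s) ≤ σ ^ 2) :
    subsampleLaw P n s B
      {p | 4 * σ * √(ℓ / m) + 8 * M * (ℓ / m) ≤ |knnDeviation P k x s f p|} ≤
        ENNReal.ofReal (2 * Real.exp (-ℓ)) := by
  have := isProbabilityMeasure_knnLaw P hk hks x
  have hB : (0 : ℝ) < B := by exact_mod_cast hm.trans hmB
  set e := ∫ z, f z ∂(knnLaw P k x s) with he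
  have heq : e = ∫ w : Fin s → Euc D × 𝒴, knnAverage k x f w Finset.univ ∂(Measure.pi fun _ => P) :=
    integral_knnLaw_eq_knnAverage P k x s hf hfM
  have heM : |e| ≤ M := by
    refine abs_integral_le_integral_abs.trans ?_
    calc _ ≤ ∫ _, M ∂(knnLaw P k x s) := integral_mono
          (integrable_of_abs_le hf ⟨M, hfM⟩).abs (integrable_const _) hfM
      _ = M := by simp
  have hgm : Measurable fun w : Fin s → Euc D × 𝒴 => knnAverage k x f w Finset.univ :=
    measurable_knnAverage k x hf (fun i => measurable_pi_apply i) _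
  have hgM : ∀ w : Fin s → Euc D × 𝒴, |knnAverage k x f w Finset.univ| ≤ M := fun w =>
    abs_knnAverage_le x hM.le hfM w _
  have hg1 := integrable_of_abs_le (μ := Measure.pi fun _ : Fin s => P) hgm ⟨M, hgM⟩
  have hsqM : ∀ z, |f z ^ 2| ≤ M ^ 2 := fun z => by
    rw [abs_pow]; exact pow_le_pow_left₀ (abs_nonneg _) (hfM z) 2
  have hg2 : Integrable (fun w : Fin s → Euc D × 𝒴 => knnAverage k x f w Finset.univ ^ 2)
      (Measure.pi fun _ : Fin s => P) :=
    integrable_of_abs_le (hgm.pow_const 2) ⟨M ^ 2, fun w => by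
      rw [abs_pow]; exact pow_le_pow_left₀ (abs_nonneg _) (hgM w) 2⟩
  have h := incomplete_tail hms hsn hmB hm P
    (φ₀ := fun w => knnAverage k x f w Finset.univ - e) (hgm.sub_const e)
    (φ := fun S z => knnAverage k x f z S - e)
    (fun S => (measurable_knnAverage k x hf (fun i => measurable_pi_apply i) S).sub_const e)
    (fun S hS z => by rw [knnAverage_eq_orderEmb f S hS z]) (M := 2 * M) (σ := σ) (ℓ := ℓ)
    (by positivity) hσ hℓ (fun w => by linarith [abs_sub (knnAverage k x f w Finset.univ) e, hgM w])
    (fun S z => by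
      linarith [abs_sub (knnAverage k x f z S) e, abs_knnAverage_le (k := k) x hM.le hfM z S])
    (by rw [integral_sub hg1 (integrable_const _), ← heq]; simp)
    (by
      have h1 : ∫ w : Fin s → Euc D × 𝒴, (knnAverage k x f w Finset.univ - e) ^ 2
          ∂(Measure.pi fun _ => P) = ∫ w : Fin s → Euc D × 𝒴, knnAverage k x f w Finset.univ ^ 2
          ∂(Measure.pi fun _ => P) - e ^ 2 := by
        have h2 : ∀ w : Fin s → Euc D × 𝒴, (knnAverage k x f w Finset.univ - e) ^ 2 =
            knnAverage k x f w Finset.univ ^ 2 -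
              (2 * e * knnAverage k x f w Finset.univ - e ^ 2) := fun w => by ring
        simp only [h2]
        have h5 := integral_sub hg2 (((hg1.const_mul (2 * e)).sub (integrable_const (e ^ 2))))
        refine h5.trans ?_
        have h6 := integral_sub (hg1.const_mul (2 * e)) (integrable_const (e ^ 2))
        rw [integral_const_mul, ← heq] at h6
        refine (congrArg _ h6).trans ?_
        simp only [integral_const, probReal_univ, smul_eq_mul, one_mul]
        ring
      have h3 : ∫ w : Fin s → Euc D × 𝒴, knnAverage k x f w Finset.univ ^ 2
          ∂(Measure.pi fun _ => P) ≤ ∫ z, f z ^ 2 ∂(knnLaw P k x s) := by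
        rw [integral_knnLaw_eq_knnAverage P k x s (hf.pow_const 2) hsqM]
        refine integral_mono hg2 (integrable_of_abs_le
          (measurable_knnAverage k x (hf.pow_const 2) (fun i => measurable_pi_apply i) _)
          ⟨M ^ 2, fun w => abs_knnAverage_le x (sq_nonneg M) hsqM w _⟩)
          fun w => knnAverage_sq_le x f w _
      rw [h1]
      nlinarith [sq_nonneg e])
  refine (measure_mono ?_).trans h
  intro p hp
  rw [Set.mem_ofPred_eq] at hp ⊢
  have h4 : (∑ b, (knnAverage k x f p.1 (p.2 b) - e)) / B = knnDeviation P k x s f p := by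
    rw [knnDeviation, Finset.sum_sub_distrib, Finset.sum_const, Finset.card_univ, Fintype.card_fin,
      nsmul_eq_mul, sub_div, mul_div_cancel_left₀ _ hB.ne']
  rw [h4]
  refine le_trans (le_of_eq ?_) hp
  ring

/-- The sub-sampled `k`-NN averages concentrate uniformly over a class of bounded functions with
bracketing entropy of order `1 / ε`. -/
theorem knnDeviation_uniform_tail [IsProbabilityMeasure P] {m : ℕ} (hk : 1 ≤ k) (hks : k ≤ s)
    (hms : m * s ≤ n) (hsn : s ≤ n) (hmB : m ≤ B) (hm : 1 ≤ m)
    {F : Set (Euc D × 𝒴 → ℝ)} {M C ℓ : ℝ} (hM : 0 < M) (hC : 0 ≤ C)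
    (hFm : ∀ f ∈ F, Measurable f) (hFM : ∀ f ∈ F, ∀ z, |f z| ≤ M)
    (hcov : ∀ Q : Measure (Euc D × 𝒴), IsProbabilityMeasure Q → ∀ ε : ℝ, 0 < ε → ε ≤ 1 →
      ((bracketingNumber F Q ε : ℕ∞) : ENNReal) ≤ ENNReal.ofReal (Real.exp (C / ε)))
    (hℓ : 1 ≤ ℓ) :
    subsampleLaw P n s B {p | ∃ f ∈ F, (50 * M * (C + 1) + 20 * (C + 1) + 8) * √(ℓ / m) <
        |knnDeviation P k x s f p|} ≤ ENNReal.ofReal (6 * Real.exp (-ℓ)) := by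
  have := isProbabilityMeasure_knnLaw P hk hks x
  rcases le_or_gt ℓ m with hℓm | hℓm
  · refine (measure_mono ?_).trans (chaining_tail (Q := knnLaw P k x s)
      (A := fun f p => knnDeviation P k x s f p)
      (fun f g hf hg hfM hgM p => knnDeviation_sub hf hg hfM hgM p)
      (fun f w hf hw hwM hfw p => abs_knnDeviation_le hf hw hwM hfw p)
      (fun f M σ ℓ hf hM hσ hℓ hfM hfσ =>
        knnDeviation_tail hk hks hms hsn hmB hm hf hM hσ hℓ hfM hfσ)
      hM hC hFm hFM (hcov _ this) hℓ hℓm)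
    rintro p ⟨f, hf, h⟩
    exact ⟨f, hf, h.le⟩
  -- For `ℓ > m` the claim is trivial: deviations never exceed `2 * M`, while `√(ℓ / m) ≥ 1`.
  · have hempty : {p : (Fin n → Euc D × 𝒴) × (Fin B → Finset (Fin n)) |
        ∃ f ∈ F, (50 * M * (C + 1) + 20 * (C + 1) + 8) * √(ℓ / m) <
        |knnDeviation P k x s f p|} = ∅ := by
      ext p
      simp only [Set.mem_ofPred_eq, Set.mem_empty_iff_false, iff_false, not_exists, not_and, not_lt]
      intro f hf
      have hm0 : (0 : ℝ) < m := by exact_mod_cast hm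
      have h1 : 1 ≤ √(ℓ / m) := Real.one_le_sqrt.2 (by rw [one_le_div hm0]; exact hℓm.le)
      have h2 : |(∑ b, knnAverage k x f p.1 (p.2 b)) / B| ≤ M := by
        have hB : (0 : ℝ) < B := by exact_mod_cast hm.trans hmB
        rw [abs_div, Nat.abs_cast, div_le_iff₀ hB]
        refine (Finset.abs_sum_le_sum_abs _ _).trans ((Finset.sum_le_card_nsmul _ _ M fun b _ =>
          abs_knnAverage_le x hM.le (hFM f hf) _ _).trans ?_)
        simp [mul_comm]
      have h3 : |∫ z, f z ∂(knnLaw P k x s)| ≤ M := by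
        refine abs_integral_le_integral_abs.trans ?_
        calc _ ≤ ∫ _, M ∂(knnLaw P k x s) := integral_mono
              (integrable_of_abs_le (hFm f hf) ⟨M, hFM f hf⟩).abs (integrable_const _) (hFM f hf)
          _ = M := by simp
      have h4 := abs_sub ((∑ b, knnAverage k x f p.1 (p.2 b)) / B) (∫ z, f z ∂(knnLaw P k x s))
      rw [knnDeviation]
      have h5 : 0 ≤ M * C := by positivity
      have h6 : 2 * M ≤ 50 * M * (C + 1) + 20 * (C + 1) + 8 := by nlinarith
      nlinarith
    rw [hempty]
    simp

end KnnLaw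

end

noncomputable section

/-! ### Bias of the nearest-neighbour kernel. -/

section Bias

/-- Resampling one coordinate leaves the law unchanged; this gives access to the integral over
coordinate `i` with the others frozen. -/
lemma measurePreserving_update {ι 𝒵 : Type*} [Fintype ι] [DecidableEq ι] [MeasurableSpace 𝒵]
    (P : Measure 𝒵) [IsProbabilityMeasure P] (i : ι) :
    MeasurePreserving (fun q : (ι → 𝒵) × 𝒵 => Function.update q.1 i q.2)
      ((Measure.pi fun _ => P).prod P) (Measure.pi fun _ => P) := by
  have hm : Measurable fun q : (ι → 𝒵) × 𝒵 => Function.update q.1 i q.2 := by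
    refine measurable_pi_lambda _ fun j => ?_
    by_cases h : j = i
    · subst h; simpa using measurable_snd
    · simp only [Function.update_of_ne h]
      exact (measurable_pi_apply j).comp measurable_fst
  refine ⟨hm, (Measure.pi_eq fun t ht => ?_).symm⟩
  rw [Measure.map_apply hm (MeasurableSet.univ_pi ht)]
  have hset : (fun q : (ι → 𝒵) × 𝒵 => Function.update q.1 i q.2) ⁻¹' Set.univ.pi t =
      (Set.univ.pi (Function.update t i Set.univ)) ×ˢ t i := by
    ext q
    simp only [Set.mem_preimage, Set.mem_univ_pi, Set.mem_prod]
    constructor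
    · intro h
      refine ⟨fun j => ?_, by simpa using h i⟩
      by_cases hj : j = i
      · subst hj; simp
      · simpa [Function.update_of_ne hj] using h j
    · rintro ⟨h1, h2⟩ j
      by_cases hj : j = i
      · subst hj; simpa using h2
      · simpa [Function.update_of_ne hj] using h1 j
  rw [hset, Measure.prod_prod, Measure.pi_pi, ← Finset.prod_erase_mul _ _ (Finset.mem_univ i)]
  simp only [Function.update_self, measure_univ, mul_one]
  rw [← Finset.prod_erase_mul Finset.univ (fun j => P (t j)) (Finset.mem_univ i)]
  congr 1
  refine Finset.prod_congr rfl fun j hj => ?_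
  rw [Function.update_of_ne (Finset.ne_of_mem_erase hj)]

variable {D : ℕ} {𝒴 : Type*} [MeasurableSpace 𝒴]

/-- With the other observations frozen, the event that `i` is a neighbour is an event about the
covariate of observation `i` alone, and over such events `h` and its conditional expectation have
the same integral. -/
lemma integral_indicator_nn_condExp {p s : ℕ} (P : Measure (Euc D × 𝒴)) [IsProbabilityMeasure P]
    (k : ℕ) (x : Euc D) {h : Euc D × 𝒴 → Euc p} (hi : Integrable h P) (i : Fin s) :
    ∫ w, {w : Fin s → Euc D × 𝒴 |
        i ∈ nearestNeighbors k x (fun j => (w j).1) Finset.univ}.indicator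
          (fun w => h (w i) -
            P[h | MeasurableSpace.comap Prod.fst inferInstance] (w i)) w
          ∂(Measure.pi fun _ => P) = 0 := by
  set η := P[h | MeasurableSpace.comap Prod.fst inferInstance] with hη
  have hle : MeasurableSpace.comap (Prod.fst : Euc D × 𝒴 → Euc D) inferInstance ≤
      (inferInstance : MeasurableSpace (Euc D × 𝒴)) := measurable_fst.comap_le
  have hηi : Integrable η P := integrable_condExp
  have hint : Integrable (fun w : Fin s → Euc D × 𝒴 => h (w i) - η (w i))
      (Measure.pi fun _ => P) :=
    (measurePreserving_eval (fun _ : Fin s => P) i).integrable_comp_of_integrable (hi.sub hηi)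
  have hintI := hint.indicator (measurableSet_nn k x i)
  have hup := measurePreserving_update P i (ι := Fin s)
  rw [← hup.map_eq] at hintI ⊢
  rw [integral_map hup.measurable.aemeasurable hintI.aestronglyMeasurable]
  refine (integral_prod _ (hintI.comp_measurable hup.measurable)).trans ?_
  refine integral_eq_zero_of_ae (Filter.Eventually.of_forall fun w => ?_)
  set A : Set (Euc D) := {a | i ∈ nearestNeighbors k x
    (fun j => Function.update (fun j => (w j).1) i a j) Finset.univ} with hA
  have hAm : MeasurableSet A := by
    refine measurableSet_mem_nearestNeighbors k x
      (X := fun j a => Function.update (fun j => (w j).1) i a j) (fun j => ?_) Finset.univ i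
    by_cases hj : j = i
    · subst hj; simp only [Function.update_self]; exact measurable_id
    · simp [Function.update_of_ne hj]
  have hpt : ∀ z : Euc D × 𝒴, {w : Fin s → Euc D × 𝒴 |
        i ∈ nearestNeighbors k x (fun j => (w j).1) Finset.univ}.indicator
          (fun w => h (w i) - η (w i)) (Function.update w i z) =
      (Prod.fst ⁻¹' A).indicator (fun z => h z - η z) z := by
    intro z
    have hX : (fun j => (Function.update w i z j).1) =
        fun j => Function.update (fun j => (w j).1) i z.1 j := by
      funext j
      by_cases hj : j = i
      · subst hj; simp
      · simp [Function.update_of_ne hj]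
    have hmem : z ∈ Prod.fst ⁻¹' A ↔ i ∈ nearestNeighbors k x
        (fun j => Function.update (fun j => (w j).1) i z.1 j) Finset.univ := Iff.rfl
    rw [Set.indicator_apply]
    simp only [Set.mem_ofPred_eq, hX, Function.update_self]
    by_cases hz : z ∈ Prod.fst ⁻¹' A
    · rw [Set.indicator_of_mem hz, if_pos (hmem.1 hz)]
    · rw [Set.indicator_of_notMem hz, if_neg (mt hmem.2 hz)]
  refine (integral_congr_ae (Filter.Eventually.of_forall hpt)).trans ?_
  rw [Pi.zero_apply, integral_indicator (measurable_fst hAm), integral_sub hi.integrableOn hηi.integrableOn,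
    hη, setIntegral_condExp hle hi ⟨A, hAm, rfl⟩, sub_self]

lemma integral_knnRadius_eq_expectedShrinkage (P : Measure (Euc D × 𝒴)) [IsProbabilityMeasure P]
    (k : ℕ) (x : Euc D) (s : ℕ) :
    ∫ w : Fin s → Euc D × 𝒴, knnRadius k x (fun j => (w j).1) Finset.univ
      ∂(Measure.pi fun _ => P) = expectedShrinkage (P.map Prod.fst) k x s := by
  have := Measure.isProbabilityMeasure_map (μ := P) (measurable_fst.aemeasurable :
    AEMeasurable (Prod.fst : Euc D × 𝒴 → Euc D) P)
  have hmp : MeasurePreserving (fun (w : Fin s → Euc D × 𝒴) j => (w j).1)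
      (Measure.pi fun _ => P) (Measure.pi fun _ => P.map Prod.fst) :=
    measurePreserving_pi (fun _ => P) (fun _ => P.map Prod.fst)
      fun _ => ⟨measurable_fst, rfl⟩
  rw [expectedShrinkage, ← hmp.map_eq, integral_map hmp.measurable.aemeasurable]
  exact (measurable_knnRadius k x (X := fun j (w : Fin s → Euc D) => w j)
    (fun j => measurable_pi_apply j) Finset.univ).aestronglyMeasurable

/-- The scores at the neighbours are replaced by conditional means, each within `|c|` times the
neighbour radius of `a`; the expected radius is the expected shrinkage. -/
lemma norm_integral_knnLaw_sub_le {p s k : ℕ} (hk : 1 ≤ k) (hks : k ≤ s)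
    (P : Measure (Euc D × 𝒴)) [IsProbabilityMeasure P] (x : Euc D) {h : Euc D × 𝒴 → Euc p}
    (hh : Measurable h) {M : ℝ} (hM : ∀ z, ‖h z‖ ≤ M) {a : Euc p} {c Δ : ℝ}
    (hΔ : ∀ᵐ z ∂P, dist x z.1 ≤ Δ)
    (hc : ∀ᵐ z ∂P, ‖P[h | MeasurableSpace.comap Prod.fst inferInstance] z - a‖ ≤ c * dist x z.1) :
    ‖∫ z, h z ∂(knnLaw P k x s) - a‖ ≤ |c| * expectedShrinkage (P.map Prod.fst) k x s := by
  set η := P[h | MeasurableSpace.comap Prod.fst inferInstance] with hη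
  have hk0 : (0 : ℝ) < k := by exact_mod_cast hk
  have hi : Integrable h P := Integrable.of_bound hh.aestronglyMeasurable M
    (Filter.Eventually.of_forall hM)
  have hηi : Integrable η P := integrable_condExp
  have hev := fun i : Fin s => measurePreserving_eval (fun _ : Fin s => P) i
  have hmem : ∀ {g : Euc D × 𝒴 → Euc p}, Integrable g P → ∀ i : Fin s,
      Integrable ({w : Fin s → Euc D × 𝒴 |
        i ∈ nearestNeighbors k x (fun j => (w j).1) Finset.univ}.indicator fun w => g (w i))
        (Measure.pi fun _ => P) := fun hg i =>
    ((hev i).integrable_comp_of_integrable hg).indicator (measurableSet_nn k x i)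
  have hsumint : ∀ {g : Euc D × 𝒴 → Euc p}, Integrable g P →
      Integrable (fun w : Fin s → Euc D × 𝒴 =>
        ∑ i ∈ nearestNeighbors k x (fun j => (w j).1) Finset.univ, g (w i))
        (Measure.pi fun _ => P) := fun hg => by
    simp only [sum_nn_eq_sum_indicator]
    exact integrable_finsetSum _ fun i _ => hmem hg i
  have h1 : ∫ w : Fin s → Euc D × 𝒴,
      (∑ i ∈ nearestNeighbors k x (fun j => (w j).1) Finset.univ, h (w i))
        ∂(Measure.pi fun _ => P) = ∫ w : Fin s → Euc D × 𝒴,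
      (∑ i ∈ nearestNeighbors k x (fun j => (w j).1) Finset.univ, η (w i))
        ∂(Measure.pi fun _ => P) := by
    rw [← sub_eq_zero, ← integral_sub (hsumint hi) (hsumint hηi)]
    simp only [← Finset.sum_sub_distrib]
    simp only [sum_nn_eq_sum_indicator (h := fun z => h z - η z)]
    refine (integral_finsetSum _ fun i _ => hmem (hi.sub hηi) i).trans ?_
    exact Finset.sum_eq_zero fun i _ => integral_indicator_nn_condExp P k x hi i
  have h2 : ∫ z, h z ∂(knnLaw P k x s) - a = (k : ℝ)⁻¹ • ∫ w : Fin s → Euc D × 𝒴,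
      (∑ i ∈ nearestNeighbors k x (fun j => (w j).1) Finset.univ, (η (w i) - a))
        ∂(Measure.pi fun _ => P) := by
    rw [integral_knnLaw P k x s hh.stronglyMeasurable hM, h1]
    have h3 : ∀ w : Fin s → Euc D × 𝒴,
        ∑ i ∈ nearestNeighbors k x (fun j => (w j).1) Finset.univ, (η (w i) - a) =
        (∑ i ∈ nearestNeighbors k x (fun j => (w j).1) Finset.univ, η (w i)) - (k : ℝ) • a := by
      intro w
      rw [Finset.sum_sub_distrib, Finset.sum_const, card_nearestNeighbors (by simpa using hks),
        Nat.cast_smul_eq_nsmul]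
    simp only [h3]
    rw [integral_sub (hsumint hηi) (integrable_const _), smul_sub, integral_const, probReal_univ,
      one_smul, inv_smul_smul₀ hk0.ne']
  have hall : ∀ᵐ w : Fin s → Euc D × 𝒴 ∂(Measure.pi fun _ => P), ∀ i,
      dist x (w i).1 ≤ Δ ∧ ‖η (w i) - a‖ ≤ c * dist x (w i).1 :=
    ae_all_iff.2 fun i => (hev i).quasiMeasurePreserving.ae (hΔ.and hc)
  have hRm : Measurable fun w : Fin s → Euc D × 𝒴 =>
      knnRadius k x (fun j => (w j).1) Finset.univ :=
    measurable_knnRadius k x (X := fun j (w : Fin s → Euc D × 𝒴) => (w j).1)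
      (fun j => (measurable_pi_apply j).fst) Finset.univ
  have hRi : Integrable (fun w : Fin s → Euc D × 𝒴 =>
      knnRadius k x (fun j => (w j).1) Finset.univ) (Measure.pi fun _ => P) := by
    refine Integrable.of_bound hRm.aestronglyMeasurable (max Δ 0) (hall.mono fun w hw => ?_)
    rw [Real.norm_eq_abs, abs_of_nonneg (knnRadius_nonneg ..)]
    exact knnRadius_le (le_max_right _ _) fun i _ => (hw i).1.trans (le_max_left _ _)
  rw [h2, norm_smul, norm_inv, Real.norm_natCast, inv_mul_le_iff₀ hk0]
  calc _ ≤ ∫ w : Fin s → Euc D × 𝒴, k * (|c| * knnRadius k x (fun j => (w j).1) Finset.univ)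
        ∂(Measure.pi fun _ => P) := by
        refine norm_integral_le_of_norm_le ((hRi.const_mul _).const_mul _) (hall.mono fun w hw => ?_)
        refine (norm_sum_le_of_le _ (n := fun _ =>
          |c| * knnRadius k x (fun j => (w j).1) Finset.univ) fun i hi => ?_).trans ?_
        · refine (hw i).2.trans ((mul_le_mul_of_nonneg_right (le_abs_self c) dist_nonneg).trans ?_)
          exact mul_le_mul_of_nonneg_left (dist_le_knnRadius hi) (abs_nonneg c)
        · rw [Finset.sum_const, card_nearestNeighbors (by simpa using hks), nsmul_eq_mul]
    _ = _ := by
        rw [integral_const_mul, integral_const_mul, integral_knnRadius_eq_expectedShrinkage]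

end Bias

/-! ### From the score to the parameter. -/

section Geometry

lemma knnScore_apply {D p n B : ℕ} {𝒴 : Type*} (k : ℕ) (x : Euc D)
    (ψ : Euc D × 𝒴 → Euc p → Euc p) (z : Fin n → Euc D × 𝒴) (S : Fin B → Finset (Fin n))
    (θ : Euc p) (j : Fin p) :
    knnScore k x ψ z S θ j = (∑ b, knnAverage k x (fun z => ψ z θ j) z (S b)) / B := by
  classical
  simp only [knnScore, knnWeight, knnAverage]
  rw [WithLp.ofLp_sum, Finset.sum_apply]
  simp only [PiLp.smul_apply, smul_eq_mul]
  simp only [div_mul_eq_mul_div, Finset.sum_mul]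
  rw [← Finset.sum_div, Finset.sum_comm]
  congr 1
  refine Finset.sum_congr rfl fun b _ => ?_
  rw [Finset.sum_div]
  simp only [ite_mul, zero_mul]
  rw [← Finset.sum_filter]
  have hfil : (Finset.univ.filter fun i => i ∈ nearestNeighbors k x (fun j => (z j).1) (S b)) =
      nearestNeighbors k x (fun j => (z j).1) (S b) := by ext; simp
  rw [hfil]
  exact Finset.sum_congr rfl fun i _ => by ring

lemma norm_le_sqrt_mul {p : ℕ} {v : Euc p} {c : ℝ} (hc : 0 ≤ c) (h : ∀ j, |v j| ≤ c) :
    ‖v‖ ≤ √p * c := by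
  rw [EuclideanSpace.norm_eq, Real.sqrt_le_left (by positivity), mul_pow,
    Real.sq_sqrt (Nat.cast_nonneg p)]
  refine (Finset.sum_le_card_nsmul _ _ (c ^ 2) fun j _ => ?_).trans (by simp)
  rw [Real.norm_eq_abs]
  exact pow_le_pow_left₀ (abs_nonneg _) (h j) 2

/-- On the segment from θ₀ to θ the function `L - lam / 2 * ‖·‖ ^ 2` is convex, so its derivative at
the start is at most its derivative at the end. As the gradient vanishes at θ₀, this reads `lam *
‖v‖ ^ 2 ≤ ⟪g θ, v⟫`, and Cauchy–Schwarz concludes. One-sided derivatives within the segment suffice,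
so Θ need not be open. -/
lemma strongConvexOn_mul_norm_le {p : ℕ} {Θ : Set (Euc p)} {lam : ℝ} {L : Euc p → ℝ}
    {g : Euc p → Euc p} (hL : StrongConvexOn Θ lam L)
    (hg : ∀ θ ∈ Θ, HasGradientWithinAt L (g θ) Θ θ) {θ θ₀ : Euc p} (hθ : θ ∈ Θ) (hθ₀ : θ₀ ∈ Θ)
    (h0 : g θ₀ = 0) : lam * ‖θ - θ₀‖ ≤ ‖g θ‖ := by
  rcases eq_or_ne θ θ₀ with rfl | hne
  · simp
  have hpos : 0 < ‖θ - θ₀‖ := norm_pos_iff.2 (sub_ne_zero.2 hne)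
  set v := θ - θ₀ with hv
  set f : Euc p → ℝ := fun y => L y - lam / 2 * ‖y‖ ^ 2 with hf
  have hconv : ConvexOn ℝ Θ f := strongConvexOn_iff_convex.1 hL
  set γ : ℝ → Euc p := fun t => θ₀ + t • v with hγ
  have hγmem : ∀ t ∈ Set.Icc (0 : ℝ) 1, γ t ∈ Θ := by
    intro t ht
    have := hconv.1 hθ₀ hθ (sub_nonneg.2 ht.2) ht.1 (by ring)
    convert this using 1
    simp only [hγ, hv]; module
  have hγ0 : γ 0 = θ₀ := by simp [hγ]
  have hγ1 : γ 1 = θ := by simp [hγ, hv]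
  have hcomp : ConvexOn ℝ (Set.Icc (0 : ℝ) 1) (f ∘ γ) := by
    refine ⟨convex_Icc 0 1, fun s hs t ht a b ha hb hab => ?_⟩
    have := hconv.2 (hγmem s hs) (hγmem t ht) ha hb hab
    have hlin : γ (a • s + b • t) = a • γ s + b • γ t := by
      simp only [hγ, smul_eq_mul]
      rw [show a • (θ₀ + s • v) + b • (θ₀ + t • v) = (a + b) • θ₀ + (a * s + b * t) • v by module,
        hab, one_smul]
    simpa only [Function.comp_apply, hlin] using this
  have hderiv : ∀ t ∈ Set.Icc (0 : ℝ) 1, HasDerivWithinAt (f ∘ γ)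
      (inner ℝ (g (γ t)) v - lam * inner ℝ (γ t) v) (Set.Icc 0 1) t := by
    intro t ht
    have hγd : HasDerivWithinAt γ v (Set.Icc 0 1) t := by
      have := ((hasDerivAt_id t).smul_const v).const_add θ₀
      simpa [hγ] using this.hasDerivWithinAt
    have h1 := (hg _ (hγmem t ht)).hasFDerivWithinAt.comp_hasDerivWithinAt t hγd hγmem
    have h2 := hγd.norm_sq.const_mul (lam / 2)
    have h3 := h1.sub h2
    refine h3.congr_deriv ?_
    simp only [InnerProductSpace.toDual_apply_apply]
    ring
  have h0d := hcomp.le_slope_of_hasDerivWithinAt (by simp) (by simp) zero_lt_one (hderiv 0 (by simp))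
  have h1d := hcomp.slope_le_of_hasDerivWithinAt (by simp) (by simp) zero_lt_one (hderiv 1 (by simp))
  have h01 := h0d.trans h1d
  rw [hγ0, hγ1, h0, inner_zero_left] at h01
  have h4 : lam * ‖v‖ ^ 2 ≤ inner ℝ (g θ) v := by
    rw [← real_inner_self_eq_norm_sq]
    nth_rewrite 1 [hv]
    rw [inner_sub_left]
    linarith
  have h5 := real_inner_le_norm (g θ) v
  by_contra! hlt
  nlinarith

end Geometry

end

noncomputable section

/-! ### Size and monotonicity of the expected shrinkage. -/

section Shrinkage

variable {D : ℕ} {μ : Measure (Euc D)} [IsProbabilityMeasure μ] {x : Euc D} {Δ : ℝ}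

lemma measurable_knnRadius_pi {ι : Type*} [LinearOrder ι] (k : ℕ) (x : Euc D) (S : Finset ι) :
    Measurable fun w : ι → Euc D => knnRadius k x w S :=
  measurable_knnRadius k x (X := fun j (w : ι → Euc D) => w j) (fun j => measurable_pi_apply j) S

lemma ae_knnRadius_mem_Icc {n : ℕ} (hΔ0 : 0 ≤ Δ) (hΔ : ∀ᵐ a ∂μ, dist x a ≤ Δ) (k : ℕ)
    (S : Finset (Fin n)) :
    ∀ᵐ w ∂(Measure.pi fun _ : Fin n => μ), knnRadius k x w S ∈ Set.Icc 0 Δ := by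
  have : ∀ᵐ w ∂(Measure.pi fun _ : Fin n => μ), ∀ i, dist x (w i) ≤ Δ :=
    ae_all_iff.2 fun i =>
      (measurePreserving_eval (fun _ : Fin n => μ) i).quasiMeasurePreserving.ae hΔ
  exact this.mono fun w hw => ⟨knnRadius_nonneg .., knnRadius_le hΔ0 fun i _ => hw i⟩

lemma integrable_knnRadius {n : ℕ} (hΔ0 : 0 ≤ Δ) (hΔ : ∀ᵐ a ∂μ, dist x a ≤ Δ) (k : ℕ)
    (S : Finset (Fin n)) :
    Integrable (fun w => knnRadius k x w S) (Measure.pi fun _ : Fin n => μ) :=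
  Integrable.of_bound (measurable_knnRadius_pi k x S).aestronglyMeasurable Δ
    ((ae_knnRadius_mem_Icc hΔ0 hΔ k S).mono fun w hw => by
      rw [Real.norm_eq_abs, abs_of_nonneg hw.1]; exact hw.2)

/-- The complete U-statistic concentrates around the expected shrinkage. -/
lemma shrinkageEstimate_tail {n k s : ℕ} (hsn : s ≤ n) (hΔ0 : 0 < Δ)
    (hΔ : ∀ᵐ a ∂μ, dist x a ≤ Δ) {t : ℝ} (ht : 0 ≤ t) :
    (Measure.pi fun _ : Fin n => μ)
      {X | t ≤ |shrinkageEstimate k x X s - expectedShrinkage μ k x s|} ≤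
      ENNReal.ofReal (2 * Real.exp (-(2 * (n / s : ℕ) * t ^ 2 / Δ ^ 2))) :=
  uStatistic_tail (Nat.div_mul_le_self n s) hsn μ
    (φ₀ := fun w => knnRadius k x w Finset.univ) (measurable_knnRadius_pi k x _)
    (φ := fun S z => knnRadius k x z S) (fun S => measurable_knnRadius_pi k x S)
    (fun S h z => by rw [← knnRadius_map, Finset.map_orderEmbOfFin_univ]) hΔ0
    (ae_knnRadius_mem_Icc hΔ0.le hΔ k _) ht

lemma expectedShrinkage_le (hΔ0 : 0 ≤ Δ) (hΔ : ∀ᵐ a ∂μ, dist x a ≤ Δ) (k s : ℕ) :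
    expectedShrinkage μ k x s ≤ Δ := by
  calc expectedShrinkage μ k x s ≤ ∫ _ : Fin s → Euc D, Δ ∂(Measure.pi fun _ => μ) :=
        integral_mono_ae (integrable_knnRadius hΔ0 hΔ k _) (integrable_const _)
          ((ae_knnRadius_mem_Icc hΔ0 hΔ k _).mono fun w hw => hw.2)
    _ = Δ := by simp

/-- The smaller sample is realised as the first `s` points of the larger one, and adding points can
only bring the neighbours closer. -/
lemma expectedShrinkage_anti (hΔ0 : 0 ≤ Δ) (hΔ : ∀ᵐ a ∂μ, dist x a ≤ Δ) {k s s' : ℕ}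
    (hks : k ≤ s) (hss : s ≤ s') :
    expectedShrinkage μ k x s' ≤ expectedShrinkage μ k x s := by
  set e := Fin.castLEOrderEmb hss
  have hmp := measurePreserving_precomp μ (g := e) e.injective
  have h1 : expectedShrinkage μ k x s = ∫ w : Fin s' → Euc D,
      knnRadius k x w (Finset.univ.map e.toEmbedding) ∂(Measure.pi fun _ => μ) := by
    rw [expectedShrinkage, ← hmp.map_eq, integral_map hmp.measurable.aemeasurable
      (measurable_knnRadius_pi k x _).aestronglyMeasurable]
    simp only [knnRadius_map]
  rw [h1]
  exact integral_mono (integrable_knnRadius hΔ0 hΔ k _) (integrable_knnRadius hΔ0 hΔ k _)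
    fun w => knnRadius_anti (Finset.subset_univ _) (by simpa using hks)

/-- Form `k` disjoint groups of `s / k` points. If every group meets the ball, then `k` points lie
in it; so a large radius forces some whole group to miss the ball. -/
lemma measureReal_lt_knnRadius_le {k s : ℕ} {t : ℝ} (ht : 0 ≤ t) :
    (Measure.pi fun _ : Fin s => μ).real {w | t < knnRadius k x w Finset.univ} ≤
      k * (1 - μ.real (Metric.closedBall x t)) ^ (s / k) := by
  classical
  have hkN : k * (s / k) ≤ s := Nat.mul_div_le s k
  set e : Fin k × Fin (s / k) → Fin s := fun q => Fin.castLE hkN (finProdFinEquiv q) with he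
  have heinj : Function.Injective e := (Fin.castLE_injective hkN).comp finProdFinEquiv.injective
  have hsub : {w : Fin s → Euc D | t < knnRadius k x w Finset.univ} ⊆
      ⋃ g : Fin k, (fun w u => w (e (g, u))) ⁻¹'
        (Set.univ.pi fun _ : Fin (s / k) => (Metric.closedBall x t)ᶜ) := by
    intro w hw
    by_contra hcon
    simp only [Set.mem_iUnion, Set.mem_preimage, Set.mem_univ_pi, Set.mem_compl_iff, not_exists,
      not_forall, not_not] at hcon
    choose u hu using hcon
    refine absurd (knnRadius_le_of_card ht ?_) (not_le.2 hw)
    calc k = (Finset.univ.image fun g => e (g, u g)).card := by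
          rw [Finset.card_image_of_injective, Finset.card_univ, Fintype.card_fin]
          intro g g' h
          exact (Prod.ext_iff.1 (heinj h)).1
      _ ≤ _ := by
          refine Finset.card_le_card fun i hi => ?_
          obtain ⟨g, -, rfl⟩ := Finset.mem_image.1 hi
          have := hu g
          rw [Metric.mem_closedBall, dist_comm] at this
          simpa using this
  have hg : ∀ g : Fin k, (Measure.pi fun _ : Fin s => μ).real ((fun w u => w (e (g, u))) ⁻¹'
        (Set.univ.pi fun _ : Fin (s / k) => (Metric.closedBall x t)ᶜ)) =
      (1 - μ.real (Metric.closedBall x t)) ^ (s / k) := by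
    intro g
    have hmp := measurePreserving_precomp μ (g := fun u => e (g, u)) fun u u' h =>
      (Prod.ext_iff.1 (heinj h)).2
    rw [← probReal_compl_eq_one_sub Metric.isClosed_closedBall.measurableSet, measureReal_def,
      hmp.measure_preimage (MeasurableSet.univ_pi fun _ =>
        Metric.isClosed_closedBall.measurableSet.compl).nullMeasurableSet, Measure.pi_pi,
      ENNReal.toReal_prod]
    simp [measureReal_def]
  refine (measureReal_mono hsub).trans ((measureReal_iUnion_fintype_le _).trans ?_)
  simp only [hg]
  simp

lemma exp_neg_le_rpow {y a : ℝ} (hy : 0 < y) (ha : 0 < a) : Real.exp (-y) ≤ (y / a) ^ (-a) := by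
  have h1 : y / a ≤ Real.exp (y / a) := by linarith [Real.add_one_le_exp (y / a)]
  calc Real.exp (-y) = Real.exp (y / a) ^ (-a) := by
        rw [← Real.exp_mul]; congr 1; field_simp
    _ ≤ (y / a) ^ (-a) := Real.rpow_le_rpow_of_nonpos (by positivity) h1 (by linarith)

/-- Layer-cake formula, split at τ = s^(-1/d): below τ the tail probability is bounded by 1, above τ
by a multiple of τ² t⁻², which integrates to a multiple of τ. -/
lemma expectedShrinkage_le_rpow {c d : ℝ} (hc : 0 < c) (hd : 0 < d) (hΔ0 : 0 ≤ Δ)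
    (hΔ : ∀ᵐ a ∂μ, dist x a ≤ Δ)
    (hball : ∀ t, 0 < t → t ≤ Δ → c * t ^ d ≤ μ.real (Metric.closedBall x t)) {k s : ℕ}
    (hk : 1 ≤ k) (hks : k ≤ s) :
    expectedShrinkage μ k x s ≤
      (1 + k * (c * d / (4 * k)) ^ (-(2 / d))) * (s : ℝ) ^ (-(1 / d)) := by
  have hk0 : (0 : ℝ) < k := by exact_mod_cast hk
  have hs0 : (0 : ℝ) < s := by exact_mod_cast hk.trans hks
  set R : (Fin s → Euc D) → ℝ := fun w => knnRadius k x w Finset.univ with hR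
  set ν : Measure (Fin s → Euc D) := Measure.pi fun _ => μ with hν
  set τ : ℝ := (s : ℝ) ^ (-(1 / d)) with hτ
  have hτ0 : 0 < τ := Real.rpow_pos_of_pos hs0 _
  set A : ℝ := k * (c * d / (4 * k)) ^ (-(2 / d)) with hA
  have hA0 : 0 ≤ A := by positivity
  have hN : (s : ℝ) / (2 * k) ≤ ((s / k : ℕ) : ℝ) := by
    have h1 : s < k * (s / k + 1) := Nat.lt_mul_div_succ s hk
    have h2 : 1 ≤ s / k := (Nat.one_le_div_iff hk).2 hks
    have h3 : s ≤ 2 * k * (s / k) := by nlinarith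
    rw [div_le_iff₀ (by positivity)]
    have : (s : ℝ) ≤ 2 * k * ((s / k : ℕ) : ℝ) := by exact_mod_cast h3
    linarith
  have htail : ∀ t, 0 < t → ν.real {w | t < R w} ≤ A * τ ^ 2 * t ^ (-2 : ℝ) := by
    intro t ht
    rcases le_or_gt t Δ with htΔ | htΔ
    · have hb := hball t ht htΔ
      have htd : 0 < t ^ d := Real.rpow_pos_of_pos ht d
      have hb1 : μ.real (Metric.closedBall x t) ≤ 1 := measureReal_le_one
      calc ν.real {w | t < R w} ≤ k * (1 - μ.real (Metric.closedBall x t)) ^ (s / k) :=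
            measureReal_lt_knnRadius_le ht.le
        _ ≤ k * Real.exp (-(s / (2 * k) * (c * t ^ d))) := by
            gcongr
            calc (1 - μ.real (Metric.closedBall x t)) ^ (s / k) ≤
                  Real.exp (-(c * t ^ d)) ^ (s / k) := by
                  refine pow_le_pow_left₀ (by linarith) ?_ _
                  linarith [Real.one_sub_le_exp_neg (c * t ^ d)]
              _ = Real.exp (-((s / k : ℕ) * (c * t ^ d))) := by
                  rw [← Real.exp_nat_mul]; congr 1; ring
              _ ≤ _ := by
                  rw [Real.exp_le_exp, neg_le_neg_iff]
                  gcongr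
        -- The power `2 / d` converts the exponential in `s * t ^ d` into `s ^ (-2 / d) * t ^ (-2)`,
        -- integrable at infinity.
        _ ≤ k * (s / (2 * k) * (c * t ^ d) / (2 / d)) ^ (-(2 / d)) := by
            gcongr
            exact exp_neg_le_rpow (by positivity) (by positivity)
        _ = A * τ ^ 2 * t ^ (-2 : ℝ) := by
            have h1 : s / (2 * k) * (c * t ^ d) / (2 / d) = c * d / (4 * k) * (s * t ^ d) := by
              field_simp; ring
            rw [h1, Real.mul_rpow (by positivity) (by positivity),
              Real.mul_rpow hs0.le htd.le, ← Real.rpow_mul ht.le, hA, hτ,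
              ← Real.rpow_natCast, ← Real.rpow_mul hs0.le]
            have h2 : d * -(2 / d) = -2 := by field_simp
            have h3 : -(1 / d) * ((2 : ℕ) : ℝ) = -(2 / d) := by push_cast; ring
            rw [h2, h3]
            ring
    · have hzero : ν {w | t < R w} = 0 := by
        rw [measure_eq_zero_iff_ae_notMem]
        exact (ae_knnRadius_mem_Icc hΔ0 hΔ k _).mono fun w hw hlt =>
          absurd hw.2 (not_le.2 (htΔ.trans hlt))
      rw [measureReal_def, hzero]
      simpa using by positivity
  have hRi : Integrable R ν := integrable_knnRadius hΔ0 hΔ k _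
  have hanti : Antitone fun t => ν.real {w | t < R w} := fun a b hab =>
    measureReal_mono fun w hw => lt_of_le_of_lt hab hw
  have hmeas : Measurable fun t => ν.real {w | t < R w} := hanti.measurable
  have hdom : IntegrableOn (fun t : ℝ => A * τ ^ 2 * t ^ (-2 : ℝ)) (Set.Ioi τ) :=
    (integrableOn_Ioi_rpow_of_lt (by norm_num) hτ0).const_mul _
  have hi2 : IntegrableOn (fun t => ν.real {w | t < R w}) (Set.Ioi τ) := by
    refine Integrable.mono' hdom hmeas.aestronglyMeasurable ?_
    refine (ae_restrict_iff' measurableSet_Ioi).2 (Filter.Eventually.of_forall fun t ht => ?_)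
    rw [Real.norm_eq_abs, abs_of_nonneg measureReal_nonneg]
    exact htail t (hτ0.trans ht)
  have hi1 : IntegrableOn (fun t => ν.real {w | t < R w}) (Set.Ioc 0 τ) :=
    Integrable.of_bound hmeas.aestronglyMeasurable 1 (Filter.Eventually.of_forall fun t => by
      rw [Real.norm_eq_abs, abs_of_nonneg measureReal_nonneg]; exact measureReal_le_one)
  have hsplit : ∫ w, R w ∂ν = (∫ t in Set.Ioc 0 τ, ν.real {w | t < R w}) +
      ∫ t in Set.Ioi τ, ν.real {w | t < R w} := by
    rw [hRi.integral_eq_integral_meas_lt (Filter.Eventually.of_forall fun w => knnRadius_nonneg ..),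
      ← Set.Ioc_union_Ioi_eq_Ioi hτ0.le, setIntegral_union (Set.Ioc_disjoint_Ioi le_rfl)
      measurableSet_Ioi hi1 hi2]
  have hI1 : ∫ t in Set.Ioc 0 τ, ν.real {w | t < R w} ≤ τ := by
    calc _ ≤ ∫ _ in Set.Ioc 0 τ, (1 : ℝ) := setIntegral_mono_on hi1
          (integrableOn_const (by simp)) measurableSet_Ioc fun t _ => measureReal_le_one
      _ = τ := by simp [hτ0.le]
  have hI2 : ∫ t in Set.Ioi τ, ν.real {w | t < R w} ≤ A * τ := by
    calc _ ≤ ∫ t in Set.Ioi τ, A * τ ^ 2 * t ^ (-2 : ℝ) := setIntegral_mono_on hi2 hdom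
          measurableSet_Ioi fun t ht => htail t (hτ0.trans ht)
      _ = A * τ := by
          rw [integral_const_mul, integral_Ioi_rpow_of_lt (by norm_num) hτ0]
          norm_num
          rw [Real.rpow_neg_one]
          field_simp
  calc expectedShrinkage μ k x s = ∫ w, R w ∂ν := rfl
    _ ≤ τ + A * τ := by rw [hsplit]; exact add_le_add hI1 hI2
    _ = _ := by ring

/-- Homogeneity treats radii below `r`; from `r` to `Δ` the mass `q` alone suffices. Replacing `C`
by `max C 1` keeps the constant positive. -/
lemma mul_rpow_le_measureReal_closedBall {C d r q : ℝ} (hd : 0 < d) (hr : 0 < r) (hq : 0 < q)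
    (hΔ0 : 0 < Δ) (hom : IsHomogeneousOn μ C d x r)
    (hmass : ENNReal.ofReal q ≤ μ (Metric.ball x r)) {t : ℝ} (ht : 0 < t) (htΔ : t ≤ Δ) :
    min (q / (max C 1 * r ^ d)) (q / Δ ^ d) * t ^ d ≤ μ.real (Metric.closedBall x t) := by
  have htd : 0 < t ^ d := Real.rpow_pos_of_pos ht d
  have hrd : 0 < r ^ d := Real.rpow_pos_of_pos hr d
  have hΔd : 0 < Δ ^ d := Real.rpow_pos_of_pos hΔ0 d
  have hC : 0 < max C 1 := lt_max_of_lt_right one_pos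
  have hmass' : q ≤ μ.real (Metric.ball x r) :=
    (ENNReal.ofReal_le_iff_le_toReal (measure_ne_top _ _)).1 hmass
  rcases lt_or_ge t r with htr | htr
  · have h := hom (t / r) (by positivity) ((div_lt_one hr).2 htr)
    rw [div_mul_cancel₀ _ hr.ne'] at h
    have h1 : q ≤ max C 1 * (t / r) ^ (-d) * μ.real (Metric.closedBall x t) := by
      have h2 : ENNReal.ofReal q ≤ ENNReal.ofReal
          (max C 1 * (t / r) ^ (-d) * μ.real (Metric.closedBall x t)) := by
        refine (hmass.trans h).trans ?_
        rw [ENNReal.ofReal_mul (p := max C 1 * (t / r) ^ (-d)) (by positivity), ofReal_measureReal]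
        gcongr
        · exact le_max_left _ _
        · exact Metric.ball_subset_closedBall
      exact (ENNReal.ofReal_le_ofReal_iff (by positivity)).1 h2
    calc _ ≤ q / (max C 1 * r ^ d) * t ^ d := by gcongr; exact min_le_left _ _
      _ ≤ (max C 1 * (t / r) ^ (-d) * μ.real (Metric.closedBall x t)) /
            (max C 1 * r ^ d) * t ^ d := by gcongr
      _ = μ.real (Metric.closedBall x t) := by
          rw [Real.rpow_neg (by positivity), Real.div_rpow ht.le hr.le]
          field_simp
  · calc _ ≤ q / Δ ^ d * t ^ d := by gcongr; exact min_le_right _ _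
      _ ≤ q / Δ ^ d * Δ ^ d := by gcongr
      _ = q := by field_simp
      _ ≤ μ.real (Metric.ball x r) := hmass'
      _ ≤ _ := measureReal_mono ((Metric.ball_subset_ball htr).trans Metric.ball_subset_closedBall)

end Shrinkage

end

noncomputable section

/-! ### The selected and the oracle sizes. -/

section Selection

lemma log_two_le_log {p n : ℕ} {δ : ℝ} (hp : 1 ≤ p) (hn : 1 ≤ n) (hδ : 0 < δ) (hδ1 : δ ≤ 1) :
    Real.log 2 ≤ Real.log (2 * p * n / δ) := by
  have hp' : (1 : ℝ) ≤ p := by exact_mod_cast hp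
  have hn' : (1 : ℝ) ≤ n := by exact_mod_cast hn
  refine Real.log_le_log two_pos ?_
  rw [le_div_iff₀ hδ]
  nlinarith

lemma threshold_eq_mul_sqrt {Δ δ : ℝ} {p n s : ℕ} :
    threshold Δ p n δ s =
      Δ * √(2 * s / (n / (p * Real.log (2 * p * n / δ)))) := by
  rw [threshold]
  congr 2
  rw [div_div_eq_mul_div]
  ring

lemma threshold_mono {Δ δ : ℝ} {p n s t : ℕ} (hΔ : 0 ≤ Δ)
    (hL : 0 ≤ Real.log (2 * p * n / δ)) (hst : s ≤ t) :
    threshold Δ p n δ s ≤ threshold Δ p n δ t := by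
  rw [threshold, threshold]
  gcongr

lemma threshold_nonneg {Δ δ : ℝ} {p n s : ℕ} (hΔ : 0 ≤ Δ) : 0 ≤ threshold Δ p n δ s :=
  mul_nonneg hΔ (Real.sqrt_nonneg _)

lemma threshold_le_mul {Δ δ : ℝ} {p n s t : ℕ} {c : ℝ} (hΔ : 0 ≤ Δ)
    (hL : 0 ≤ Real.log (2 * p * n / δ)) (hc : 0 ≤ c) (hst : (s : ℝ) ≤ c ^ 2 * t) :
    threshold Δ p n δ s ≤ c * threshold Δ p n δ t := by
  rw [threshold, threshold, mul_left_comm, ← Real.sqrt_sq hc,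
    ← Real.sqrt_mul (sq_nonneg c)]
  refine mul_le_mul_of_nonneg_left (Real.sqrt_le_sqrt ?_) hΔ
  rw [← mul_div_assoc]
  refine div_le_div_of_nonneg_right ?_ (Nat.cast_nonneg n)
  calc 2 * Real.log (2 * p * n / δ) * p * s ≤
        2 * Real.log (2 * p * n / δ) * p * (c ^ 2 * t) := by gcongr
    _ = _ := by ring

/-- Since 2 log 2 > 1, the size `n` always qualifies for the oracle, so the infimum defining
`oracleSize` is never over the empty set. -/
lemma le_threshold_self {Δ δ : ℝ} {p n : ℕ} (hΔ : 0 ≤ Δ) (hp : 1 ≤ p) (hn : 1 ≤ n) (hδ : 0 < δ)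
    (hδ1 : δ ≤ 1) : Δ ≤ threshold Δ p n δ n := by
  have hn0 : (n : ℝ) ≠ 0 := by exact_mod_cast (show n ≠ 0 by omega)
  have hp' : (1 : ℝ) ≤ p := by exact_mod_cast hp
  have hL := log_two_le_log hp hn hδ hδ1
  have hl2 := Real.log_two_gt_d9
  rw [threshold, mul_div_cancel_right₀ _ hn0]
  refine le_mul_of_one_le_right hΔ (Real.one_le_sqrt.2 ?_)
  nlinarith

variable {D : ℕ} {μ : Measure (Euc D)} [IsProbabilityMeasure μ] {x : Euc D} {Δ δ : ℝ}
  {k p n : ℕ}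

lemma oracleSize_spec (hΔ0 : 0 ≤ Δ) (hΔ : ∀ᵐ a ∂μ, dist x a ≤ Δ) (hk : 1 ≤ k) (hkn : k ≤ n)
    (hp : 1 ≤ p) (hδ : 0 < δ) (hδ1 : δ ≤ 1) :
    k ≤ oracleSize μ k p n Δ δ x ∧ oracleSize μ k p n Δ δ x ≤ n ∧
      expectedShrinkage μ k x (oracleSize μ k p n Δ δ x) ≤
        threshold Δ p n δ (oracleSize μ k p n Δ δ x) :=
  Nat.sInf_mem (s := {s : ℕ | k ≤ s ∧ s ≤ n ∧ expectedShrinkage μ k x s ≤ threshold Δ p n δ s})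
    ⟨n, hkn, le_rfl, (expectedShrinkage_le hΔ0 hΔ k n).trans
      (le_threshold_self hΔ0 hp (hk.trans hkn) hδ hδ1)⟩

/-- When the U-statistics are accurate, the selected size balances shrinkage and threshold up to
constants and does not exceed a multiple of the oracle size. -/
lemma adaptiveSize_spec (hΔ0 : 0 ≤ Δ) (hΔ : ∀ᵐ a ∂μ, dist x a ≤ Δ) (hk : 1 ≤ k) (hkn : k ≤ n)
    (hp : 1 ≤ p) (hδ : 0 < δ) (hδ1 : δ ≤ 1) {X : Fin n → Euc D}
    (hX : ∀ s ∈ Finset.Icc k n,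
      |shrinkageEstimate k x X s - expectedShrinkage μ k x s| ≤ threshold Δ p n δ s) :
    adaptiveSize k p Δ δ x X ∈ Finset.Icc k n ∧
      expectedShrinkage μ k x (adaptiveSize k p Δ δ x X) ≤
        3 * threshold Δ p n δ (adaptiveSize k p Δ δ x X) ∧
      threshold Δ p n δ (adaptiveSize k p Δ δ x X) ≤
        4 * threshold Δ p n δ (oracleSize μ k p n Δ δ x) := by
  classical
  obtain ⟨ho1, ho2, ho3⟩ := oracleSize_spec hΔ0 hΔ hk hkn hp hδ hδ1
  have hL : 0 ≤ Real.log (2 * p * n / δ) :=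
    (Real.log_nonneg one_le_two).trans (log_two_le_log hp (hk.trans hkn) hδ hδ1)
  set o := oracleSize μ k p n Δ δ x
  -- At a size s ≥ o, H(s) ≤ ε_k(s) + G(s) ≤ ε_k(o) + G(s) ≤ 2 G(s), so no crossing occurs there.
  have hs1 : selectedSize k p Δ δ x X ≤ o := by
    rw [selectedSize]
    refine max_le ho1 (Finset.sup_le fun s hs => ?_)
    rw [Finset.mem_filter] at hs
    by_contra! hlt
    have hos : o ≤ s := by omega
    have h1 := (abs_le.1 (hX s hs.1)).2
    have h2 := expectedShrinkage_anti hΔ0 hΔ ho1 hos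
    have h3 := threshold_mono hΔ0 hL hos
    linarith [hs.2]
  have hks : k ≤ selectedSize k p Δ δ x X := le_max_left _ _
  have hsa : selectedSize k p Δ δ x X ≤ adaptiveSize k p Δ δ x X := by
    rw [adaptiveSize]; omega
  have hmem : adaptiveSize k p Δ δ x X ∈ Finset.Icc k n :=
    Finset.mem_Icc.2 ⟨hks.trans hsa, min_le_left _ _⟩
  -- From 9 o + 1 ≤ 10 o; the factor 4 on the threshold then follows from 10 ≤ 4².
  have hao : adaptiveSize k p Δ δ x X ≤ 10 * o := by
    rw [adaptiveSize]; omega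
  refine ⟨hmem, ?_, ?_⟩
  -- The size used is at least `selectedSize`, hence beyond the last crossing, so H ≤ 2 G there; one
  -- more G passes from H to ε_k.
  · have h1 : ¬ 2 * threshold Δ p n δ (adaptiveSize k p Δ δ x X) <
        shrinkageEstimate k x X (adaptiveSize k p Δ δ x X) := by
      intro hlt
      have h2 := Finset.le_sup (f := fun s => s + 1) (Finset.mem_filter (p := fun s =>
        2 * threshold Δ p n δ s < shrinkageEstimate k x X s).2 ⟨hmem, hlt⟩)
      have h3 : adaptiveSize k p Δ δ x X + 1 ≤ selectedSize k p Δ δ x X :=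
        h2.trans (le_max_right _ _)
      omega
    have h4 := (abs_le.1 (hX _ hmem)).1
    linarith
  · refine threshold_le_mul hΔ0 hL (by norm_num) ?_
    have : (adaptiveSize k p Δ δ x X : ℝ) ≤ 10 * o := by exact_mod_cast hao
    have : (0 : ℝ) ≤ o := Nat.cast_nonneg _
    linarith

/-- The oracle threshold is of the minimax order when the shrinkage is of order `s ^ (-1 / d)`. -/
lemma threshold_oracleSize_le {c d : ℝ} (hc : 0 < c) (hd : 0 < d) (hΔ0 : 0 < Δ)
    (hΔ : ∀ᵐ a ∂μ, dist x a ≤ Δ) (hk : 1 ≤ k) (hkn : k ≤ n) (hp : 1 ≤ p) (hδ : 0 < δ)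
    (hδ1 : δ ≤ 1) (hε : ∀ s, k ≤ s → expectedShrinkage μ k x s ≤ c * (s : ℝ) ^ (-(1 / d)))
    (hρ : p * Real.log (2 * p * n / δ) ≤ n) :
    threshold Δ p n δ (oracleSize μ k p n Δ δ x) ≤
      (Δ * √(2 * k) + 2 * (c ^ (d / (d + 2)) * (Δ * √2) ^ (2 / (d + 2)))) *
        (n / (p * Real.log (2 * p * n / δ))) ^ (-1 / (d + 2)) := by
  obtain ⟨ho1, ho2, ho3⟩ := oracleSize_spec hΔ0.le hΔ hk hkn hp hδ hδ1
  have hp0 : (0 : ℝ) < p := by exact_mod_cast hp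
  have hLpos : 0 < Real.log (2 * p * n / δ) :=
    (Real.log_pos one_lt_two).trans_le (log_two_le_log hp (hk.trans hkn) hδ hδ1)
  set o := oracleSize μ k p n Δ δ x with ho
  set ρ : ℝ := n / (p * Real.log (2 * p * n / δ)) with hρdef
  have hρ1 : 1 ≤ ρ := (one_le_div (by positivity)).2 hρ
  have hρ0 : 0 < ρ := by linarith
  have hrate : 0 < ρ ^ (-1 / (d + 2)) := Real.rpow_pos_of_pos hρ0 _
  rcases eq_or_lt_of_le ho1 with hko | hko
  · rw [← hko, threshold_eq_mul_sqrt]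
    have h1 : √(2 * k / ρ) ≤ √(2 * k) * ρ ^ (-1 / (d + 2)) := by
      rw [Real.sqrt_div' _ hρ0.le, div_eq_mul_inv]
      gcongr
      rw [Real.sqrt_eq_rpow, ← Real.rpow_neg hρ0.le]
      refine Real.rpow_le_rpow_of_exponent_le hρ1 ?_
      rw [neg_div, neg_le_neg_iff]
      gcongr; linarith
    calc Δ * √(2 * k / ρ) ≤ Δ * (√(2 * k) * ρ ^ (-1 / (d + 2))) := by gcongr
      _ = (Δ * √(2 * k) + 0) * ρ ^ (-1 / (d + 2)) := by ring
      _ ≤ _ := by gcongr; positivity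
  · obtain ⟨u, hu⟩ : ∃ u, o = u + 1 := ⟨o - 1, by omega⟩
    have hku : k ≤ u := by omega
    have hu0 : (0 : ℝ) < u := by exact_mod_cast hk.trans hku
    -- Minimality of the oracle size makes its predecessor `u` violate the balance, which bounds the
    -- threshold at `u` from above by the shrinkage.
    have hnot : threshold Δ p n δ u < expectedShrinkage μ k x u := by
      by_contra! hle
      have : o ≤ u := Nat.sInf_le ⟨hku, by omega, hle⟩
      omega
    have h1 : threshold Δ p n δ u ≤ c * (u : ℝ) ^ (-(1 / d)) := hnot.le.trans (hε u hku)
    have h2 : threshold Δ p n δ u = Δ * √2 * ((u : ℝ) ^ (1 / 2 : ℝ) * ρ ^ (-(1 / 2 : ℝ))) := by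
      rw [threshold_eq_mul_sqrt, ← hρdef, Real.sqrt_div' _ hρ0.le, Real.sqrt_mul two_pos.le,
        Real.rpow_neg hρ0.le, ← Real.sqrt_eq_rpow, ← Real.sqrt_eq_rpow]
      ring
    have hGpos : 0 < threshold Δ p n δ u := by rw [h2]; positivity
    have h3 : threshold Δ p n δ u ≤
        c ^ (d / (d + 2)) * (Δ * √2) ^ (2 / (d + 2)) * ρ ^ (-1 / (d + 2)) := by
      -- The weights d/(d+2) and 2/(d+2) are chosen so that the powers of `u` from u^(-1/d) and
      -- u^(1/2) cancel.
      calc threshold Δ p n δ u = threshold Δ p n δ u ^ (d / (d + 2)) *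
            threshold Δ p n δ u ^ (2 / (d + 2)) := by
            rw [← Real.rpow_add hGpos, ← add_div, div_self (by positivity), Real.rpow_one]
        _ ≤ (c * (u : ℝ) ^ (-(1 / d))) ^ (d / (d + 2)) *
            (Δ * √2 * ((u : ℝ) ^ (1 / 2 : ℝ) * ρ ^ (-(1 / 2 : ℝ)))) ^ (2 / (d + 2)) := by
            rw [← h2]; gcongr
        _ = _ := by
            have hW : 0 ≤ Δ * √2 := by positivity
            generalize Δ * √2 = W at hW
            rw [Real.mul_rpow hc.le (by positivity), Real.mul_rpow hW (by positivity),
              Real.mul_rpow (by positivity) (by positivity), ← Real.rpow_mul hu0.le,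
              ← Real.rpow_mul hu0.le, ← Real.rpow_mul hρ0.le]
            have e1 : -(1 / d) * (d / (d + 2)) = -(1 / (d + 2)) := by field_simp
            have e2 : 1 / 2 * (2 / (d + 2)) = 1 / (d + 2) := by field_simp
            have e3 : -(1 / 2) * (2 / (d + 2)) = -1 / (d + 2) := by field_simp
            rw [e1, e2, e3, Real.rpow_neg hu0.le]
            have : (u : ℝ) ^ (1 / (d + 2)) ≠ 0 := (Real.rpow_pos_of_pos hu0 _).ne'
            field_simp
    have h4 : threshold Δ p n δ o ≤ 2 * threshold Δ p n δ u := by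
      refine threshold_le_mul hΔ0.le hLpos.le two_pos.le ?_
      rw [hu]; push_cast
      have : (1 : ℝ) ≤ u := by exact_mod_cast hk.trans hku
      linarith
    calc threshold Δ p n δ o ≤
          2 * (c ^ (d / (d + 2)) * (Δ * √2) ^ (2 / (d + 2)) * ρ ^ (-1 / (d + 2))) :=
          h4.trans (by gcongr)
      _ = (0 + 2 * (c ^ (d / (d + 2)) * (Δ * √2) ^ (2 / (d + 2)))) * ρ ^ (-1 / (d + 2)) := by ring
      _ ≤ _ := by gcongr; positivity

end Selection

end

noncomputable section

/-! ### Identification of the joint law of data and draws. -/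

section Laws

variable {D n k : ℕ} {𝒴 Ω : Type*} [MeasurableSpace 𝒴] [MeasurableSpace Ω]
  {Pr : Measure Ω} {P : Measure (Euc D × 𝒴)}
  {Z : Fin n → Ω → Euc D × 𝒴} {B : ℕ → ℕ} {S : (s : ℕ) → Fin (B s) → Ω → Finset (Fin n)}

lemma SubsampledData.measurable_joint (h : SubsampledData k Pr P Z B S) {s : ℕ}
    (hs : s ∈ Finset.Icc k n) : Measurable fun ω => ((fun i => Z i ω), fun b => S s b ω) :=
  (measurable_pi_lambda _ h.measurable_data).prodMk
    (measurable_pi_lambda _ (h.measurable_draws s hs))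

variable [IsProbabilityMeasure Pr]

/-- The prescribed masses on the `s`-subsets already add up to one, so every other subset is null.
-/
lemma map_eq_uniformSubsets {s : ℕ} (hsn : s ≤ n) {T : Ω → Finset (Fin n)} (hT : Measurable T)
    (h : ∀ A ∈ (Finset.univ : Finset (Fin n)).powersetCard s,
      Pr {ω | T ω = A} = ((n.choose s : ℕ) : ENNReal)⁻¹) :
    Pr.map T = uniformSubsets n s := by
  classical
  have := isProbabilityMeasure_uniformSubsets hsn
  have := Measure.isProbabilityMeasure_map (μ := Pr) hT.aemeasurable
  have hsing : ∀ A, Pr.map T {A} = Pr {ω | T ω = A} := fun A => by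
    rw [Measure.map_apply hT (measurableSet_singleton A)]; rfl
  have hC : ((n.choose s : ℕ) : ENNReal) ≠ 0 := by exact_mod_cast (Nat.choose_pos hsn).ne'
  set K : Finset (Finset (Fin n)) := (Finset.univ : Finset (Fin n)).powersetCard s with hK
  have hKcard : K.card = n.choose s := by simp [hK]
  have hone : ∀ ν : Measure (Finset (Fin n)),
      (∀ A ∈ K, ν {A} = ((n.choose s : ℕ) : ENNReal)⁻¹) → ν (K : Set (Finset (Fin n))) = 1 := by
    intro ν hν
    rw [← sum_measure_singleton, Finset.sum_congr rfl hν, Finset.sum_const, hKcard, nsmul_eq_mul,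
      ENNReal.mul_inv_cancel hC (ENNReal.natCast_ne_top _)]
  have hunif : ∀ A ∈ K, uniformSubsets n s {A} = ((n.choose s : ℕ) : ENNReal)⁻¹ := by
    intro A hA
    rw [← lintegral_indicator_one (measurableSet_singleton A), lintegral_uniformSubsets,
      Finset.sum_eq_single_of_mem A hA]
    · simp
    · intro b _ hb
      simp [hb]
  have hmap : ∀ A ∈ K, Pr.map T {A} = ((n.choose s : ℕ) : ENNReal)⁻¹ := fun A hA => by
    rw [hsing]; exact h A hA
  refine Measure.ext_of_singleton fun A => ?_
  by_cases hA : A ∈ K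
  · rw [hmap A hA, hunif A hA]
  · have hzero : ∀ ν : Measure (Finset (Fin n)), IsProbabilityMeasure ν →
        ν (K : Set (Finset (Fin n))) = 1 → ν {A} = 0 := by
      intro ν hν h1
      have h0 : ν (K : Set (Finset (Fin n)))ᶜ = 0 :=
        (prob_compl_eq_zero_iff (Finset.measurableSet K)).2 h1
      exact measure_mono_null (by simpa using hA) h0
    rw [hzero _ inferInstance (hone _ hmap), hzero _ inferInstance (hone _ hunif)]

lemma SubsampledData.map_data (h : SubsampledData k Pr P Z B S) :
    Pr.map (fun ω i => Z i ω) = Measure.pi fun _ => P := by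
  rw [(iIndepFun_iff_map_fun_eq_pi_map fun i => (h.measurable_data i).aemeasurable).1 h.indep_data]
  simp only [h.law_data]

lemma SubsampledData.map_joint (h : SubsampledData k Pr P Z B S) {s : ℕ}
    (hs : s ∈ Finset.Icc k n) :
    Pr.map (fun ω => ((fun i => Z i ω), fun b => S s b ω)) = subsampleLaw P n s (B s) := by
  have h1 := (indepFun_iff_map_prod_eq_prod_map_map
    (measurable_pi_lambda _ h.measurable_data).aemeasurable
    (measurable_pi_lambda _ (h.measurable_draws s hs)).aemeasurable).1 (h.indep_draws_data s hs)
  rw [h1, h.map_data, subsampleLaw, (iIndepFun_iff_map_fun_eq_pi_map fun b =>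
    (h.measurable_draws s hs b).aemeasurable).1 (h.indep_draws s hs)]
  congr 2
  funext b
  exact map_eq_uniformSubsets (Finset.mem_Icc.1 hs).2 (h.measurable_draws s hs b)
    (h.uniform_draws s hs b)

lemma SubsampledData.map_covariates [IsProbabilityMeasure P] (h : SubsampledData k Pr P Z B S) :
    Pr.map (fun ω i => (Z i ω).1) = Measure.pi fun _ => P.map Prod.fst := by
  have := Measure.isProbabilityMeasure_map (μ := P) (measurable_fst.aemeasurable :
    AEMeasurable (Prod.fst : Euc D × 𝒴 → Euc D) P)
  have hmp : MeasurePreserving (fun (w : Fin n → Euc D × 𝒴) j => (w j).1)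
      (Measure.pi fun _ => P) (Measure.pi fun _ => P.map Prod.fst) :=
    measurePreserving_pi (fun _ => P) (fun _ => P.map Prod.fst)
      fun _ => ⟨measurable_fst, rfl⟩
  rw [← hmp.map_eq, ← h.map_data,
    Measure.map_map hmp.measurable (measurable_pi_lambda _ h.measurable_data)]
  rfl

end Laws

/-! ### Consequences of the moment model. -/

section Model

variable {D p n k : ℕ} {𝒴 : Type*} [MeasurableSpace 𝒴] {d C r q Δ lam Lm ψmax Cb : ℝ}
  {P : Measure (Euc D × 𝒴)} {𝒳 : Set (Euc D)} {x : Euc D} {Θ : Set (Euc p)}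
  {ψ : Euc D × 𝒴 → Euc p → Euc p} {m : Euc D → Euc p → Euc p} {θ₀ : Euc p}

lemma MomentModel.ae_dist_le (h : MomentModel d C r q Δ lam Lm ψmax Cb P 𝒳 x Θ ψ m θ₀) :
    ∀ᵐ z ∂P, dist x z.1 ≤ Δ :=
  h.covariate_mem.mono fun z hz => h.diam_le x h.target_mem z.1 hz

lemma MomentModel.ae_map_dist_le (h : MomentModel d C r q Δ lam Lm ψmax Cb P 𝒳 x Θ ψ m θ₀) :
    ∀ᵐ a ∂(P.map Prod.fst), dist x a ≤ Δ :=
  (ae_map_iff measurable_fst.aemeasurable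
    (measurableSet_le (measurable_const.dist measurable_id) measurable_const)).2 h.ae_dist_le

lemma MomentModel.measurable_score_apply (h : MomentModel d C r q Δ lam Lm ψmax Cb P 𝒳 x Θ ψ m θ₀)
    (θ : Euc p) : Measurable fun z => ψ z θ :=
  h.measurable_score.comp (measurable_id.prodMk measurable_const)

lemma MomentModel.norm_score_le (h : MomentModel d C r q Δ lam Lm ψmax Cb P 𝒳 x Θ ψ m θ₀)
    {θ : Euc p} (hθ : θ ∈ Θ) (z : Euc D × 𝒴) : ‖ψ z θ‖ ≤ √p * |ψmax| :=
  norm_le_sqrt_mul (abs_nonneg _) fun j => (h.score_bound z θ hθ j).trans (le_abs_self _)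

lemma MomentModel.mul_norm_sub_le (h : MomentModel d C r q Δ lam Lm ψmax Cb P 𝒳 x Θ ψ m θ₀)
    {θ : Euc p} (hθ : θ ∈ Θ) : lam * ‖θ - θ₀‖ ≤ ‖m x θ‖ := by
  obtain ⟨L, hL, hg⟩ := h.strongConvex
  exact strongConvexOn_mul_norm_le hL hg hθ h.param_mem h.moment_eq_zero

lemma MomentModel.norm_integral_sub_le
    (h : MomentModel d C r q Δ lam Lm ψmax Cb P 𝒳 x Θ ψ m θ₀) {θ : Euc p} (hθ : θ ∈ Θ) {s : ℕ}
    (hk : 1 ≤ k) (hks : k ≤ s) :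
    ‖∫ z, ψ z θ ∂(knnLaw P k x s) - m x θ‖ ≤
      |Lm| * expectedShrinkage (P.map Prod.fst) k x s := by
  have := h.isProb
  refine norm_integral_knnLaw_sub_le hk hks P x (h.measurable_score_apply θ) (h.norm_score_le hθ)
    h.ae_dist_le ?_
  filter_upwards [h.moment θ hθ, h.covariate_mem] with z hz hz𝒳
  rw [← hz, dist_comm, dist_eq_norm]
  exact h.lipschitz θ hθ z.1 hz𝒳 x h.target_mem

/-- The bias bound with `k = s = 1` bounds `m x θ` in terms of the score bound and `Δ`, and strong
convexity then confines Θ to a ball. This controls the error on the exceptional event in the mean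
square bound. -/
lemma MomentModel.norm_sub_le (h : MomentModel d C r q Δ lam Lm ψmax Cb P 𝒳 x Θ ψ m θ₀)
    (hΔ : 0 ≤ Δ) (hlam : 0 < lam) {θ : Euc p} (hθ : θ ∈ Θ) :
    ‖θ - θ₀‖ ≤ (|Lm| * Δ + √p * |ψmax|) / lam := by
  have := h.isProb
  have := Measure.isProbabilityMeasure_map (μ := P) (measurable_fst.aemeasurable :
    AEMeasurable (Prod.fst : Euc D × 𝒴 → Euc D) P)
  have := isProbabilityMeasure_knnLaw P le_rfl le_rfl x (s := 1)
  rw [le_div_iff₀ hlam, mul_comm]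
  refine (h.mul_norm_sub_le hθ).trans ?_
  have h1 := h.norm_integral_sub_le hθ le_rfl le_rfl (k := 1) (s := 1)
  have h2 := mul_le_mul_of_nonneg_left
    (expectedShrinkage_le hΔ h.ae_map_dist_le 1 1) (abs_nonneg Lm)
  have h3 : ‖∫ z, ψ z θ ∂(knnLaw P 1 x 1)‖ ≤ √p * |ψmax| := by
    refine (norm_integral_le_of_norm_le_const
      (Filter.Eventually.of_forall (h.norm_score_le hθ))).trans ?_
    simp
  have h4 := norm_sub_norm_le (m x θ) (∫ z, ψ z θ ∂(knnLaw P 1 x 1))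
  rw [norm_sub_rev] at h4
  linarith

/-- The score at the estimate controls the estimation error, up to the shrinkage of the kernel. -/
lemma MomentModel.mul_norm_sub_le_of_score_eq_zero
    (h : MomentModel d C r q Δ lam Lm ψmax Cb P 𝒳 x Θ ψ m θ₀) {θ : Euc p} (hθ : θ ∈ Θ) {s b : ℕ}
    (hk : 1 ≤ k) (hks : k ≤ s) {z : Fin n → Euc D × 𝒴} {S : Fin b → Finset (Fin n)} {c : ℝ}
    (hc : 0 ≤ c) (hscore : knnScore k x ψ z S θ = 0)
    (hdev : ∀ j, |knnDeviation P k x s (fun z => ψ z θ j) (z, S)| ≤ c) :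
    lam * ‖θ - θ₀‖ ≤ |Lm| * expectedShrinkage (P.map Prod.fst) k x s + √p * c := by
  have := h.isProb
  have := isProbabilityMeasure_knnLaw P hk hks x
  refine (h.mul_norm_sub_le hθ).trans ?_
  have h1 := h.norm_integral_sub_le hθ hk hks
  have hint : Integrable (fun z => ψ z θ) (knnLaw P k x s) :=
    Integrable.of_bound (h.measurable_score_apply θ).aestronglyMeasurable _
      (Filter.Eventually.of_forall (h.norm_score_le hθ))
  have h3 : ‖∫ z, ψ z θ ∂(knnLaw P k x s)‖ ≤ √p * c := by
    refine norm_le_sqrt_mul hc fun j => ?_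
    have h4 : (∫ z, ψ z θ ∂(knnLaw P k x s)) j = ∫ z, ψ z θ j ∂(knnLaw P k x s) :=
      ((EuclideanSpace.proj j : Euc p →L[ℝ] ℝ).integral_comp_comm hint).symm
    have h5 := hdev j
    have h6 : (∑ b, knnAverage k x (fun z => ψ z θ j) z (S b)) / b = 0 := by
      rw [← knnScore_apply, hscore]; rfl
    rw [knnDeviation, h6, zero_sub, abs_neg] at h5
    rw [h4]
    exact h5
  have h4 := norm_sub_norm_le (m x θ) (∫ z, ψ z θ ∂(knnLaw P k x s))
  rw [norm_sub_rev] at h4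
  linarith

end Model

end

noncomputable section

/-! ### The oracle inequality. -/

section Tail

/-- The constant of the uniform deviation inequality for the score. -/
def deviationConst (ψmax Cb : ℝ) : ℝ :=
  50 * (|ψmax| + 1) * (|Cb| + 1) + 20 * (|Cb| + 1) + 8

/-- The constant of the oracle inequality. -/
def oracleConst (Δ lam Lm ψmax Cb : ℝ) : ℝ :=
  (12 * |Lm| + 8 * deviationConst ψmax Cb / Δ) / lam

lemma deviationConst_pos (ψmax Cb : ℝ) : 0 < deviationConst ψmax Cb := by
  rw [deviationConst]; positivity

lemma failure_le {p n : ℕ} {δ : ℝ} (hp : 1 ≤ p) (hn : 1 ≤ n) (hδ : 0 < δ) (hδ1 : δ ≤ 1) :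
    n * (2 * (δ / (2 * p * n)) ^ 2 + p * (6 * (δ / (2 * p * n)) ^ 4)) ≤ δ := by
  have hp' : (1 : ℝ) ≤ p := by exact_mod_cast hp
  have hn' : (1 : ℝ) ≤ n := by exact_mod_cast hn
  set y := δ / (2 * p * n) with hy
  have hy0 : 0 < y := by positivity
  have hpn : 1 ≤ (p : ℝ) * n := by nlinarith
  have hδy : δ = 2 * (p * n) * y := by rw [hy]; field_simp
  have hy1 : y ≤ 1 / 2 := by
    rw [hy, div_le_iff₀ (by positivity)]; nlinarith
  have h2 : y ^ 2 ≤ y / 2 := by nlinarith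
  have h4 : y ^ 4 ≤ y / 8 := by
    calc y ^ 4 = y ^ 2 * y ^ 2 := by ring
      _ ≤ (y / 2) * (y / 2) := by gcongr
      _ = y ^ 2 / 4 := by ring
      _ ≤ (y / 2) / 4 := by gcongr
      _ = y / 8 := by ring
  calc n * (2 * y ^ 2 + p * (6 * y ^ 4)) ≤ n * (2 * (y / 2) + p * (6 * (y / 8))) := by gcongr
    _ = n * y + 3 / 4 * (p * n * y) := by ring
    _ ≤ p * n * y + 3 / 4 * (p * n * y) := by
        gcongr
        exact le_mul_of_one_le_left (by positivity) hp'
    _ ≤ δ := by rw [hδy]; nlinarith [mul_pos (by linarith : (0:ℝ) < p * n) hy0]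

lemma exp_neg_mul_log {p n : ℕ} {δ : ℝ} (hp : 1 ≤ p) (hn : 1 ≤ n) (hδ : 0 < δ) (j : ℕ) :
    Real.exp (-(j * Real.log (2 * p * n / δ))) = (δ / (2 * p * n)) ^ j := by
  have hp' : (0 : ℝ) < p := by exact_mod_cast hp
  have hn' : (0 : ℝ) < n := by exact_mod_cast hn
  rw [← mul_neg, ← Real.log_inv, inv_div, Real.exp_nat_mul, Real.exp_log (by positivity)]

/-- Rounding `n / s` down loses at most a factor 2. -/
lemma one_le_two_mul_div_mul {n s : ℕ} (hs : 1 ≤ s) (hsn : s ≤ n) :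
    (n : ℝ) ≤ 2 * ((n / s : ℕ) : ℝ) * s := by
  have h1 : n < s * (n / s + 1) := Nat.lt_mul_div_succ n hs
  have h2 : 1 ≤ n / s := (Nat.one_le_div_iff hs).2 hsn
  have h3 : n ≤ 2 * (n / s) * s := by nlinarith
  exact_mod_cast h3

variable {D p n k : ℕ} {𝒴 Ω : Type*} [MeasurableSpace 𝒴] [MeasurableSpace Ω]
  {Pr : Measure Ω} [IsProbabilityMeasure Pr] {d C r q Δ lam Lm ψmax Cb δ : ℝ}
  {P : Measure (Euc D × 𝒴)} {𝒳 : Set (Euc D)} {x : Euc D} {Θ : Set (Euc p)}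
  {ψ : Euc D × 𝒴 → Euc p → Euc p} {m : Euc D → Euc p → Euc p} {θ₀ : Euc p}
  {Z : Fin n → Ω → Euc D × 𝒴} {B : ℕ → ℕ} {S : (s : ℕ) → Fin (B s) → Ω → Finset (Fin n)}
  {θhat : Ω → Euc p}

lemma measure_shrinkage_deviation_le (hΔ : 0 < Δ) (hk : 1 ≤ k) (hp : 1 ≤ p) (hδ : 0 < δ)
    (hδ1 : δ ≤ 1) (hM : MomentModel d C r q Δ lam Lm ψmax Cb P 𝒳 x Θ ψ m θ₀)
    (hS : SubsampledData k Pr P Z B S) {s : ℕ} (hs : s ∈ Finset.Icc k n) :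
    Pr {ω | threshold Δ p n δ s < |shrinkageEstimate k x (fun i => (Z i ω).1) s -
      expectedShrinkage (P.map Prod.fst) k x s|} ≤
        ENNReal.ofReal (2 * (δ / (2 * p * n)) ^ 2) := by
  have := hM.isProb
  have := Measure.isProbabilityMeasure_map (μ := P) (measurable_fst.aemeasurable :
    AEMeasurable (Prod.fst : Euc D × 𝒴 → Euc D) P)
  obtain ⟨hks, hsn⟩ := Finset.mem_Icc.1 hs
  have hs1 := hk.trans hks
  have hn1 := hs1.trans hsn
  have hp' : (1 : ℝ) ≤ p := by exact_mod_cast hp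
  have hn' : (0 : ℝ) < n := by exact_mod_cast hn1
  have hL : 0 ≤ Real.log (2 * p * n / δ) :=
    (Real.log_nonneg one_le_two).trans (log_two_le_log hp hn1 hδ hδ1)
  have hmeas : Measurable fun ω i => (Z i ω).1 :=
    measurable_pi_lambda _ fun i => (hS.measurable_data i).fst
  have h1 := shrinkageEstimate_tail (μ := P.map Prod.fst) (k := k) hsn hΔ hM.ae_map_dist_le
    (threshold_nonneg (Δ := Δ) (δ := δ) (p := p) (n := n) (s := s) hΔ.le)
  rw [← hS.map_covariates] at h1
  refine (measure_mono ?_).trans (((Measure.le_map_apply hmeas.aemeasurable _).trans h1).trans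
    (ENNReal.ofReal_le_ofReal ?_))
  · intro ω hω
    rw [Set.mem_ofPred_eq] at hω
    exact hω.le
  · rw [← exp_neg_mul_log hp hn1 hδ]
    gcongr
    rw [threshold, mul_pow, Real.sq_sqrt (by positivity)]
    generalize Real.log (2 * p * n / δ) = L at hL
    have h2 := one_le_two_mul_div_mul hs1 hsn
    -- At deviation G(s), Hoeffding's exponent is at least twice the logarithm, since `p ≥ 1` and
    -- the rounded block count satisfies 2⌊n/s⌋s ≥ n.
    have h3 : 2 * ((n / s : ℕ) : ℝ) * (Δ ^ 2 * (2 * L * p * s / n)) / Δ ^ 2 =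
        2 * L * p * ((2 * ((n / s : ℕ) : ℝ) * s) / n) := by
      field_simp
    rw [h3]
    have h4 : 1 ≤ (2 * ((n / s : ℕ) : ℝ) * s) / n := (one_le_div hn').2 h2
    calc ((2 : ℕ) : ℝ) * L = 2 * L * 1 * 1 := by push_cast; ring
      _ ≤ _ := by gcongr

lemma measure_score_deviation_le (hk : 1 ≤ k) (hp : 1 ≤ p) (hδ : 0 < δ)
    (hδ1 : δ ≤ 1) (hM : MomentModel d C r q Δ lam Lm ψmax Cb P 𝒳 x Θ ψ m θ₀)
    (hS : SubsampledData k Pr P Z B S) {s : ℕ} (hs : s ∈ Finset.Icc k n) (j : Fin p) :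
    Pr {ω | ∃ θ ∈ Θ, deviationConst ψmax Cb *
      √(4 * Real.log (2 * p * n / δ) / ((n / s : ℕ) : ℝ)) <
        |knnDeviation P k x s (fun z => ψ z θ j) ((fun i => Z i ω), fun b => S s b ω)|} ≤
        ENNReal.ofReal (6 * (δ / (2 * p * n)) ^ 4) := by
  have := hM.isProb
  obtain ⟨hks, hsn⟩ := Finset.mem_Icc.1 hs
  have hs1 := hk.trans hks
  have hn1 := hs1.trans hsn
  have hL := log_two_le_log hp hn1 hδ hδ1
  have hl2 := Real.log_two_gt_d9
  have hB : n / s ≤ B s := by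
    have h1 : ((n / s : ℕ) : ℝ) ≤ B s := Nat.cast_div_le.trans (hS.draws_ge s hs)
    exact_mod_cast h1
  -- The level 4 log(2pn/δ) exceeds 1, as chaining requires, and leaves room for the union bound
  -- over coordinates and sizes.
  have h1 := knnDeviation_uniform_tail (P := P) (k := k) (x := x) (n := n) (B := B s) (s := s)
    (m := n / s) hk hks (Nat.div_mul_le_self n s) hsn hB ((Nat.one_le_div_iff hs1).2 hsn)
    (F := (fun θ z => ψ z θ j) '' Θ) (M := |ψmax| + 1) (C := |Cb|)
    (ℓ := 4 * Real.log (2 * p * n / δ)) (by positivity) (abs_nonneg _)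
    (by
      rintro _ ⟨θ, -, rfl⟩
      exact (EuclideanSpace.proj j : Euc p →L[ℝ] ℝ).measurable.comp (hM.measurable_score_apply θ))
    (by
      rintro _ ⟨θ, hθ, rfl⟩ z
      linarith [hM.score_bound z θ hθ j, le_abs_self ψmax])
    (fun Q hQ ε hε hε1 => (hM.bracketing j Q hQ ε hε hε1).trans (ENNReal.ofReal_le_ofReal
      (Real.exp_le_exp.2 (by gcongr; exact le_abs_self Cb))))
    (by linarith)
  rw [← hS.map_joint hs] at h1
  have h2 := exp_neg_mul_log hp hn1 hδ 4
  push_cast at h2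
  rw [h2] at h1
  -- The event quantifies over all of Θ and need not be measurable; this inequality holds for outer
  -- measure.
  refine (measure_mono ?_).trans ((Measure.le_map_apply
    (hS.measurable_joint hs).aemeasurable _).trans h1)
  rintro ω ⟨θ, hθ, h⟩
  exact ⟨_, ⟨θ, hθ, rfl⟩, h⟩

/-- The adaptive estimator attains the oracle threshold up to a constant. -/
theorem measure_adaptive_error_le (hΔ : 0 < Δ) (hlam : 0 < lam) (hk : 1 ≤ k) (hkn : k ≤ n)
    (hp : 1 ≤ p) (hδ : 0 < δ)
    (hδ1 : δ ≤ 1) (hM : MomentModel d C r q Δ lam Lm ψmax Cb P 𝒳 x Θ ψ m θ₀)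
    (hS : SubsampledData k Pr P Z B S)
    (hθ : IsAdaptiveKnnEstimator k Δ δ Pr x Θ ψ Z B S θhat) :
    Pr {ω | oracleConst Δ lam Lm ψmax Cb *
      threshold Δ p n δ (oracleSize (P.map Prod.fst) k p n Δ δ x) < ‖θhat ω - θ₀‖} ≤
        ENNReal.ofReal δ := by
  have := hM.isProb
  have := Measure.isProbabilityMeasure_map (μ := P) (measurable_fst.aemeasurable :
    AEMeasurable (Prod.fst : Euc D × 𝒴 → Euc D) P)
  have hn1 := hk.trans hkn
  have hn' : (0 : ℝ) < n := by exact_mod_cast hn1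
  have hL : 0 ≤ Real.log (2 * p * n / δ) :=
    (Real.log_nonneg one_le_two).trans (log_two_le_log hp hn1 hδ hδ1)
  have hKc := deviationConst_pos ψmax Cb
  set bad₁ : ℕ → Set Ω := fun s => {ω | threshold Δ p n δ s <
    |shrinkageEstimate k x (fun i => (Z i ω).1) s -
      expectedShrinkage (P.map Prod.fst) k x s|} with hbad₁
  set bad₂ : ℕ → Fin p → Set Ω := fun s j => {ω | ∃ θ ∈ Θ, deviationConst ψmax Cb *
      √(4 * Real.log (2 * p * n / δ) / ((n / s : ℕ) : ℝ)) <
        |knnDeviation P k x s (fun z => ψ z θ j) ((fun i => Z i ω), fun b => S s b ω)|} with hbad₂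
  -- All sizes are controlled at once, since the joint law of data and draws is known for
  -- deterministic sizes only.
  have hunion : Pr (⋃ s ∈ Finset.Icc k n, bad₁ s ∪ ⋃ j, bad₂ s j) ≤ ENNReal.ofReal δ := by
    have h1 : ∀ s ∈ Finset.Icc k n, Pr (bad₁ s ∪ ⋃ j, bad₂ s j) ≤
        ENNReal.ofReal (2 * (δ / (2 * p * n)) ^ 2 + p * (6 * (δ / (2 * p * n)) ^ 4)) := by
      intro s hs
      rw [ENNReal.ofReal_add (by positivity) (by positivity),
        ENNReal.ofReal_mul (Nat.cast_nonneg p), ENNReal.ofReal_natCast]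
      refine (measure_union_le _ _).trans (add_le_add
        (measure_shrinkage_deviation_le hΔ hk hp hδ hδ1 hM hS hs) ?_)
      refine (measure_iUnion_fintype_le _ _).trans ?_
      refine (Finset.sum_le_card_nsmul _ _ _ fun j _ =>
        measure_score_deviation_le hk hp hδ hδ1 hM hS hs j).trans ?_
      simp
    refine (measure_biUnion_finset_le _ _).trans ((Finset.sum_le_card_nsmul _ _ _ h1).trans ?_)
    rw [nsmul_eq_mul, ← ENNReal.ofReal_natCast, ← ENNReal.ofReal_mul (Nat.cast_nonneg _)]
    refine ENNReal.ofReal_le_ofReal (le_trans ?_ (failure_le hp hn1 hδ hδ1))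
    gcongr
    rw [Nat.card_Icc]; omega
  refine (measure_mono_ae ?_).trans hunion
  filter_upwards [hθ.mem, hθ.solves] with ω hmem hsol hω
  by_contra hgood
  have hg : ∀ s ∈ Finset.Icc k n, ω ∉ bad₁ s ∧ ∀ j, ω ∉ bad₂ s j := by
    intro s hs
    constructor
    · intro h
      exact hgood (Set.mem_biUnion hs (Or.inl h))
    · intro j h
      exact hgood (Set.mem_biUnion hs (Or.inr (Set.mem_iUnion.2 ⟨j, h⟩)))
  obtain ⟨ha, ha1, ha2⟩ := adaptiveSize_spec hΔ.le hM.ae_map_dist_le hk hkn hp hδ hδ1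
    (X := fun i => (Z i ω).1) fun s hs => not_lt.1 (hg s hs).1
  set a := adaptiveSize k p Δ δ x fun i => (Z i ω).1
  obtain ⟨hka, han⟩ := Finset.mem_Icc.1 ha
  have ha0 : (0 : ℝ) < a := by exact_mod_cast hk.trans hka
  have hdev : ∀ j, |knnDeviation P k x a (fun z => ψ z (θhat ω) j)
      ((fun i => Z i ω), fun b => S a b ω)| ≤ deviationConst ψmax Cb *
      √(4 * Real.log (2 * p * n / δ) / ((n / a : ℕ) : ℝ)) := by
    intro j
    by_contra! h
    exact (hg a ha).2 j ⟨θhat ω, hmem, h⟩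
  have h1 := hM.mul_norm_sub_le_of_score_eq_zero hmem hk hka (by positivity) hsol hdev
  -- The factor √p and the logarithm are exactly those inside G; the 2 absorbs the rounding and the
  -- level 4.
  have h2 : √p * (deviationConst ψmax Cb *
      √(4 * Real.log (2 * p * n / δ) / ((n / a : ℕ) : ℝ))) ≤
      deviationConst ψmax Cb * (2 * (threshold Δ p n δ a / Δ)) := by
    rw [mul_left_comm, threshold, mul_div_cancel_left₀ _ hΔ.ne', ← Real.sqrt_mul (Nat.cast_nonneg p)]
    gcongr
    generalize Real.log (2 * p * n / δ) = L at hL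
    have hna : (0 : ℝ) < ((n / a : ℕ) : ℝ) := by
      exact_mod_cast (Nat.one_le_div_iff (hk.trans hka)).2 han
    have h3 := one_le_two_mul_div_mul (hk.trans hka) han
    rw [show (2 : ℝ) = √(2 ^ 2) by rw [Real.sqrt_sq two_pos.le], ← Real.sqrt_mul (by positivity),
      Real.sqrt_sq two_pos.le]
    refine Real.sqrt_le_sqrt ?_
    rw [mul_div_assoc', mul_div_assoc', div_le_div_iff₀ hna hn']
    have hpL : 0 ≤ (p : ℝ) * L := by positivity
    nlinarith
  have h4 : lam * ‖θhat ω - θ₀‖ ≤ (12 * |Lm| + 8 * deviationConst ψmax Cb / Δ) *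
      threshold Δ p n δ (oracleSize (P.map Prod.fst) k p n Δ δ x) := by
    have h5 : |Lm| * expectedShrinkage (P.map Prod.fst) k x a ≤
        |Lm| * (12 * threshold Δ p n δ (oracleSize (P.map Prod.fst) k p n Δ δ x)) :=
      mul_le_mul_of_nonneg_left (by linarith) (abs_nonneg _)
    have h6 : deviationConst ψmax Cb * (2 * (threshold Δ p n δ a / Δ)) ≤
        deviationConst ψmax Cb *
          (2 * (4 * threshold Δ p n δ (oracleSize (P.map Prod.fst) k p n Δ δ x) / Δ)) := by
      gcongr
    refine h1.trans ((add_le_add h5 (h2.trans h6)).trans (le_of_eq ?_))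
    ring
  refine absurd hω (not_lt.2 ?_)
  rw [oracleConst, div_mul_eq_mul_div, le_div_iff₀ hlam, mul_comm]
  exact h4

end Tail

end

noncomputable section

/-! ### Explicit rates and the mean square error. -/

section Rate

/-- The constant in the bound of the expected shrinkage by `s ^ (-1 / d)`. -/
def shrinkageConst (k : ℕ) (d C r q Δ : ℝ) : ℝ :=
  1 + k * (min (q / (max C 1 * r ^ d)) (q / Δ ^ d) * d / (4 * k)) ^ (-(2 / d))

/-- The constant in the bound of the oracle threshold. -/
def rateConst (k : ℕ) (d C r q Δ : ℝ) : ℝ :=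
  Δ * √(2 * k) + 2 * (shrinkageConst k d C r q Δ ^ (d / (d + 2)) * (Δ * √2) ^ (2 / (d + 2)))

lemma shrinkageConst_pos {k : ℕ} {d C r q Δ : ℝ} (hd : 0 < d) (hr : 0 < r) (hq : 0 < q)
    (hΔ : 0 < Δ) : 0 < shrinkageConst k d C r q Δ := by
  have hC : 0 < max C 1 := lt_max_of_lt_right one_pos
  have : 0 < min (q / (max C 1 * r ^ d)) (q / Δ ^ d) := lt_min (by positivity) (by positivity)
  rw [shrinkageConst]; positivity

lemma rateConst_nonneg {k : ℕ} {d C r q Δ : ℝ} (hd : 0 < d) (hr : 0 < r) (hq : 0 < q)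
    (hΔ : 0 < Δ) : 0 ≤ rateConst k d C r q Δ := by
  have := shrinkageConst_pos (k := k) (C := C) hd hr hq hΔ
  rw [rateConst]; positivity

lemma oracleConst_nonneg {Δ lam Lm ψmax Cb : ℝ} (hΔ : 0 < Δ) (hlam : 0 < lam) :
    0 ≤ oracleConst Δ lam Lm ψmax Cb := by
  have := deviationConst_pos ψmax Cb
  rw [oracleConst]; positivity

variable {D p n k : ℕ} {𝒴 Ω : Type*} [MeasurableSpace 𝒴] [MeasurableSpace Ω]
  {Pr : Measure Ω} [IsProbabilityMeasure Pr] {d C r q Δ lam Lm ψmax Cb δ : ℝ}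
  {P : Measure (Euc D × 𝒴)} {𝒳 : Set (Euc D)} {x : Euc D} {Θ : Set (Euc p)}
  {ψ : Euc D × 𝒴 → Euc p → Euc p} {m : Euc D → Euc p → Euc p} {θ₀ : Euc p}
  {Z : Fin n → Ω → Euc D × 𝒴} {B : ℕ → ℕ} {S : (s : ℕ) → Fin (B s) → Ω → Finset (Fin n)}
  {θhat : Ω → Euc p}

lemma MomentModel.threshold_oracleSize_le
    (hM : MomentModel d C r q Δ lam Lm ψmax Cb P 𝒳 x Θ ψ m θ₀)
    (hd : 0 < d) (hr : 0 < r) (hq : 0 < q) (hΔ : 0 < Δ) (hk : 1 ≤ k) (hkn : k ≤ n) (hp : 1 ≤ p)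
    (hδ : 0 < δ) (hδ1 : δ ≤ 1) (hρ : p * Real.log (2 * p * n / δ) ≤ n) :
    threshold Δ p n δ (oracleSize (P.map Prod.fst) k p n Δ δ x) ≤
      rateConst k d C r q Δ * (n / (p * Real.log (2 * p * n / δ))) ^ (-1 / (d + 2)) := by
  have := hM.isProb
  have := Measure.isProbabilityMeasure_map (μ := P) (measurable_fst.aemeasurable :
    AEMeasurable (Prod.fst : Euc D × 𝒴 → Euc D) P)
  have hC : 0 < max C 1 := lt_max_of_lt_right one_pos
  exact _root_.threshold_oracleSize_le (shrinkageConst_pos hd hr hq hΔ) hd hΔ hM.ae_map_dist_le hk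
    hkn hp hδ hδ1 (fun s hks => expectedShrinkage_le_rpow
      (lt_min (by positivity) (by positivity)) hd hΔ.le hM.ae_map_dist_le
      (fun t ht htΔ => mul_rpow_le_measureReal_closedBall hd hr hq hΔ hM.homogeneous hM.mass ht htΔ)
      hk hks) hρ

lemma one_sub_two_mul_le {f : Ω → Euc p} (hf : Measurable f) {a b : ℝ} (hδ : 0 ≤ δ)
    (hab : a ≤ b) (h : Pr {ω | a < ‖f ω - θ₀‖} ≤ ENNReal.ofReal δ) :
    1 - 2 * δ ≤ Pr.real {ω | ‖f ω - θ₀‖ ≤ b} := by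
  have hmeas : MeasurableSet {ω | a < ‖f ω - θ₀‖} :=
    measurableSet_lt measurable_const (hf.sub_const θ₀).norm
  have h1 : Pr.real {ω | a < ‖f ω - θ₀‖} ≤ δ := ENNReal.toReal_le_of_le_ofReal hδ h
  have h2 := probReal_compl_eq_one_sub (μ := Pr) hmeas
  have h3 : Pr.real {ω | a < ‖f ω - θ₀‖}ᶜ ≤ Pr.real {ω | ‖f ω - θ₀‖ ≤ b} :=
    measureReal_mono fun ω hω => by
      rw [Set.mem_compl_iff, Set.mem_ofPred_eq, not_lt] at hω
      exact hω.trans hab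
  linarith

lemma integral_sq_le_of_tail {f : Ω → ℝ} (hf : Measurable f) (hf0 : ∀ ω, 0 ≤ f ω) {a b : ℝ}
    (hb : ∀ᵐ ω ∂Pr, f ω ≤ b) (hδ : 0 ≤ δ)
    (h : Pr {ω | a < f ω} ≤ ENNReal.ofReal δ) :
    Integrable (fun ω => f ω ^ 2) Pr ∧ ∫ ω, f ω ^ 2 ∂Pr ≤ a ^ 2 + b ^ 2 * δ := by
  have hmeas : MeasurableSet {ω | a < f ω} := measurableSet_lt measurable_const hf
  have hint : Integrable (fun ω => f ω ^ 2) Pr :=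
    Integrable.of_bound (hf.pow_const 2).aestronglyMeasurable (b ^ 2) (hb.mono fun ω hω => by
      rw [Real.norm_eq_abs, abs_of_nonneg (sq_nonneg _)]
      exact pow_le_pow_left₀ (hf0 ω) hω 2)
  refine ⟨hint, ?_⟩
  have h1 : Pr.real {ω | a < f ω} ≤ δ := ENNReal.toReal_le_of_le_ofReal hδ h
  calc ∫ ω, f ω ^ 2 ∂Pr ≤ ∫ ω, (a ^ 2 + {ω | a < f ω}.indicator (fun _ => b ^ 2) ω) ∂Pr := by
        refine integral_mono_ae hint ((integrable_const _).add
          ((integrable_const _).indicator hmeas)) (hb.mono fun ω hω => ?_)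
        by_cases hlt : a < f ω
        · have h2 := pow_le_pow_left₀ (hf0 ω) hω 2
          have h3 : {ω | a < f ω}.indicator (fun _ => b ^ 2) ω = b ^ 2 :=
            Set.indicator_of_mem (s := {ω | a < f ω}) hlt _
          simp only [h3]
          nlinarith [sq_nonneg a]
        · have h2 := pow_le_pow_left₀ (hf0 ω) (not_lt.1 hlt) 2
          have h3 : {ω | a < f ω}.indicator (fun _ => b ^ 2) ω = 0 :=
            Set.indicator_of_notMem (s := {ω | a < f ω}) hlt _
          simp only [h3]
          linarith
    _ = a ^ 2 + b ^ 2 * Pr.real {ω | a < f ω} := by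
        rw [integral_add (integrable_const _) ((integrable_const _).indicator hmeas),
          integral_indicator_const _ hmeas]
        simp [mul_comm]
    _ ≤ _ := by gcongr

/-- The logarithmic factor for the confidence level `1 / n`. -/
lemma mul_log_le {p n : ℕ} (hp : 1 ≤ p) (hn : 2 ≤ n) :
    p * Real.log (2 * p * n / (1 / (n : ℝ))) ≤
      p * (Real.log (2 * p) / Real.log 2 + 2) * Real.log n := by
  have hp' : (1 : ℝ) ≤ p := by exact_mod_cast hp
  have hn' : (2 : ℝ) ≤ n := by exact_mod_cast hn
  have hlog : Real.log 2 ≤ Real.log n := Real.log_le_log two_pos hn'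
  have hl2 := Real.log_pos one_lt_two
  have hlp : 0 ≤ Real.log (2 * p) := Real.log_nonneg (by linarith)
  have h1 : 2 * p * n / (1 / (n : ℝ)) = 2 * p * (n : ℝ) ^ 2 := by field_simp
  rw [h1, Real.log_mul (by positivity) (by positivity), Real.log_pow, mul_assoc]
  gcongr
  push_cast
  have h2 : Real.log (2 * p) ≤ Real.log (2 * p) / Real.log 2 * Real.log n := by
    rw [div_mul_eq_mul_div, le_div_iff₀ hl2]; gcongr
  linarith

end Rate

/-- The root mean squared error from a tail bound at level `1 / n` and a deterministic bound. -/
lemma sqrt_le_log_rate {n : ℕ} (hn : 2 ≤ n) {d Λ c K b V : ℝ} (hd : 0 < d) (hΛ : 0 < Λ)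
    (hΛc : Λ ≤ c * Real.log n) (hK : 0 ≤ K) (hb : 0 ≤ b)
    (h1 : Λ ≤ n → V ≤ (K * (n / Λ) ^ (-1 / (d + 2))) ^ 2 + b ^ 2 * (1 / n)) (h2 : V ≤ b ^ 2) :
    √V ≤ ((K + b) * c ^ (1 / (d + 2)) + b * (Real.log 2 ^ (1 / (d + 2)))⁻¹ + 1) *
      Real.log n ^ (1 / (d + 2)) * (n : ℝ) ^ (-1 / (d + 2)) := by
  have hn' : (2 : ℝ) ≤ n := by exact_mod_cast hn
  have hn0 : (0 : ℝ) < n := by linarith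
  have hl2 := Real.log_pos one_lt_two
  have hlog : Real.log 2 ≤ Real.log n := Real.log_le_log two_pos hn'
  have hlogn : 0 < Real.log n := hl2.trans_le hlog
  have hc : 0 < c := by
    by_contra! hc
    nlinarith
  have he : 0 < 1 / (d + 2) := by positivity
  have hneg : -1 / (d + 2) = -(1 / (d + 2)) := by ring
  rw [hneg]
  rw [hneg] at h1
  set e := 1 / (d + 2) with hedef
  have hrate0 : 0 < (n : ℝ) ^ (-e) := Real.rpow_pos_of_pos hn0 _
  have hloge : 0 < Real.log n ^ e := Real.rpow_pos_of_pos hlogn _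
  have hce : 0 < c ^ e := Real.rpow_pos_of_pos hc _
  have hl2e : 0 < Real.log 2 ^ e := Real.rpow_pos_of_pos hl2 _
  have hX : (n / Λ) ^ (-e) ≤ c ^ e * Real.log n ^ e * (n : ℝ) ^ (-e) := by
    rw [Real.rpow_neg (by positivity), ← Real.inv_rpow (by positivity), inv_div,
      Real.rpow_neg hn0.le, ← div_eq_mul_inv, ← Real.mul_rpow hc.le hlogn.le,
      ← Real.div_rpow (by positivity) hn0.le]
    gcongr
  set W := Real.log n ^ e * (n : ℝ) ^ (-e) with hW
  have hW0 : 0 < W := by positivity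
  have hX' : (n / Λ) ^ (-e) ≤ c ^ e * W := by rw [hW, ← mul_assoc]; exact hX
  rw [mul_assoc, ← hW]
  rcases le_or_gt Λ n with hcase | hcase
  · have h3 : √V ≤ K * (n / Λ) ^ (-e) + b * (n : ℝ) ^ (-e) := by
      -- As `e ≤ 1 / 2`, the contribution of the exceptional event, of probability 1/n, is no larger
      -- than the squared rate.
      have h4 : 1 / (n : ℝ) ≤ ((n : ℝ) ^ (-e)) ^ 2 := by
        rw [← Real.rpow_natCast, ← Real.rpow_mul hn0.le, one_div, ← Real.rpow_neg_one]
        refine Real.rpow_le_rpow_of_exponent_le (by linarith) ?_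
        have : e ≤ 1 / 2 := by rw [hedef]; gcongr; linarith
        push_cast; linarith
      have h5 : 0 ≤ (n / Λ) ^ (-e) := by positivity
      rw [Real.sqrt_le_left (by positivity)]
      refine (h1 hcase).trans ?_
      have h6 : b ^ 2 * (1 / n) ≤ b ^ 2 * ((n : ℝ) ^ (-e)) ^ 2 := by gcongr
      nlinarith [mul_nonneg (mul_nonneg hK h5) (mul_nonneg hb hrate0.le)]
    have h7 : (n : ℝ) ^ (-e) ≤ (Real.log 2 ^ e)⁻¹ * W := by
      rw [hW, ← mul_assoc]
      refine le_mul_of_one_le_left hrate0.le ?_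
      rw [inv_mul_eq_div, one_le_div hl2e]
      gcongr
    calc √V ≤ K * (c ^ e * W) + b * ((Real.log 2 ^ e)⁻¹ * W) := h3.trans (by gcongr)
      _ ≤ K * (c ^ e * W) + b * ((Real.log 2 ^ e)⁻¹ * W) + (b * c ^ e + 1) * W :=
          le_add_of_nonneg_right (by positivity)
      _ = _ := by ring
  -- Here the rate bound is unavailable, but `c ^ e * W ≥ 1`, so the deterministic bound is enough.
  · have h3 : √V ≤ b := by rw [Real.sqrt_le_left hb]; exact h2
    have h4 : 1 ≤ (n / Λ) ^ (-e) :=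
      Real.one_le_rpow_of_pos_of_le_one_of_nonpos (by positivity)
        ((div_le_one hΛ).2 hcase.le) (by linarith)
    have h5 : 1 ≤ c ^ e * W := h4.trans hX'
    calc √V ≤ b * 1 := by linarith
      _ ≤ b * (c ^ e * W) := by gcongr
      _ ≤ b * (c ^ e * W) + (K * c ^ e + b * (Real.log 2 ^ e)⁻¹ + 1) * W :=
          le_add_of_nonneg_right (by positivity)
      _ = _ := by ring

end

theorem mainTheorem7 (k : ℕ) (hk : 1 ≤ k) (d C r q Δ lam Lm ψmax Cb : ℝ)
    (hd : 0 < d) (hr : 0 < r) (hq : 0 < q) (hΔ : 0 < Δ) (hlam : 0 < lam) :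
    (∃ K : ℝ, 0 < K ∧
      ∀ (D p n : ℕ) (𝒴 : Type u) [MeasurableSpace 𝒴] (Ω : Type v) [MeasurableSpace Ω]
        (Pr : Measure Ω) [IsProbabilityMeasure Pr]
        (P : Measure (Euc D × 𝒴)) (𝒳 : Set (Euc D)) (x : Euc D) (Θ : Set (Euc p))
        (ψ : Euc D × 𝒴 → Euc p → Euc p) (m : Euc D → Euc p → Euc p) (θ₀ : Euc p)
        (Z : Fin n → Ω → Euc D × 𝒴) (B : ℕ → ℕ)
        (S : (s : ℕ) → Fin (B s) → Ω → Finset (Fin n)) (θhat : Ω → Euc p) (δ : ℝ),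
        1 ≤ p → k ≤ n → 0 < δ → δ ≤ 1 →
        MomentModel d C r q Δ lam Lm ψmax Cb P 𝒳 x Θ ψ m θ₀ →
        SubsampledData k Pr P Z B S →
        IsAdaptiveKnnEstimator k Δ δ Pr x Θ ψ Z B S θhat →
        1 - 2 * δ ≤ Pr.real {ω | ‖θhat ω - θ₀‖ ≤
            K * threshold Δ p n δ (oracleSize (P.map Prod.fst) k p n Δ δ x)} ∧
        (p * Real.log (2 * p * n / δ) ≤ n →
          threshold Δ p n δ (oracleSize (P.map Prod.fst) k p n Δ δ x) ≤
              K * (n / (p * Real.log (2 * p * n / δ))) ^ (-1 / (d + 2)) ∧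
          1 - 2 * δ ≤ Pr.real {ω | ‖θhat ω - θ₀‖ ≤
              K * (n / (p * Real.log (2 * p * n / δ))) ^ (-1 / (d + 2))})) ∧
    (∀ p : ℕ, 1 ≤ p → ∃ K a : ℝ, 0 < K ∧
      ∀ (D n : ℕ) (𝒴 : Type u) [MeasurableSpace 𝒴] (Ω : Type v) [MeasurableSpace Ω]
        (Pr : Measure Ω) [IsProbabilityMeasure Pr]
        (P : Measure (Euc D × 𝒴)) (𝒳 : Set (Euc D)) (x : Euc D) (Θ : Set (Euc p))
        (ψ : Euc D × 𝒴 → Euc p → Euc p) (m : Euc D → Euc p → Euc p) (θ₀ : Euc p)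
        (Z : Fin n → Ω → Euc D × 𝒴) (B : ℕ → ℕ)
        (S : (s : ℕ) → Fin (B s) → Ω → Finset (Fin n)) (θhat : Ω → Euc p),
        2 ≤ n → k ≤ n →
        MomentModel d C r q Δ lam Lm ψmax Cb P 𝒳 x Θ ψ m θ₀ →
        SubsampledData k Pr P Z B S →
        IsAdaptiveKnnEstimator k Δ (1 / (n : ℝ)) Pr x Θ ψ Z B S θhat →
        Integrable (fun ω => ‖θhat ω - θ₀‖ ^ 2) Pr ∧
        √(∫ ω, ‖θhat ω - θ₀‖ ^ 2 ∂Pr) ≤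
          K * Real.log n ^ a * (n : ℝ) ^ (-1 / (d + 2))) := by
  have hK1 : 0 ≤ oracleConst Δ lam Lm ψmax Cb := oracleConst_nonneg hΔ hlam
  have hK2 : 0 ≤ rateConst k d C r q Δ := rateConst_nonneg hd hr hq hΔ
  generalize hK1' : oracleConst Δ lam Lm ψmax Cb = K₁ at hK1
  generalize hK2' : rateConst k d C r q Δ = K₂ at hK2
  -- One constant dominates `K₁`, `K₂` and `K₁ * K₂`, for the oracle inequality, the oracle
  -- threshold and the rate; the 1 makes it positive.
  refine ⟨⟨K₁ + K₂ + K₁ * K₂ + 1, by positivity, ?_⟩, fun p hp => ?_⟩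
  · intro D p n 𝒴 _ Ω _ Pr _ P 𝒳 x Θ ψ m θ₀ Z B S θhat δ hp hkn hδ hδ1 hM hS hθ
    have htail := measure_adaptive_error_le hΔ hlam hk hkn hp hδ hδ1 hM hS hθ
    rw [hK1'] at htail
    have hG := threshold_nonneg (δ := δ) (p := p) (n := n)
      (s := oracleSize (P.map Prod.fst) k p n Δ δ x) hΔ.le
    have hL : 0 ≤ Real.log (2 * p * n / δ) :=
      (Real.log_nonneg one_le_two).trans (log_two_le_log hp (hk.trans hkn) hδ hδ1)
    refine ⟨one_sub_two_mul_le hθ.measurable hδ.le ?_ htail, fun hρ => ?_⟩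
    · exact mul_le_mul_of_nonneg_right (by nlinarith [mul_nonneg hK1 hK2]) hG
    have hrate := hM.threshold_oracleSize_le hd hr hq hΔ hk hkn hp hδ hδ1 hρ
    rw [hK2'] at hrate
    have hR : 0 ≤ ((n : ℝ) / (p * Real.log (2 * p * n / δ))) ^ (-1 / (d + 2)) := by positivity
    refine ⟨hrate.trans (mul_le_mul_of_nonneg_right (by nlinarith [mul_nonneg hK1 hK2]) hR),
      one_sub_two_mul_le hθ.measurable hδ.le ?_ htail⟩
    refine (mul_le_mul_of_nonneg_left hrate hK1).trans ?_
    rw [← mul_assoc]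
    exact mul_le_mul_of_nonneg_right (by linarith) hR
  · have hb : 0 ≤ (|Lm| * Δ + √p * |ψmax|) / lam := by positivity
    have hlp : 0 ≤ Real.log (2 * p) := Real.log_nonneg (by
      have : (1 : ℝ) ≤ p := by exact_mod_cast hp
      linarith)
    have hl2 := Real.log_pos one_lt_two
    refine ⟨(K₁ * K₂ + (|Lm| * Δ + √p * |ψmax|) / lam) *
        (p * (Real.log (2 * p) / Real.log 2 + 2)) ^ (1 / (d + 2)) +
        (|Lm| * Δ + √p * |ψmax|) / lam * (Real.log 2 ^ (1 / (d + 2)))⁻¹ + 1, 1 / (d + 2),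
      by positivity, ?_⟩
    intro D n 𝒴 _ Ω _ Pr _ P 𝒳 x Θ ψ m θ₀ Z B S θhat hn hkn hM hS hθ
    have hn0 : (0 : ℝ) < n := by exact_mod_cast two_pos.trans_le hn
    have hδ : 0 < 1 / (n : ℝ) := by positivity
    have hδ1 : 1 / (n : ℝ) ≤ 1 := by
      rw [div_le_one hn0]
      exact_mod_cast one_le_two.trans hn
    have htail := measure_adaptive_error_le hΔ hlam hk hkn hp hδ hδ1 hM hS hθ
    rw [hK1'] at htail
    have hL : 0 < Real.log (2 * p * n / (1 / (n : ℝ))) :=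
      hl2.trans_le (log_two_le_log hp (hk.trans hkn) hδ hδ1)
    have hΛ : 0 < p * Real.log (2 * p * n / (1 / (n : ℝ))) :=
      mul_pos (by exact_mod_cast hp) hL
    have hbound : ∀ᵐ ω ∂Pr, ‖θhat ω - θ₀‖ ≤ (|Lm| * Δ + √p * |ψmax|) / lam :=
      hθ.mem.mono fun ω hω => hM.norm_sub_le hΔ.le hlam hω
    have hmeas : Measurable fun ω => ‖θhat ω - θ₀‖ := (hθ.measurable.sub_const θ₀).norm
    obtain ⟨hint, hV⟩ := integral_sq_le_of_tail hmeas (fun _ => norm_nonneg _) hbound hδ.le htail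
    refine ⟨hint, sqrt_le_log_rate hn hd hΛ (mul_log_le hp hn) (mul_nonneg hK1 hK2) hb
      (fun hρ => hV.trans ?_) ?_⟩
    · have hrate := hM.threshold_oracleSize_le hd hr hq hΔ hk hkn hp hδ hδ1 hρ
      rw [hK2'] at hrate
      have hG := threshold_nonneg (δ := 1 / (n : ℝ)) (p := p) (n := n)
        (s := oracleSize (P.map Prod.fst) k p n Δ (1 / (n : ℝ)) x) hΔ.le
      rw [mul_assoc K₁ K₂]
      gcongr
    · calc ∫ ω, ‖θhat ω - θ₀‖ ^ 2 ∂Pr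
          ≤ ∫ _, ((|Lm| * Δ + √p * |ψmax|) / lam) ^ 2 ∂Pr :=
            integral_mono_ae hint (integrable_const _)
              (hbound.mono fun ω hω => pow_le_pow_left₀ (norm_nonneg _) hω 2)
        _ = _ := by simp
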